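/- Let $\Gamma=SL(2,\mathbb Z)$ act on integral binary cubic forms $x(u,v)=x_0u^3+x_1u^2v+x_2uv^2+x_3v^3$ by $(\gamma x)(u,v)=x((u,v)\gamma)$, let $\Gamma_x$ be the stabilizer of $x$, and let $$\mathrm{disc}(x)=x_1^2x_2^2+18x_0x_1x_2x_3-4x_0x_2^3-4x_1^3x_3-27x_0^2x_3^2 .$$ Let $L^\vee_{+}$ (resp. $L^\vee_-$) be the set of integral binary cubic forms with $3\mid x_1$, $3\mid x_2$ and $\mathrm{disc}(x)>0$ (resp. $<0$), and put $$\xi_1^\vee(s)=\sum_{x\in\Gamma\backslash L^\vee_+}\frac1{|\Gamma_x|}\,|\mathrm{disc}(x)/27|^{-s},\qquad \xi_2^\vee(s)=\sum_{x\in\Gamma\backslash L^\vee_-}|\mathrm{disc}(x)/27|^{-s}.$$ For $k$ a quadratic field or $k=\mathbb Q^2=\mathbb Q\times\mathbb Q$, let $\mathcal O_k$ be its maximal order, $\mathcal O_{k,c}=\mathbb Z\cdot 1+c\,\mathcal O_k$ its order of conductor $c\ge1$, and $Cl_{k,c}$ the class group of $\mathcal O_{k,c}$, i.e. the group of invertible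 fractional $\mathcal O_{k,c}$-ideals modulo the principal ideals $\alpha\mathcal O_{k,c}$, $\alpha\in k^*$. Write $Cl_{k,c}^\vee=\mathrm{Hom}(Cl_{k,c},\mathbb C^*)$ and, for $\chi\in Cl_{k,c}^\vee$, $$L(w,\chi,\mathcal O_{k,c})=\sum_{\mathfrak a}\chi([\mathfrak a])\,[\mathcal O_{k,c}:\mathfrak a]^{-w},$$ where $\mathfrak a$ runs over the integral invertible ideals of $\mathcal O_{k,c}$. Let $\Delta_k$ be the discriminant of $k$. **Theorem 3.3.** For every complex $s$ with $\mathrm{Re}(s)>1$, the class groups $Cl_{k,c}$ are finite, all the series below converge absolutely (including the double series over $(k,c)$), and $$\xi_1^\vee(s)=\sum_{k\text{ imaginary quadratic}}\frac1{|\Delta_k|^s}\sum_{c=1}^\infty\frac1{c^{2s}}\sum_{\chi\in Cl_{k,c}^\vee,\ \chi^3=1}L(2s,\chi,\mathcal O_{k,c}),$$ $$\xi_2^\vee(s)=\sum_{k\text{ real quadratic}}\frac3{|\Delta_k|^s}\sum_{c=1}^\infty\frac1{c^{2s}}\sum_{\chi\in Cl_{k,c}^\vee,\ \chi^3=1}L(2s,\chi,\mathcal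 O_{k,c})+\sum_{c=1}^\infty\frac1{c^{2s}}\sum_{\chi\in Cl_{\mathbb Q^2,c}^\vee,\ \chi^3=1}L(2s,\chi,\mathcal O_{\mathbb Q^2,c}),$$ where $k$ runs over quadratic fields up to isomorphism. -/

import Mathlib

open scoped MatrixGroups

/-! ### Integral binary cubic forms and the action of `SL(2, ℤ)` -/

/-- The integral binary cubic form `x₀ u³ + x₁ u² v + x₂ u v² + x₃ v³`. -/
@[ext]
structure BinaryCubicForm where
  x₀ : ℤ
  x₁ : ℤ
  x₂ : ℤ
  x₃ : ℤ

namespace BinaryCubicForm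

/-- The value `x(u, v)`. -/
def eval (x : BinaryCubicForm) (u v : ℤ) : ℤ :=
  x.x₀ * u ^ 3 + x.x₁ * u ^ 2 * v + x.x₂ * u * v ^ 2 + x.x₃ * v ^ 3

/-- The discriminant of a binary cubic form. -/
def disc (x : BinaryCubicForm) : ℤ :=
  x.x₁ ^ 2 * x.x₂ ^ 2 + 18 * x.x₀ * x.x₁ * x.x₂ * x.x₃
    - 4 * x.x₀ * x.x₂ ^ 3 - 4 * x.x₁ ^ 3 * x.x₃ - 27 * x.x₀ ^ 2 * x.x₃ ^ 2

/-- The coefficients of the form `x((u, v) γ) = x(a u + c v, b u + d v)` for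
`γ = !![a, b; c, d]`; see `eval_smul`. -/
instance : SMul SL(2, ℤ) BinaryCubicForm where
  smul γ x :=
    { x₀ := x.x₀ * γ 0 0 ^ 3 + x.x₁ * γ 0 0 ^ 2 * γ 0 1 + x.x₂ * γ 0 0 * γ 0 1 ^ 2
        + x.x₃ * γ 0 1 ^ 3
      x₁ := 3 * x.x₀ * γ 0 0 ^ 2 * γ 1 0
        + x.x₁ * (γ 0 0 ^ 2 * γ 1 1 + 2 * γ 0 0 * γ 0 1 * γ 1 0)
        + x.x₂ * (2 * γ 0 0 * γ 0 1 * γ 1 1 + γ 0 1 ^ 2 * γ 1 0)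
        + 3 * x.x₃ * γ 0 1 ^ 2 * γ 1 1
      x₂ := 3 * x.x₀ * γ 0 0 * γ 1 0 ^ 2
        + x.x₁ * (2 * γ 0 0 * γ 1 0 * γ 1 1 + γ 0 1 * γ 1 0 ^ 2)
        + x.x₂ * (γ 0 0 * γ 1 1 ^ 2 + 2 * γ 0 1 * γ 1 0 * γ 1 1)
        + 3 * x.x₃ * γ 0 1 * γ 1 1 ^ 2
      x₃ := x.x₀ * γ 1 0 ^ 3 + x.x₁ * γ 1 0 ^ 2 * γ 1 1 + x.x₂ * γ 1 0 * γ 1 1 ^ 2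
        + x.x₃ * γ 1 1 ^ 3 }

theorem smul_x₀ (γ : SL(2, ℤ)) (x : BinaryCubicForm) : (γ • x).x₀ =
    x.x₀ * γ 0 0 ^ 3 + x.x₁ * γ 0 0 ^ 2 * γ 0 1 + x.x₂ * γ 0 0 * γ 0 1 ^ 2
      + x.x₃ * γ 0 1 ^ 3 := rfl

theorem smul_x₁ (γ : SL(2, ℤ)) (x : BinaryCubicForm) : (γ • x).x₁ =
    3 * x.x₀ * γ 0 0 ^ 2 * γ 1 0
      + x.x₁ * (γ 0 0 ^ 2 * γ 1 1 + 2 * γ 0 0 * γ 0 1 * γ 1 0)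
      + x.x₂ * (2 * γ 0 0 * γ 0 1 * γ 1 1 + γ 0 1 ^ 2 * γ 1 0)
      + 3 * x.x₃ * γ 0 1 ^ 2 * γ 1 1 := rfl

theorem smul_x₂ (γ : SL(2, ℤ)) (x : BinaryCubicForm) : (γ • x).x₂ =
    3 * x.x₀ * γ 0 0 * γ 1 0 ^ 2
      + x.x₁ * (2 * γ 0 0 * γ 1 0 * γ 1 1 + γ 0 1 * γ 1 0 ^ 2)
      + x.x₂ * (γ 0 0 * γ 1 1 ^ 2 + 2 * γ 0 1 * γ 1 0 * γ 1 1)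
      + 3 * x.x₃ * γ 0 1 * γ 1 1 ^ 2 := rfl

theorem smul_x₃ (γ : SL(2, ℤ)) (x : BinaryCubicForm) : (γ • x).x₃ =
    x.x₀ * γ 1 0 ^ 3 + x.x₁ * γ 1 0 ^ 2 * γ 1 1 + x.x₂ * γ 1 0 * γ 1 1 ^ 2
      + x.x₃ * γ 1 1 ^ 3 := rfl

/-- `(γ x)(u, v) = x((u, v) γ)`. -/
theorem eval_smul (γ : SL(2, ℤ)) (x : BinaryCubicForm) (u v : ℤ) :
    (γ • x).eval u v = x.eval (u * γ 0 0 + v * γ 1 0) (u * γ 0 1 + v * γ 1 1) := by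
  simp only [eval, smul_x₀, smul_x₁, smul_x₂, smul_x₃]
  ring

instance : MulAction SL(2, ℤ) BinaryCubicForm where
  one_smul x := by
    ext <;> simp [smul_x₀, smul_x₁, smul_x₂, smul_x₃]
  mul_smul γ δ x := by
    ext <;> simp only [smul_x₀, smul_x₁, smul_x₂, smul_x₃, Matrix.SpecialLinearGroup.coe_mul,
      Matrix.mul_apply, Fin.sum_univ_two] <;> ring

theorem disc_smul (γ : SL(2, ℤ)) (x : BinaryCubicForm) : (γ • x).disc = x.disc := by
  have h : γ 0 0 * γ 1 1 - γ 0 1 * γ 1 0 = 1 := by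
    have := γ.det_coe
    rwa [Matrix.det_fin_two] at this
  have h6 : (γ • x).disc = (γ 0 0 * γ 1 1 - γ 0 1 * γ 1 0) ^ 6 * x.disc := by
    simp only [disc, smul_x₀, smul_x₁, smul_x₂, smul_x₃]
    ring
  rw [h6, h, one_pow, one_mul]

/-- Membership in the dual lattice: the middle coefficients are divisible by `3`. -/
def IsDual (x : BinaryCubicForm) : Prop := 3 ∣ x.x₁ ∧ 3 ∣ x.x₂

theorem IsDual.smul {x : BinaryCubicForm} (hx : x.IsDual) (γ : SL(2, ℤ)) : (γ • x).IsDual := by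
  obtain ⟨⟨p, hp⟩, ⟨q, hq⟩⟩ := hx
  constructor
  · rw [smul_x₁, hp, hq]
    exact ⟨x.x₀ * γ 0 0 ^ 2 * γ 1 0
      + p * (γ 0 0 ^ 2 * γ 1 1 + 2 * γ 0 0 * γ 0 1 * γ 1 0)
      + q * (2 * γ 0 0 * γ 0 1 * γ 1 1 + γ 0 1 ^ 2 * γ 1 0)
      + x.x₃ * γ 0 1 ^ 2 * γ 1 1, by ring⟩
  · rw [smul_x₂, hp, hq]
    exact ⟨x.x₀ * γ 0 0 * γ 1 0 ^ 2
      + p * (2 * γ 0 0 * γ 1 0 * γ 1 1 + γ 0 1 * γ 1 0 ^ 2)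
      + q * (γ 0 0 * γ 1 1 ^ 2 + 2 * γ 0 1 * γ 1 0 * γ 1 1)
      + x.x₃ * γ 0 1 * γ 1 1 ^ 2, by ring⟩

/-- The forms of positive discriminant in the dual lattice, with the action of `SL(2, ℤ)`. -/
def dualPos : SubMulAction SL(2, ℤ) BinaryCubicForm where
  carrier := {x | x.IsDual ∧ 0 < x.disc}
  smul_mem' γ x hx := ⟨hx.1.smul γ, by rw [disc_smul]; exact hx.2⟩

/-- The forms of negative discriminant in the dual lattice, with the action of `SL(2, ℤ)`. -/
def dualNeg : SubMulAction SL(2, ℤ) BinaryCubicForm where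
  carrier := {x | x.IsDual ∧ x.disc < 0}
  smul_mem' γ x hx := ⟨hx.1.smul γ, by rw [disc_smul]; exact hx.2⟩

/-- The order `|Γ_x|` of the stabilizer of `x` in `Γ = SL(2, ℤ)`. -/
noncomputable def stabCard (x : BinaryCubicForm) : ℕ :=
  Nat.card (MulAction.stabilizer SL(2, ℤ) x)

theorem stabCard_smul (γ : SL(2, ℤ)) (x : BinaryCubicForm) :
    (γ • x).stabCard = x.stabCard :=
  Nat.card_congr (MulAction.stabilizerEquivStabilizerOfOrbitRel
    (G := SL(2, ℤ)) (a := γ • x) (b := x) ⟨γ, rfl⟩).toEquiv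

/-- `|disc(x) / 27| ^ (-s)`. -/
noncomputable def discPow (s : ℂ) (x : BinaryCubicForm) : ℂ :=
  ((|(x.disc : ℝ) / 27| : ℝ) : ℂ) ^ (-s)

end BinaryCubicForm

/-! ### The two dual Shintani zeta functions -/

/-- The summand `|Γ_x|⁻¹ |disc(x)/27|^(-s)` of the orbit of `x`, for positive discriminant. -/
noncomputable def shintaniDualTerm₁ (s : ℂ)
    (ω : MulAction.orbitRel.Quotient SL(2, ℤ) BinaryCubicForm.dualPos) : ℂ :=
  Quotient.liftOn' ω
    (fun x => 1 / (x.1.stabCard : ℂ) * x.1.discPow s) (by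
      rintro _ y ⟨γ, rfl⟩
      simp only [SubMulAction.val_smul, BinaryCubicForm.stabCard_smul, BinaryCubicForm.discPow,
        BinaryCubicForm.disc_smul])

/-- The summand `|disc(x)/27|^(-s)` of the orbit of `x`, for negative discriminant. -/
noncomputable def shintaniDualTerm₂ (s : ℂ)
    (ω : MulAction.orbitRel.Quotient SL(2, ℤ) BinaryCubicForm.dualNeg) : ℂ :=
  Quotient.liftOn' ω (fun x => x.1.discPow s) (by
      rintro _ y ⟨γ, rfl⟩
      simp only [SubMulAction.val_smul, BinaryCubicForm.discPow, BinaryCubicForm.disc_smul])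

/-- `ξ₁^∨(s)`. -/
noncomputable def shintaniDual₁ (s : ℂ) : ℂ := ∑' ω, shintaniDualTerm₁ s ω

/-- `ξ₂^∨(s)`. -/
noncomputable def shintaniDual₂ (s : ℂ) : ℂ := ∑' ω, shintaniDualTerm₂ s ω

/-! ### Orders, invertible ideals, class groups and `L`-series

`A` is a commutative `ℚ`-algebra (below a quadratic field or `ℚ × ℚ`); its maximal order is
`integralClosure ℤ A`. -/

/-- The order `𝒪_{A,m} = ℤ·1 + m 𝒪_A`. -/
def conductorOrder (A : Type*) [CommRing A] (m : ℕ+) : Subring A where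
  carrier := {z | ∃ n : ℤ, ∃ w ∈ integralClosure ℤ A, z = (n : A) + ((m : ℕ) : A) * w}
  zero_mem' := ⟨0, 0, zero_mem _, by simp⟩
  one_mem' := ⟨1, 0, zero_mem _, by simp⟩
  add_mem' := by
    rintro _ _ ⟨n, w, hw, rfl⟩ ⟨n', w', hw', rfl⟩
    exact ⟨n + n', w + w', add_mem hw hw', by push_cast; ring⟩
  neg_mem' := by
    rintro _ ⟨n, w, hw, rfl⟩
    exact ⟨-n, -w, neg_mem hw, by push_cast; ring⟩
  mul_mem' := by
    rintro _ _ ⟨n, w, hw, rfl⟩ ⟨n', w', hw', rfl⟩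
    refine ⟨n * n', (n : A) * w' + (n' : A) * w + ((m : ℕ) : A) * (w * w'), ?_, by
      push_cast; ring⟩
    exact add_mem (add_mem (mul_mem (intCast_mem _ n) hw') (mul_mem (intCast_mem _ n') hw))
      (mul_mem (natCast_mem _ (m : ℕ)) (mul_mem hw hw'))

/-- The group `I(𝒪)` of invertible `𝒪`-ideals of `A`: the units of the multiplicative monoid of
`𝒪`-submodules of `A`, whose identity is `𝒪` itself. (For an order `𝒪` of `A` such a submodule is
automatically a finitely generated `ℤ`-module of full rank.) -/
abbrev InvertibleIdeal {A : Type*} [CommRing A] (O : Subring A) : Type _ := (Submodule O A)ˣ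

/-- The subgroup `P(𝒪)` of the principal ideals `α 𝒪` with `α ∈ Aˣ`. -/
noncomputable def principalIdeals {A : Type*} [CommRing A] (O : Subring A) :
    Subgroup (InvertibleIdeal O) :=
  (Units.map (Submodule.spanSingleton (A := A) O).toMonoidHom).range

/-- The ideal class group `Cl(𝒪) = I(𝒪) / P(𝒪)`. -/
abbrev OrderClassGroup {A : Type*} [CommRing A] (O : Subring A) : Type _ :=
  InvertibleIdeal O ⧸ principalIdeals O

/-- The integral invertible ideals, i.e. those contained in `𝒪`. -/
def IntegralIdeal {A : Type*} [CommRing A] (O : Subring A) : Type _ :=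
  {I : InvertibleIdeal O // (I : Submodule O A) ≤ 1}

/-- The norm `𝐍 𝔞 = [𝒪 : 𝔞]` of an integral invertible ideal. -/
noncomputable def IntegralIdeal.norm {A : Type*} [CommRing A] {O : Subring A}
    (I : IntegralIdeal O) : ℕ :=
  (I.1 : Submodule O A).toAddSubgroup.relIndex (1 : Submodule O A).toAddSubgroup

/-- The ideal class `[𝔞]` of an integral invertible ideal. -/
noncomputable def IntegralIdeal.cls {A : Type*} [CommRing A] {O : Subring A}
    (I : IntegralIdeal O) : OrderClassGroup O :=
  QuotientGroup.mk I.1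

/-- The summand `χ(𝔞) 𝐍𝔞^(-w)`. -/
noncomputable def orderLTerm {A : Type*} [CommRing A] {O : Subring A}
    (χ : OrderClassGroup O →* ℂˣ) (w : ℂ) (I : IntegralIdeal O) : ℂ :=
  (χ I.cls : ℂ) * (I.norm : ℂ) ^ (-w)

/-- `L(w, χ, 𝒪) = ∑ χ(𝔞) 𝐍𝔞^(-w)`, over all integral invertible ideals `𝔞` of `𝒪`. -/
noncomputable def orderLSeries {A : Type*} [CommRing A] {O : Subring A}
    (χ : OrderClassGroup O →* ℂˣ) (w : ℂ) : ℂ :=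
  ∑' I : IntegralIdeal O, orderLTerm χ w I

/-- The characters `χ` of `Cl(𝒪)` with `χ³ = 1`. -/
abbrev CubicCharacter {A : Type*} [CommRing A] (O : Subring A) : Type _ :=
  {χ : OrderClassGroup O →* ℂˣ // χ ^ 3 = 1}

/-- `∑_{χ ∈ Cl(𝒪)^∨, χ³ = 1} L(w, χ, 𝒪)` for `𝒪 = 𝒪_{A,c}`. -/
noncomputable def cubicLSum (A : Type*) [CommRing A] (c : ℕ+) (w : ℂ) : ℂ :=
  ∑' χ : CubicCharacter (conductorOrder A c), orderLSeries χ.1 w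

/-- All the sums inside `cubicLSum A c w` are genuine: the class group is finite (so there are
finitely many characters) and each `L`-series converges absolutely at `w`. -/
def CubicLSumConverges (A : Type*) [CommRing A] (c : ℕ+) (w : ℂ) : Prop :=
  Finite (OrderClassGroup (conductorOrder A c)) ∧
    ∀ χ : CubicCharacter (conductorOrder A c), Summable (orderLTerm χ.1 w)

/-! ### Quadratic fields -/

/-- The quadratic fields, each realized as a subfield of `ℂ`: every isomorphism class of quadratic
extensions of `ℚ` contains exactly one subfield of `ℂ`. -/
abbrev QuadraticField : Type := {k : IntermediateField ℚ ℂ // Module.finrank ℚ k = 2}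

instance (k : QuadraticField) : NumberField k.1 where
  to_charZero := inferInstance
  to_finiteDimensional := Module.finite_of_finrank_pos (by rw [k.2]; norm_num)

/-- The imaginary quadratic fields. -/
abbrev ImaginaryQuadraticField : Type :=
  {k : QuadraticField // NumberField.IsTotallyComplex k.1}

/-- The real quadratic fields. -/
abbrev RealQuadraticField : Type :=
  {k : QuadraticField // NumberField.IsTotallyReal k.1}

/-- `|Δ_k|`, the absolute value of the discriminant, as a complex number. -/
noncomputable def QuadraticField.absDisc (k : QuadraticField) : ℂ :=
  ((|NumberField.discr k.1| : ℤ) : ℂ)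

/-!
Dual forms come from cubes in quadratic orders. Let `A` be a quadratic field or `ℚ × ℚ`, with
integral basis `1, w` and discriminant `Δ`, and let `im` be the coordinate along `w`. An invertible
ideal `I` of the order `𝒪_c` with an oriented basis `x, y`, together with a multiplier `δ ∈ Aˣ` such
that `𝔞 = δ I³` is integral, gives the form `f = im (δ (x u + y v)³) / c`. Since
`𝒪_c = {z ∈ 𝒪_A | c ∣ im z}`, integrality of `𝔞` says exactly that `f` has integral coefficients and
is dual (`IsBasis.cube_le_one_iff`), and `disc f = -27 Δ c² N(𝔞)²`.

Every dual form of nonzero discriminant arises in this way. The class of `-3 disc f` modulo squares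
selects `A` (`exists_discriminant_class`): a unique quadratic field
(`QuadraticField.exists_disc_eq`, `QuadraticField.eq_of_disc_eq`), or `ℚ × ℚ` when it is trivial.
The Hessian of `f` is proportional to the norm form of the lattice `ℤ x + ℤ y`, so `x, y` can be
read off from it (`QuadraticCoords.exists_isFormOf`) and are determined up to a common factor
`κ ∈ Aˣ`, with `δ` determined up to `κ⁻³` (`IsFormOf.unique`). A lattice is an invertible ideal of
its multiplier ring, which is some `𝒪_c` (`exists_invertibleIdeal`). Changing the oriented basis
moves `f` in its `SL(2, ℤ)`-orbit, and the stabilizer of `f` consists of the multiplications by the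
`u ∈ 𝒪_cˣ` with `u³ = 1` (`Attached.stabCard_eq`). So the orbits belonging to `A` correspond to
quadruples of a conductor `c`, an integral invertible ideal `𝔞` of `𝒪_c`, a class `C` with
`C³ = [𝔞]`, and an element of `𝒪_cˣ` modulo cubes (`exists_parametrization`).

It remains to sum `(|Δ| c² N(𝔞)²) ^ (-s)` over these quadruples. By orthogonality of characters
(`tsum_cubic_characters`) the number of `C` is `∑_{χ³ = 1} χ([𝔞])`, which turns the sum over `𝔞`
into the cubic `L`-sum (`cubicLSum_eq`). The units modulo cubes give the weights. When `Δ < 0` the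
unit group is finite, with as many classes modulo cubes as cube roots of unity, and this number
cancels the order of the stabilizer (`card_quotient_cubes_of_finite`). For a real field there are
three classes, by Pell's equation and the discreteness of the logarithms of the units
(`card_units_mod_cubes_of_real`). For `ℚ × ℚ` the units square to `1`, so there is one class
(`card_quotient_cubes_of_sq_eq_one`).

Rearranging the sums requires absolute convergence over the orbits, which comes from reduction
theory (`summable_disc_rpow`). A form of nonzero discriminant is a sum of two cubes `ℓ₁³ + ℓ₂³` of
real or complex conjugate linear forms, up to the action. Reducing the definite form
`|ℓ₁|² + |ℓ₂|²` yields an equivalent form with `∏ max(1, |xᵢ|) ≪ |disc|` when `x₀ ≠ 0`; forms with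
`x₀ = 0` are reduced by a translation (`exists_reduced`). The sum over the orbits is then dominated
by products of one-variable sums `∑ max(1, |n|) ^ (-Re s)`. The absolute convergence of the
`L`-series and the finiteness of the class groups are proved separately, through lattice bases in
Hermite normal form and elements of small norm (`summable_norm_rpow`, `finite_orderClassGroup`).
-/

/-! ### Quadratic algebras in coordinates -/

/-- Coordinates on a quadratic `ℚ`-algebra `A` with respect to an integral basis `1, w` of its
maximal order, where `w ^ 2 = t * w - n`. The element `x + y w` has coordinates `(x, y)`. -/
structure QuadraticCoords (A : Type*) [CommRing A] [Algebra ℚ A] where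
  /-- the trace of `w` -/
  t : ℤ
  /-- the norm of `w` -/
  n : ℤ
  /-- the coordinate map -/
  coord : A ≃ₗ[ℚ] ℚ × ℚ
  coord_one : coord 1 = (1, 0)
  coord_mul : ∀ x y, coord (x * y) =
    ((coord x).1 * (coord y).1 - n * (coord x).2 * (coord y).2,
      (coord x).1 * (coord y).2 + (coord x).2 * (coord y).1 + t * (coord x).2 * (coord y).2)
  mem_integralClosure : ∀ z, z ∈ integralClosure ℤ A ↔
    (∃ a : ℤ, (coord z).1 = a) ∧ ∃ b : ℤ, (coord z).2 = b
  disc_ne_zero : t ^ 2 - 4 * n ≠ 0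

lemma mem_one_iff_mem_order {A : Type*} [CommRing A] {O : Subring A} (z : A) :
    z ∈ (1 : Submodule O A) ↔ z ∈ O :=
  Submodule.mem_one.trans ⟨fun ⟨r, h⟩ => h ▸ r.2, fun h => ⟨⟨z, h⟩, rfl⟩⟩

namespace QuadraticCoords

variable {A : Type*} [CommRing A] [Algebra ℚ A] (B : QuadraticCoords A)

/-- The coefficient of `1`. -/
def re (z : A) : ℚ := (B.coord z).1

/-- The coefficient of `w`. -/
def im (z : A) : ℚ := (B.coord z).2

/-- The element `x + y w`. -/
def elt (x y : ℚ) : A := B.coord.symm (x, y)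

/-- The discriminant of the maximal order. -/
def disc : ℤ := B.t ^ 2 - 4 * B.n

@[simp] lemma re_elt (x y : ℚ) : B.re (B.elt x y) = x := by simp [re, elt]
@[simp] lemma im_elt (x y : ℚ) : B.im (B.elt x y) = y := by simp [im, elt]

lemma ext {x y : A} (h₁ : B.re x = B.re y) (h₂ : B.im x = B.im y) : x = y :=
  B.coord.injective (Prod.ext h₁ h₂)

@[simp] lemma re_zero : B.re 0 = 0 := by simp [re]
@[simp] lemma im_zero : B.im 0 = 0 := by simp [im]
@[simp] lemma re_one : B.re 1 = 1 := by simp [re, B.coord_one]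
@[simp] lemma im_one : B.im 1 = 0 := by simp [im, B.coord_one]
@[simp] lemma re_add (x y : A) : B.re (x + y) = B.re x + B.re y := by simp [re]
@[simp] lemma im_add (x y : A) : B.im (x + y) = B.im x + B.im y := by simp [im]
@[simp] lemma re_sub (x y : A) : B.re (x - y) = B.re x - B.re y := by simp [re]
@[simp] lemma im_sub (x y : A) : B.im (x - y) = B.im x - B.im y := by simp [im]
@[simp] lemma re_neg (x : A) : B.re (-x) = -B.re x := by simp [re]
@[simp] lemma im_neg (x : A) : B.im (-x) = -B.im x := by simp [im]
@[simp] lemma re_mul (x y : A) :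
    B.re (x * y) = B.re x * B.re y - B.n * B.im x * B.im y := by simp [re, im, B.coord_mul]
@[simp] lemma im_mul (x y : A) :
    B.im (x * y) = B.re x * B.im y + B.im x * B.re y + B.t * B.im x * B.im y := by
  simp [re, im, B.coord_mul]

@[simp] lemma re_algebraMap (q : ℚ) : B.re (algebraMap ℚ A q) = q := by
  rw [Algebra.algebraMap_eq_smul_one]; simp [re, B.coord_one]
@[simp] lemma im_algebraMap (q : ℚ) : B.im (algebraMap ℚ A q) = 0 := by
  rw [Algebra.algebraMap_eq_smul_one]; simp [im, B.coord_one]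
@[simp] lemma re_intCast (m : ℤ) : B.re (m : A) = m := by
  rw [← map_intCast (algebraMap ℚ A), re_algebraMap]
@[simp] lemma im_intCast (m : ℤ) : B.im (m : A) = 0 := by
  rw [← map_intCast (algebraMap ℚ A), im_algebraMap]
@[simp] lemma re_natCast (m : ℕ) : B.re (m : A) = m := by
  rw [← map_natCast (algebraMap ℚ A), re_algebraMap]
@[simp] lemma im_natCast (m : ℕ) : B.im (m : A) = 0 := by
  rw [← map_natCast (algebraMap ℚ A), im_algebraMap]

/-- The conjugate of an element. -/
def conj (z : A) : A := B.elt (B.re z + B.t * B.im z) (-B.im z)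

@[simp] lemma re_conj (z : A) : B.re (B.conj z) = B.re z + B.t * B.im z := by simp [conj]
@[simp] lemma im_conj (z : A) : B.im (B.conj z) = -B.im z := by simp [conj]

@[simp] lemma conj_conj (z : A) : B.conj (B.conj z) = z := by
  apply B.ext <;> simp

lemma conj_mul (x y : A) : B.conj (x * y) = B.conj x * B.conj y := by
  apply B.ext <;> simp <;> ring

lemma conj_add (x y : A) : B.conj (x + y) = B.conj x + B.conj y := by
  apply B.ext <;> simp <;> ring

lemma conj_intCast (m : ℤ) : B.conj (m : A) = m := by
  apply B.ext <;> simp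

/-- The norm of an element. -/
def nm (z : A) : ℚ := B.re z ^ 2 + B.t * B.re z * B.im z + B.n * B.im z ^ 2

lemma nm_mul (x y : A) : B.nm (x * y) = B.nm x * B.nm y := by
  simp only [nm, re_mul, im_mul]; ring

@[simp] lemma nm_one : B.nm 1 = 1 := by simp [nm]

lemma mul_conj (z : A) : z * B.conj z = algebraMap ℚ A (B.nm z) := by
  apply B.ext
  · rw [re_algebraMap]; simp [nm]; ring
  · rw [im_algebraMap]; simp; ring

lemma nm_conj (z : A) : B.nm (B.conj z) = B.nm z := by
  simp [nm]; ring

lemma nm_neg (z : A) : B.nm (-z) = B.nm z := by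
  simp [nm]

lemma nm_ne_zero (u : Aˣ) : B.nm u ≠ 0 := by
  intro h
  have := B.nm_mul u ↑u⁻¹
  rw [Units.mul_inv, h] at this
  simp at this

lemma isUnit_of_nm_ne_zero {z : A} (h : B.nm z ≠ 0) : IsUnit z := by
  refine IsUnit.of_mul_eq_one (B.conj z * algebraMap ℚ A (B.nm z)⁻¹) ?_
  rw [← mul_assoc, B.mul_conj, ← map_mul, mul_inv_cancel₀ h, map_one]

/-- The determinant of a pair of elements, in the coordinates. -/
def det (x y : A) : ℚ := B.re x * B.im y - B.im x * B.re y

lemma det_mul_left (z x y : A) : B.det (z * x) (z * y) = B.nm z * B.det x y := by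
  simp only [det, nm, re_mul, im_mul]; ring

lemma det_conj (x y : A) : B.det (B.conj x) (B.conj y) = - B.det x y := by
  simp [det]; ring

lemma det_comb (a b c d : ℤ) (x y : A) :
    B.det (a * x + b * y) (c * x + d * y) = (a * d - b * c) * B.det x y := by
  simp [det]; ring

/-- A pair with nonzero determinant is a rational basis. -/
lemma exists_comb {x y : A} (h : B.det x y ≠ 0) (z : A) :
    ∃ p q : ℚ, z = algebraMap ℚ A p * x + algebraMap ℚ A q * y := by
  refine ⟨B.det z y / B.det x y, B.det x z / B.det x y, ?_⟩
  apply B.ext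
  all_goals
    simp
    field_simp
    simp only [det]
    ring

lemma comb_inj {x y : A} (h : B.det x y ≠ 0) {p q p' q' : ℚ}
    (e : algebraMap ℚ A p * x + algebraMap ℚ A q * y =
      algebraMap ℚ A p' * x + algebraMap ℚ A q' * y) : p = p' ∧ q = q' := by
  have h1 := congrArg B.re e
  have h2 := congrArg B.im e
  simp at h1 h2
  simp only [det] at h
  constructor
  · apply mul_right_cancel₀ h; linear_combination B.im y * h1 - B.re y * h2
  · apply mul_right_cancel₀ h; linear_combination B.re x * h2 - B.im x * h1

lemma mem_conductorOrder (c : ℕ+) (z : A) : z ∈ conductorOrder A c ↔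
    (∃ a : ℤ, B.re z = a) ∧ ∃ b : ℤ, B.im z = c * b := by
  constructor
  · rintro ⟨m, w, hw, rfl⟩
    obtain ⟨⟨a, ha⟩, b, hb⟩ := (B.mem_integralClosure w).1 hw
    change B.re w = a at ha
    change B.im w = b at hb
    exact ⟨⟨m + c * a, by simp [ha]⟩, b, by simp [hb]⟩
  · rintro ⟨⟨a, ha⟩, b, hb⟩
    refine ⟨a, B.elt 0 b, (B.mem_integralClosure _).2 ⟨⟨0, ?_⟩, b, ?_⟩, ?_⟩
    · exact (B.re_elt _ _).trans (by simp)
    · exact B.im_elt _ _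
    · apply B.ext <;> simp [ha, hb]

/-- The conductor of an order is determined by the order. -/
lemma conductor_unique (B : QuadraticCoords A) {c c' : ℕ+}
    (h : ∀ z : A, z ∈ conductorOrder A c ↔ z ∈ conductorOrder A c') :
    c = c' := by
  have key : ∀ {c c' : ℕ+}, (∀ z : A, z ∈ conductorOrder A c → z ∈ conductorOrder A c') →
      (c' : ℕ) ∣ c := by
    intro c c' h
    have h1 : B.elt 0 (c : ℕ) ∈ conductorOrder A c :=
      (B.mem_conductorOrder c _).2 ⟨⟨0, by simp⟩, 1, by simp⟩
    obtain ⟨-, b, hb⟩ := (B.mem_conductorOrder c' _).1 (h _ h1)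
    rw [im_elt] at hb
    have : ((c' : ℕ) : ℤ) ∣ ((c : ℕ) : ℤ) := ⟨b, by exact_mod_cast hb⟩
    exact_mod_cast this
  exact PNat.coe_injective (Nat.dvd_antisymm (key fun z => (h z).2) (key fun z => (h z).1))

/-- The trace pairing `z ↦ im z / c` makes `𝒪_c` self-dual: a module over `𝒪_c` lies in `𝒪_c`
as soon as its elements have imaginary part in `c ℤ`. -/
lemma le_one_iff {c : ℕ+} (M : Submodule (conductorOrder A c) A) :
    M ≤ 1 ↔ ∀ z ∈ M, ∃ b : ℤ, B.im z = c * b := by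
  constructor
  · intro h z hz
    obtain ⟨r, rfl⟩ := Submodule.mem_one.1 (h hz)
    exact ((B.mem_conductorOrder c _).1 r.2).2
  · intro h z hz
    have hw : B.elt 0 (c : ℕ) ∈ conductorOrder A c :=
      (B.mem_conductorOrder c _).2 ⟨⟨0, by simp⟩, 1, by simp⟩
    obtain ⟨b, hb⟩ := h z hz
    obtain ⟨b', hb'⟩ := h _ (M.smul_mem ⟨_, hw⟩ hz)
    refine Submodule.mem_one.2 ⟨⟨z, (B.mem_conductorOrder c _).2 ⟨⟨b' - B.t * (c * b), ?_⟩, b, hb⟩⟩,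
      rfl⟩
    change B.im (B.elt 0 (c : ℕ) * z) = _ at hb'
    simp [hb] at hb'
    have hc : ((c : ℕ) : ℚ) ≠ 0 := by exact_mod_cast c.pos.ne'
    push_cast
    apply mul_left_cancel₀ hc
    linear_combination hb'

end QuadraticCoords

/-! ### Lattices and invertible ideals -/

/-- Hermite normal form: a subgroup of `ℤ × ℤ` is generated by some `(p, 0)` and `(q, r)`. -/
lemma AddSubgroup.exists_hermite (H : AddSubgroup (ℤ × ℤ)) :
    ∃ p q r : ℤ, 0 ≤ p ∧ 0 ≤ r ∧
      ∀ m k : ℤ, (m, k) ∈ H ↔ ∃ i j : ℤ, m = i * p + j * q ∧ k = j * r := by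
  obtain ⟨r₀, hr₀⟩ := Int.subgroup_cyclic (H.map (AddMonoidHom.snd ℤ ℤ))
  obtain ⟨p₀, hp₀⟩ := Int.subgroup_cyclic (H.comap (AddMonoidHom.inl ℤ ℤ))
  have hr : ∀ k, (∃ m, (m, k) ∈ H) ↔ |r₀| ∣ k := by
    intro k
    have : k ∈ H.map (AddMonoidHom.snd ℤ ℤ) ↔ ∃ m, (m, k) ∈ H := by simp
    rw [← this, hr₀, ← AddSubgroup.zmultiples_eq_closure, Int.mem_zmultiples_iff, abs_dvd]
  have hp : ∀ m, (m, 0) ∈ H ↔ |p₀| ∣ m := by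
    intro m
    have : m ∈ H.comap (AddMonoidHom.inl ℤ ℤ) ↔ (m, 0) ∈ H := by simp
    rw [← this, hp₀, ← AddSubgroup.zmultiples_eq_closure, Int.mem_zmultiples_iff, abs_dvd]
  obtain ⟨q, hq⟩ := (hr |r₀|).2 dvd_rfl
  refine ⟨|p₀|, q, |r₀|, abs_nonneg _, abs_nonneg _, fun m k => ⟨fun h => ?_, ?_⟩⟩
  · obtain ⟨j, hj⟩ := (hr k).1 ⟨m, h⟩
    have h1 : (m - j * q, 0) ∈ H := by
      have := H.sub_mem h (H.zsmul_mem hq j)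
      simpa [hj, mul_comm] using this
    obtain ⟨i, hi⟩ := (hp _).1 h1
    exact ⟨i, j, by linarith, by rw [hj, mul_comm]⟩
  · rintro ⟨i, j, rfl, rfl⟩
    have := H.add_mem (H.zsmul_mem ((hp _).2 dvd_rfl) i) (H.zsmul_mem hq j)
    simpa using this

/-- Three rationals, not all zero, are a positive multiple of three coprime integers. -/
lemma Rat.exists_content (α β γ : ℚ) (h : ¬(α = 0 ∧ β = 0 ∧ γ = 0)) :
    ∃ g : ℚ, 0 < g ∧ ∃ a b e x y z : ℤ,
      α = g * a ∧ β = g * b ∧ γ = g * e ∧ a * x + b * y + e * z = 1 := by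
  set N : ℕ := α.den * β.den * γ.den with hN
  have hN0 : (N : ℚ) ≠ 0 := by
    have := α.den_nz; have := β.den_nz; have := γ.den_nz
    simp [hN]
  set A : ℤ := α.num * β.den * γ.den
  set B : ℤ := β.num * α.den * γ.den
  set C : ℤ := γ.num * α.den * β.den
  have hA : (A : ℚ) = N * α := by
    have := Rat.mul_den_eq_num α
    simp only [A, hN]; push_cast; rw [← this]; ring
  have hB : (B : ℚ) = N * β := by
    have := Rat.mul_den_eq_num β
    simp only [B, hN]; push_cast; rw [← this]; ring
  have hC : (C : ℚ) = N * γ := by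
    have := Rat.mul_den_eq_num γ
    simp only [C, hN]; push_cast; rw [← this]; ring
  set G : ℕ := Int.gcd A (Int.gcd B C) with hG
  obtain ⟨a, ha⟩ : (G : ℤ) ∣ A := Int.gcd_dvd_left _ _
  have h1 : (G : ℤ) ∣ Int.gcd B C := Int.gcd_dvd_right _ _
  obtain ⟨b, hb⟩ : (G : ℤ) ∣ B := h1.trans (Int.gcd_dvd_left _ _)
  obtain ⟨e, he⟩ : (G : ℤ) ∣ C := h1.trans (Int.gcd_dvd_right _ _)
  have hG0 : G ≠ 0 := by
    intro h0
    rw [h0] at ha hb he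
    apply h
    simp only [Nat.cast_zero, zero_mul] at ha hb he
    rw [ha] at hA; rw [hb] at hB; rw [he] at hC
    simp only [Int.cast_zero, zero_eq_mul, hN0, false_or] at hA hB hC
    exact ⟨hA, hB, hC⟩
  have bez : (G : ℤ) = A * Int.gcdA A (Int.gcd B C) + (B * Int.gcdA B C + C * Int.gcdB B C) *
      Int.gcdB A (Int.gcd B C) := by
    rw [← Int.gcd_eq_gcd_ab, ← Int.gcd_eq_gcd_ab]
  have hG1 : (G : ℚ) ≠ 0 := by exact_mod_cast hG0
  refine ⟨G / N, by positivity, a, b, e, Int.gcdA A (Int.gcd B C),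
    Int.gcdA B C * Int.gcdB A (Int.gcd B C), Int.gcdB B C * Int.gcdB A (Int.gcd B C), ?_, ?_, ?_, ?_⟩
  · field_simp; rw [mul_comm, ← hA, ha]; push_cast; ring
  · field_simp; rw [mul_comm, ← hB, hb]; push_cast; ring
  · field_simp; rw [mul_comm, ← hC, he]; push_cast; ring
  · have hGz : (G : ℤ) ≠ 0 := by exact_mod_cast hG0
    apply mul_left_cancel₀ hGz
    rw [mul_one]
    conv_rhs => rw [bez]
    linear_combination (-Int.gcdA A (Int.gcd B C)) * ha
      - (Int.gcdA B C * Int.gcdB A (Int.gcd B C)) * hb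
      - (Int.gcdB B C * Int.gcdB A (Int.gcd B C)) * he

/-- The multiplier ring of an invertible ideal of `O` is `O`. -/
lemma mem_order_iff_mul_mem {A : Type*} [CommRing A] {O : Subring A} (I : InvertibleIdeal O)
    (z : A) : z ∈ O ↔ ∀ x ∈ (I : Submodule O A), z * x ∈ (I : Submodule O A) := by
  constructor
  · exact fun h x hx => (I : Submodule O A).smul_mem ⟨z, h⟩ hx
  · intro h
    rw [← mem_one_iff_mem_order]
    have key : ∀ y ∈ (I : Submodule O A) * (↑I⁻¹ : Submodule O A), z * y ∈ (1 : Submodule O A) := by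
      intro y hy
      refine Submodule.mul_induction_on hy (fun m hm k hk => ?_) fun x y hx hy => ?_
      · rw [← mul_assoc, ← I.mul_inv]
        exact Submodule.mul_mem_mul (h m hm) hk
      · rw [mul_add]; exact add_mem hx hy
    have := key 1 (by rw [I.mul_inv]; exact Submodule.one_le.1 le_rfl)
    rwa [mul_one] at this

namespace QuadraticCoords

variable {A : Type*} [CommRing A] [Algebra ℚ A] (B : QuadraticCoords A)

/-- The pairing `tr (x * conj y)`, the polarization of the norm. -/
def pair (x y : A) : ℚ :=
  2 * B.re x * B.re y + B.t * (B.re x * B.im y + B.im x * B.re y) + 2 * B.n * B.im x * B.im y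

lemma pair_sq (x y : A) :
    B.pair x y ^ 2 - 4 * B.nm x * B.nm y = B.disc * B.det x y ^ 2 := by
  simp only [pair, nm, det, disc]; push_cast; ring

lemma disc_ne : (B.disc : ℚ) ≠ 0 := by exact_mod_cast B.disc_ne_zero

/-- `x, y` is a `ℤ`-basis of `I`. -/
def IsBasis {O : Subring A} (I : Submodule O A) (x y : A) : Prop :=
  B.det x y ≠ 0 ∧ ∀ z, z ∈ I ↔ ∃ m k : ℤ, z = m * x + k * y

/-- For a lattice with basis `x, y`, the norm form is `g` times a primitive integral form, and
`x * conj y / g` generates the order of conductor `f = |det x y| / g`. -/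
lemma exists_content {x y : A} (h : B.det x y ≠ 0) :
    ∃ (f : ℕ+) (g : ℚ), 0 < g ∧ |B.det x y| = g * f ∧
      (∃ a b e u v s : ℤ, B.nm x = g * a ∧ B.pair x y = g * b ∧ B.nm y = g * e ∧
        a * u + b * v + e * s = 1) ∧
      ∀ z : A, z ∈ conductorOrder A f ↔
        ∃ r s : ℤ, z = r + s * (algebraMap ℚ A g⁻¹ * (x * B.conj y)) := by
  obtain ⟨g, hg, a, b, e, u, v, s, ha, hb, he, hs⟩ := Rat.exists_content (B.nm x) (B.pair x y)
    (B.nm y) (by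
      rintro ⟨h1, h2, -⟩
      have := B.pair_sq x y
      rw [h1, h2] at this
      have h3 := mul_ne_zero B.disc_ne (pow_ne_zero 2 h)
      simp at this
      rcases this with h4 | h4
      · exact B.disc_ne (by exact_mod_cast h4)
      · exact h h4)
  set η := algebraMap ℚ A g⁻¹ * (x * B.conj y) with hη
  have hre : 2 * B.re η + B.t * B.im η = b := by
    have : (b : ℚ) = g⁻¹ * B.pair x y := by rw [hb]; field_simp
    rw [this, hη, pair]
    simp
    ring
  have hnm : B.nm η = a * e := by
    rw [hη, nm_mul, nm_mul, nm_conj, ha, he]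
    simp [nm]
    field_simp
  have hint : η ∈ integralClosure ℤ A := by
    refine ⟨Polynomial.X ^ 2 - Polynomial.C b * Polynomial.X + Polynomial.C (a * e), ?_, ?_⟩
    · monicity!
    · simp only [nm] at hnm
      rw [Polynomial.eval₂_add, Polynomial.eval₂_sub, Polynomial.eval₂_mul, Polynomial.eval₂_pow,
        Polynomial.eval₂_X, Polynomial.eval₂_C, Polynomial.eval₂_C, eq_intCast, eq_intCast, pow_two]
      push_cast
      apply B.ext <;> simp <;> rw [← hre]
      · linear_combination -hnm
      · ring
  obtain ⟨⟨ρ, hρ⟩, σ, hσ⟩ := (B.mem_integralClosure η).1 hint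
  change B.re η = ρ at hρ
  change B.im η = σ at hσ
  have hσ' : B.det x y = - (g * σ) := by
    rw [← hσ, hη, det]; simp; field_simp; ring
  have hσ0 : σ ≠ 0 := by
    rintro rfl
    simp at hσ'
    exact h hσ'
  obtain ⟨f, hf⟩ : ∃ f : ℕ+, (f : ℕ) = σ.natAbs := ⟨⟨σ.natAbs, Int.natAbs_pos.2 hσ0⟩, rfl⟩
  refine ⟨f, g, hg, ?_, ⟨a, b, e, u, v, s, ha, hb, he, hs⟩, ?_⟩
  · rw [hσ', abs_neg, abs_mul, abs_of_pos hg, hf, Nat.cast_natAbs, Int.cast_abs]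
  · intro z
    rw [B.mem_conductorOrder]
    obtain ⟨l, hl⟩ : σ ∣ (f : ℕ) := by rw [hf]; exact Int.dvd_natAbs.2 dvd_rfl
    obtain ⟨l', hl'⟩ : ((f : ℕ) : ℤ) ∣ σ := by rw [hf]; exact Int.natAbs_dvd.2 dvd_rfl
    have h1 : ((f : ℕ) : ℚ) = σ * l := by exact_mod_cast hl
    have h2 : (σ : ℚ) = (f : ℕ) * l' := by exact_mod_cast hl'
    rw [← hη]
    clear_value η
    constructor
    · rintro ⟨⟨m, hm⟩, k, hk⟩
      refine ⟨m - l * k * ρ, l * k, B.ext ?_ ?_⟩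
      · simp [hm, hρ]
      · simp [hk, hσ, h1]; ring
    · rintro ⟨r, s, rfl⟩
      refine ⟨⟨r + s * ρ, by simp [hρ]⟩, l' * s, ?_⟩
      simp [hσ]
      rw [h2]; ring

lemma conj_mul_mul_left (x y : A) :
    x * B.conj y * x = algebraMap ℚ A (B.pair x y) * x - algebraMap ℚ A (B.nm x) * y := by
  apply B.ext
  · simp only [re_mul, re_sub, im_mul, re_conj, im_conj, re_algebraMap, im_algebraMap, pair, nm]; ring
  · simp only [im_sub, im_mul, re_mul, re_conj, im_conj, re_algebraMap, im_algebraMap, pair, nm]; ring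

lemma conj_mul_mul_right (x y : A) :
    x * B.conj y * y = algebraMap ℚ A (B.nm y) * x := by
  rw [← B.mul_conj]; ring

lemma mul_conj_add (x y : A) :
    x * B.conj y + y * B.conj x = algebraMap ℚ A (B.pair x y) := by
  apply B.ext
  · rw [re_algebraMap]; simp [pair]; ring
  · rw [im_algebraMap]; simp; ring

/-- Every lattice is an invertible ideal of its multiplier ring. With `g` the content of the norm
form, the inverse of `I` is `conj I / g`: the product `I * conj I / g` contains the three coprime
coefficients of the primitive norm form, hence `1`. -/
theorem exists_invertibleIdeal {x y : A} (h : B.det x y ≠ 0) :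
    ∃ (f : ℕ+) (I J : Submodule (conductorOrder A f) A), I * J = 1 ∧ B.IsBasis I x y ∧
      (∀ z, z ∈ J ↔ B.conj (algebraMap ℚ A (|B.det x y| / f) * z) ∈ I) ∧
      |B.det x y| / f ≠ 0 := by
  -- The group `ℤ x + ℤ y` is a module over the order generated by `x * conj y / g`; this is used
  -- for the lattice and for its inverse.
  have stab : ∀ {x y : A} (f : ℕ+) (g : ℚ), 0 < g →
      (∃ a b e : ℤ, B.nm x = g * a ∧ B.pair x y = g * b ∧ B.nm y = g * e) →
      (∀ z : A, z ∈ conductorOrder A f →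
        ∃ r s : ℤ, z = r + s * (algebraMap ℚ A g⁻¹ * (x * B.conj y))) →
      ∀ z : A, z ∈ Submodule.span (conductorOrder A f) {x, y} ↔ ∃ m k : ℤ, z = m * x + k * y := by
    rintro x y f g hg ⟨a, b, e, ha, hb, he⟩ hO z
    have hg1 : algebraMap ℚ A g⁻¹ * algebraMap ℚ A g = 1 := by
      rw [← map_mul, inv_mul_cancel₀ hg.ne', map_one]
    rw [Submodule.mem_span_pair]
    constructor
    · rintro ⟨α, β, rfl⟩
      obtain ⟨r, s, hα⟩ := hO _ α.2
      obtain ⟨r', s', hβ⟩ := hO _ β.2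
      refine ⟨r + s * b + s' * e, r' - s * a, ?_⟩
      change (α : A) * x + (β : A) * y = _
      have h1 := B.conj_mul_mul_left x y
      have h2 := B.conj_mul_mul_right x y
      rw [hb, ha, map_mul, map_mul, map_intCast, map_intCast] at h1
      rw [he, map_mul, map_intCast] at h2
      rw [hα, hβ]
      push_cast
      linear_combination (s * algebraMap ℚ A g⁻¹) * h1 + (s' * algebraMap ℚ A g⁻¹) * h2
        + ((s : A) * (b * x - a * y) + s' * e * x) * hg1
    · rintro ⟨m, k, rfl⟩
      exact ⟨(m : ℤ), (k : ℤ), by rw [Subring.smul_def, Subring.smul_def]; simp⟩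
  obtain ⟨f, g, hg, hdet, ⟨a, b, e, u, v, s, ha, hb, he, hs⟩, hO⟩ := B.exists_content h
  have hf : ((f : ℕ) : ℚ) ≠ 0 := by exact_mod_cast f.pos.ne'
  have hgf : |B.det x y| / f = g := by rw [hdet]; field_simp
  have hg1 : algebraMap ℚ A g⁻¹ * algebraMap ℚ A g = 1 := by
    rw [← map_mul, inv_mul_cancel₀ hg.ne', map_one]
  have hI := stab f g hg ⟨a, b, e, ha, hb, he⟩ fun z => (hO z).1
  set x' := algebraMap ℚ A g⁻¹ * B.conj x with hx'
  set y' := algebraMap ℚ A g⁻¹ * B.conj y with hy'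
  have hη : ∀ z ∈ conductorOrder A f, ∃ r s : ℤ,
      z = r + s * (algebraMap ℚ A g⁻¹⁻¹ * (x' * B.conj y')) := by
    intro z hz
    have hbη : algebraMap ℚ A g⁻¹⁻¹ * (x' * B.conj y') =
        b - algebraMap ℚ A g⁻¹ * (x * B.conj y) := by
      have h1 := B.mul_conj_add x y
      rw [hb, map_mul, map_intCast] at h1
      have h2 : B.conj y' = algebraMap ℚ A g⁻¹ * y := by
        rw [hy', conj_mul, conj_conj]
        congr 1
        apply B.ext <;> simp
      rw [h2, hx', inv_inv]
      linear_combination (algebraMap ℚ A g⁻¹) * h1 + (algebraMap ℚ A g⁻¹ * (B.conj x * y)+ b) * hg1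
    obtain ⟨r, s, rfl⟩ := (hO z).1 hz
    refine ⟨r + s * b, -s, ?_⟩
    rw [hbη]; push_cast; ring
  have hJ := stab (x := x') (y := y') f g⁻¹ (inv_pos.2 hg) ⟨a, b, e, by
      rw [hx', nm_mul, nm_conj, ha]; simp [nm]; field_simp, by
      rw [hx', hy']
      have : B.pair (algebraMap ℚ A g⁻¹ * B.conj x) (algebraMap ℚ A g⁻¹ * B.conj y) =
        g⁻¹ ^ 2 * B.pair x y := by simp [pair]; ring
      rw [this, hb]; field_simp, by
      rw [hy', nm_mul, nm_conj, he]; simp [nm]; field_simp⟩ hη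
  refine ⟨f, Submodule.span _ {x, y}, Submodule.span _ {x', y'}, ?_, ⟨h, hI⟩, ?_, by
    rw [hgf]; exact hg.ne'⟩
  · have hxx : x * x' = a := by
      rw [hx', mul_left_comm, mul_conj, ha, map_mul, map_intCast, ← mul_assoc, hg1, one_mul]
    have hyy : y * y' = e := by
      rw [hy', mul_left_comm, mul_conj, he, map_mul, map_intCast, ← mul_assoc, hg1, one_mul]
    have hxy : x * y' + y * x' = b := by
      have := B.mul_conj_add x y
      rw [hb, map_mul, map_intCast] at this
      rw [hx', hy']
      linear_combination (algebraMap ℚ A g⁻¹) * this + b * hg1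
    have hxy' : x * y' = algebraMap ℚ A g⁻¹ * (x * B.conj y) := by rw [hy']; ring
    apply le_antisymm
    · rw [Submodule.mul_le]
      intro m hm k hk
      obtain ⟨p, q, rfl⟩ := (hI m).1 hm
      obtain ⟨p', q', rfl⟩ := (hJ k).1 hk
      rw [mem_one_iff_mem_order, hO, ← hxy']
      refine ⟨p * p' * a + q * q' * e + q * p' * b, p * q' - q * p', ?_⟩
      push_cast
      linear_combination (p * p' : A) * hxx + (q * q' : A) * hyy + (q * p' : A) * hxy
    · rw [Submodule.one_le]
      have key : (1 : A) = (u : ℤ) • (x * x') + (v : ℤ) • (x * y' + y * x') + (s : ℤ) • (y * y') := by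
        rw [hxx, hyy, hxy]
        simp only [zsmul_eq_mul]
        have : (a * u + b * v + e * s : A) = 1 := by exact_mod_cast congrArg (Int.cast (R := A)) hs
        linear_combination -this
      have hx1 : x ∈ Submodule.span (conductorOrder A f) {x, y} := Submodule.subset_span (by simp)
      have hy1 : y ∈ Submodule.span (conductorOrder A f) {x, y} := Submodule.subset_span (by simp)
      have hx2 : x' ∈ Submodule.span (conductorOrder A f) {x', y'} := Submodule.subset_span (by simp)
      have hy2 : y' ∈ Submodule.span (conductorOrder A f) {x', y'} := Submodule.subset_span (by simp)
      rw [key]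
      exact add_mem (add_mem (zsmul_mem (Submodule.mul_mem_mul hx1 hx2) _)
        (zsmul_mem (add_mem (Submodule.mul_mem_mul hx1 hy2) (Submodule.mul_mem_mul hy1 hx2)) _))
        (zsmul_mem (Submodule.mul_mem_mul hy1 hy2) _)
  · intro z
    rw [hI, hJ, hgf]
    have hcg : ∀ q : ℚ, B.conj (algebraMap ℚ A q) = algebraMap ℚ A q := fun q => by
      apply B.ext <;> simp
    constructor
    · rintro ⟨m, k, rfl⟩
      refine ⟨m, k, ?_⟩
      simp only [conj_mul, conj_add, conj_intCast, hx', hy', conj_conj, hcg]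
      linear_combination (m * x + k * y : A) * hg1
    · rintro ⟨m, k, hz⟩
      refine ⟨m, k, ?_⟩
      have h1 := congrArg B.conj hz
      rw [conj_conj] at h1
      simp only [conj_mul, conj_add, conj_intCast] at h1
      rw [hx', hy']
      linear_combination (algebraMap ℚ A g⁻¹) * h1 - z * hg1

end QuadraticCoords

/-! ### Norms of invertible ideals -/

/-- The principal ideal `δ O`, as an invertible ideal. -/
noncomputable def principalIdeal {A : Type*} [CommRing A] (O : Subring A) (δ : Aˣ) :
    InvertibleIdeal O :=
  Units.map (Submodule.spanSingleton (A := A) O).toMonoidHom δ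

section principal

variable {A : Type*} [CommRing A] {O : Subring A}

lemma coe_principalIdeal (δ : Aˣ) :
    (principalIdeal O δ : Submodule O A) = Submodule.span O {(δ : A)} := rfl

lemma principalIdeal_mul (δ ε : Aˣ) :
    principalIdeal O (δ * ε) = principalIdeal O δ * principalIdeal O ε := map_mul _ _ _

lemma principalIdeal_pow (δ : Aˣ) (m : ℕ) :
    principalIdeal O (δ ^ m) = principalIdeal O δ ^ m := map_pow _ _ _

lemma principalIdeal_inv (δ : Aˣ) :
    principalIdeal O δ⁻¹ = (principalIdeal O δ)⁻¹ := map_inv _ _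

lemma mem_principalIdeal_mul (δ : Aˣ) (I : InvertibleIdeal O) (z : A) :
    z ∈ ((principalIdeal O δ * I : InvertibleIdeal O) : Submodule O A) ↔
      (↑δ⁻¹ : A) * z ∈ (I : Submodule O A) := by
  rw [Units.val_mul, coe_principalIdeal, Submodule.mem_span_singleton_mul]
  constructor
  · rintro ⟨y, hy, rfl⟩
    simpa using hy
  · intro h
    exact ⟨_, h, by simp⟩

lemma mem_principalIdeal (δ : Aˣ) (z : A) :
    z ∈ (principalIdeal O δ : Submodule O A) ↔ (↑δ⁻¹ : A) * z ∈ O := by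
  rw [← mem_one_iff_mem_order]
  simpa using mem_principalIdeal_mul δ (1 : InvertibleIdeal O) z

/-- Two units generate the same ideal iff they differ by a unit of the order. -/
lemma principalIdeal_eq_iff (δ ε : Aˣ) :
    principalIdeal O δ = principalIdeal O ε ↔ ∃ u : Oˣ, (ε : A) = (u : O) * δ := by
  constructor
  · intro h
    have h1 : (↑δ⁻¹ : A) * ε ∈ O := by
      rw [← mem_principalIdeal, h, mem_principalIdeal]; simp [O.one_mem]
    have h2 : (↑ε⁻¹ : A) * δ ∈ O := by
      rw [← mem_principalIdeal, ← h, mem_principalIdeal]; simp [O.one_mem]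
    refine ⟨⟨⟨_, h1⟩, ⟨_, h2⟩, Subtype.ext ?_, Subtype.ext ?_⟩, ?_⟩
    · change (↑δ⁻¹ : A) * ε * (↑ε⁻¹ * δ) = 1
      rw [mul_mul_mul_comm, mul_comm (ε : A), mul_mul_mul_comm]; simp
    · change (↑ε⁻¹ : A) * δ * (↑δ⁻¹ * ε) = 1
      rw [mul_mul_mul_comm, mul_comm (δ : A), mul_mul_mul_comm]; simp
    · change (ε : A) = ↑δ⁻¹ * ε * δ
      rw [mul_right_comm]; simp
  · rintro ⟨u, hu⟩
    have hv : (δ : A) = ((↑u⁻¹ : O) : A) * ε := by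
      rw [hu, ← mul_assoc, ← Subring.coe_mul, Units.inv_mul]; simp
    apply Units.ext
    rw [coe_principalIdeal, coe_principalIdeal]
    apply le_antisymm <;> rw [Submodule.span_singleton_le_iff_mem, Submodule.mem_span_singleton]
    · exact ⟨(↑u⁻¹ : O), hv.symm⟩
    · exact ⟨(u : O), hu.symm⟩

end principal

namespace QuadraticCoords

variable {A : Type*} [CommRing A] [Algebra ℚ A] (B : QuadraticCoords A)

lemma IsBasis.principalIdeal_mul {B : QuadraticCoords A} {O : Subring A} {I : InvertibleIdeal O}
    {x y : A} (h : B.IsBasis (I : Submodule O A) x y) (κ : Aˣ) :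
    B.IsBasis ((principalIdeal O κ * I : InvertibleIdeal O) : Submodule O A) (κ * x) (κ * y) := by
  refine ⟨?_, fun z => ?_⟩
  · rw [det_mul_left]; exact mul_ne_zero (B.nm_ne_zero κ) h.1
  · rw [mem_principalIdeal_mul, h.2]
    refine exists_congr fun m => exists_congr fun k => ?_
    rw [Units.inv_mul_eq_iff_eq_mul]
    constructor <;> (rintro rfl; ring)

/-- In terms of a basis `x, y` of `I`, the inverse of `I` is the conjugate of `I` divided by
`|det x y| / c`. -/
lemma IsBasis.mem_inv_iff {B : QuadraticCoords A} {c : ℕ+} {I : InvertibleIdeal (conductorOrder A c)}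
    {x y : A} (h : B.IsBasis (I : Submodule (conductorOrder A c) A) x y) (z : A) :
    z ∈ (↑I⁻¹ : Submodule (conductorOrder A c) A) ↔
      B.conj (algebraMap ℚ A (|B.det x y| / c) * z) ∈ (I : Submodule (conductorOrder A c) A) := by
  obtain ⟨f, I', J', hIJ, hb, hJ, -⟩ := B.exists_invertibleIdeal h.1
  have hmem : ∀ z, z ∈ I' ↔ z ∈ (I : Submodule (conductorOrder A c) A) := fun z => by
    rw [hb.2, h.2]
  obtain rfl : f = c := by
    refine B.conductor_unique fun z => ?_
    rw [mem_order_iff_mul_mem (⟨I', J', hIJ, by rwa [mul_comm]⟩ : InvertibleIdeal _),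
      mem_order_iff_mul_mem I]
    simp [hmem]
  obtain rfl : I' = I := SetLike.ext hmem
  have : (↑I⁻¹ : Submodule (conductorOrder A f) A) = J' := by
    rw [Units.inv_eq_of_mul_eq_one_right hIJ]
  rw [this, hJ]

/-- `N` is the norm of the invertible ideal `I`: it is positive and `I * conj I = N O`, expressed
through the inverse of `I`. -/
def HasNorm {O : Subring A} (I : InvertibleIdeal O) (N : ℚ) : Prop :=
  0 < N ∧ ∀ z, z ∈ (↑I⁻¹ : Submodule O A) ↔ B.conj (algebraMap ℚ A N * z) ∈ (I : Submodule O A)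

lemma conj_algebraMap (q : ℚ) : B.conj (algebraMap ℚ A q) = algebraMap ℚ A q := by
  apply B.ext <;> simp

lemma algebraMap_mul_inv {q : ℚ} (h : q ≠ 0) : algebraMap ℚ A q * algebraMap ℚ A q⁻¹ = 1 := by
  rw [← map_mul, mul_inv_cancel₀ h, map_one]

variable {B}

lemma IsBasis.hasNorm {c : ℕ+} {I : InvertibleIdeal (conductorOrder A c)}
    {x y : A} (h : B.IsBasis (I : Submodule (conductorOrder A c) A) x y) :
    B.HasNorm I (|B.det x y| / c) := by
  have := c.pos
  exact ⟨div_pos (abs_pos.2 h.1) (by exact_mod_cast c.pos), fun z => h.mem_inv_iff z⟩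

lemma HasNorm.inv_mem {O : Subring A} {I : InvertibleIdeal O} {N : ℚ} (h : B.HasNorm I N)
    {z : A} (hz : z ∈ (I : Submodule O A)) :
    algebraMap ℚ A N⁻¹ * B.conj z ∈ (↑I⁻¹ : Submodule O A) := by
  rw [h.2, ← mul_assoc, algebraMap_mul_inv h.1.ne', one_mul, conj_conj]
  exact hz

lemma HasNorm.mul {O : Subring A} {I J : InvertibleIdeal O} {N M : ℚ} (hI : B.HasNorm I N)
    (hJ : B.HasNorm J M) : B.HasNorm (I * J) (N * M) := by
  refine ⟨mul_pos hI.1 hJ.1, fun z => ?_⟩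
  rw [mul_inv, Units.val_mul, Units.val_mul]
  constructor
  · intro hz
    refine Submodule.mul_induction_on hz (fun m hm k hk => ?_) fun x y hx hy => ?_
    · have : B.conj (algebraMap ℚ A (N * M) * (m * k)) =
          B.conj (algebraMap ℚ A N * m) * B.conj (algebraMap ℚ A M * k) := by
        rw [← conj_mul, map_mul]; congr 1; ring
      rw [this]
      exact Submodule.mul_mem_mul ((hI.2 m).1 hm) ((hJ.2 k).1 hk)
    · rw [mul_add, conj_add]; exact add_mem hx hy
  · have key : ∀ u ∈ (I : Submodule O A) * (J : Submodule O A),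
        algebraMap ℚ A (N * M)⁻¹ * B.conj u ∈ (↑I⁻¹ : Submodule O A) * (↑J⁻¹ : Submodule O A) := by
      intro u hu
      refine Submodule.mul_induction_on hu (fun m hm k hk => ?_) fun x y hx hy => ?_
      · have : algebraMap ℚ A (N * M)⁻¹ * B.conj (m * k) =
            (algebraMap ℚ A N⁻¹ * B.conj m) * (algebraMap ℚ A M⁻¹ * B.conj k) := by
          rw [conj_mul, mul_inv, map_mul]; ring
        rw [this]
        exact Submodule.mul_mem_mul (hI.inv_mem hm) (hJ.inv_mem hk)
      · rw [conj_add, mul_add]; exact add_mem hx hy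
    intro h
    have := key _ h
    rwa [conj_conj, ← mul_assoc, mul_comm (algebraMap ℚ A _),
      algebraMap_mul_inv (mul_pos hI.1 hJ.1).ne', one_mul] at this

lemma HasNorm.pow {O : Subring A} {I : InvertibleIdeal O} {N : ℚ} (hI : B.HasNorm I N) :
    B.HasNorm (I ^ 3) (N ^ 3) := by
  have := (hI.mul hI).mul hI
  rwa [← pow_two, ← pow_two, ← pow_succ, ← pow_succ] at this

lemma HasNorm.unique {c : ℕ+} {I : InvertibleIdeal (conductorOrder A c)} {N M : ℚ}
    (hN : B.HasNorm I N) (hM : B.HasNorm I M) : N = M := by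
  have key : ∀ {N M : ℚ}, B.HasNorm I N → B.HasNorm I M → ∃ a : ℤ, N / M = a := by
    intro N M hN hM
    have h1 : algebraMap ℚ A (N / M) ∈ conductorOrder A c := by
      rw [mem_order_iff_mul_mem I⁻¹]
      intro z hz
      rw [hM.2, ← mul_assoc, ← map_mul, mul_div_cancel₀ _ hM.1.ne', ← hN.2]
      exact hz
    obtain ⟨⟨a, ha⟩, -⟩ := (B.mem_conductorOrder c _).1 h1
    exact ⟨a, by simpa using ha⟩
  obtain ⟨a, ha⟩ := key hN hM
  obtain ⟨b, hb⟩ := key hM hN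
  have h1 : (a : ℚ) * b = 1 := by
    rw [← ha, ← hb]; have := hN.1.ne'; have := hM.1.ne'; field_simp
  have h2 : a * b = 1 := by exact_mod_cast h1
  have h3 : 0 < a := by
    have : (0 : ℚ) < a := ha ▸ div_pos hN.1 hM.1
    exact_mod_cast this
  have h4 : a = 1 := by
    rcases Int.mul_eq_one_iff_eq_one_or_neg_one.1 h2 with h | h <;> omega
  rw [h4, Int.cast_one, div_eq_one_iff_eq hM.1.ne'] at ha
  exact ha

lemma conj_mem_conductorOrder {c : ℕ+} {z : A} (h : z ∈ conductorOrder A c) :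
    B.conj z ∈ conductorOrder A c := by
  obtain ⟨⟨a, ha⟩, b, hb⟩ := (B.mem_conductorOrder c z).1 h
  exact (B.mem_conductorOrder c _).2 ⟨⟨a + B.t * (c * b), by simp [ha, hb]⟩, -b, by simp [hb]⟩

lemma hasNorm_principalIdeal (B : QuadraticCoords A) {c : ℕ+} (δ : Aˣ) :
    B.HasNorm (principalIdeal (conductorOrder A c) δ) |B.nm δ| := by
  refine ⟨abs_pos.2 (B.nm_ne_zero δ), fun z => ?_⟩
  rw [← principalIdeal_inv, mem_principalIdeal, mem_principalIdeal, inv_inv]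
  have h1 : (↑δ⁻¹ : A) * B.conj (algebraMap ℚ A (B.nm δ) * z) = B.conj (δ * z) := by
    rw [conj_mul, conj_mul, conj_algebraMap, ← mul_conj, mul_assoc, Units.inv_mul_cancel_left]
  have h2 : B.conj (δ * z) ∈ conductorOrder A c ↔ (δ : A) * z ∈ conductorOrder A c :=
    ⟨fun h => by simpa using conj_mem_conductorOrder (B := B) h, conj_mem_conductorOrder⟩
  rcases abs_choice (B.nm δ) with h | h
  · rw [h, h1, h2]
  · have h3 : B.conj (algebraMap ℚ A (-B.nm δ) * z) = -B.conj (algebraMap ℚ A (B.nm δ) * z) := by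
      apply B.ext <;> (simp; try ring)
    rw [h, h3, mul_neg, h1, neg_mem_iff, h2]

/-- An element of a quadratic algebra has a positive integral multiple in any given order. -/
lemma exists_nat_mul_mem (B : QuadraticCoords A) (c : ℕ+) (z : A) :
    ∃ e : ℕ, 0 < e ∧ (e : A) * z ∈ conductorOrder A c := by
  refine ⟨(B.re z).den * (B.im z).den * c, ?_, (B.mem_conductorOrder c _).2
    ⟨⟨(B.re z).num * (B.im z).den * c, ?_⟩, (B.im z).num * (B.re z).den, ?_⟩⟩
  · have := c.pos; have := (B.re z).pos; have := (B.im z).pos; positivity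
  · have := Rat.mul_den_eq_num (B.re z)
    simp
    rw [← this]; ring
  · have := Rat.mul_den_eq_num (B.im z)
    simp
    rw [← this]; ring

lemma exists_nat_mul_mem_of_fg (B : QuadraticCoords A) (c : ℕ+)
    (I : InvertibleIdeal (conductorOrder A c)) :
    ∃ e : ℕ, 0 < e ∧ ∀ z ∈ (I : Submodule (conductorOrder A c) A),
      (e : A) * z ∈ conductorOrder A c := by
  obtain ⟨S, hS⟩ := Submodule.fg_unit I
  have key : ∃ e : ℕ, 0 < e ∧ ∀ z ∈ S, (e : A) * z ∈ conductorOrder A c := by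
    clear hS
    classical
    induction S using Finset.induction_on with
    | empty => exact ⟨1, one_pos, by simp⟩
    | insert a S _ ih =>
      obtain ⟨e, he, h⟩ := ih
      obtain ⟨e', he', h'⟩ := B.exists_nat_mul_mem c a
      refine ⟨e * e', mul_pos he he', fun z hz => ?_⟩
      rcases Finset.mem_insert.1 hz with rfl | hz
      · rw [Nat.cast_mul, mul_assoc]
        exact mul_mem (natCast_mem _ e) h'
      · rw [Nat.cast_mul, mul_comm (e : A), mul_assoc]
        exact mul_mem (natCast_mem _ e') (h z hz)
  obtain ⟨e, he, h⟩ := key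
  refine ⟨e, he, fun z hz => ?_⟩
  rw [← hS] at hz
  induction hz using Submodule.span_induction with
  | mem x hx => exact h x hx
  | zero => simp [zero_mem]
  | add x y _ _ hx hy => rw [mul_add]; exact add_mem hx hy
  | smul a x _ hx =>
    rw [Subring.smul_def, smul_eq_mul, mul_left_comm]
    exact mul_mem a.2 hx

/-- An invertible ideal has a basis in Hermite normal form. -/
lemma exists_hermite_basis (B : QuadraticCoords A) {c : ℕ+}
    (I : InvertibleIdeal (conductorOrder A c)) {e : ℕ} (he : 0 < e)
    (hI : ∀ z ∈ (I : Submodule (conductorOrder A c) A), (e : A) * z ∈ conductorOrder A c) :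
    ∃ p q r : ℤ, 0 < p ∧ 0 < r ∧ 0 ≤ q ∧ q < p ∧
      B.IsBasis (I : Submodule (conductorOrder A c) A) (B.elt (p / e) 0)
        (B.elt (q / e) (r * c / e)) := by
  have he0 : (e : ℚ) ≠ 0 := by exact_mod_cast he.ne'
  have hc0 : ((c : ℕ) : ℚ) ≠ 0 := by exact_mod_cast c.pos.ne'
  let φ : ℤ × ℤ →+ A :=
    { toFun := fun v => B.elt (v.1 / e) (v.2 * c / e)
      map_zero' := by apply B.ext <;> simp
      map_add' := fun v w => by apply B.ext <;> simp <;> ring }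
  obtain ⟨p, q, r, hp, hr, hH⟩ :=
    ((I : Submodule (conductorOrder A c) A).toAddSubgroup.comap φ).exists_hermite
  have hH' : ∀ m k : ℤ, B.elt (m / e) (k * c / e) ∈ (I : Submodule (conductorOrder A c) A) ↔
      ∃ i j : ℤ, m = i * p + j * q ∧ k = j * r := hH
  obtain ⟨d, hd, hd'⟩ := B.exists_nat_mul_mem_of_fg c I⁻¹
  have hd1 : ∀ z ∈ conductorOrder A c, (d : A) * z ∈ (I : Submodule (conductorOrder A c) A) := by
    intro z hz
    have h1 : (d : A) * z ∈ (I : Submodule (conductorOrder A c) A) * (↑I⁻¹ : Submodule _ A) := by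
      rw [I.mul_inv, mem_one_iff_mem_order]
      exact mul_mem (natCast_mem _ d) hz
    have h2 : ∀ u ∈ (I : Submodule (conductorOrder A c) A) * (↑I⁻¹ : Submodule _ A),
        (d : A) * u ∈ (I : Submodule (conductorOrder A c) A) := by
      intro u hu
      refine Submodule.mul_induction_on hu (fun m hm k hk => ?_) fun x y hx hy => ?_
      · rw [mul_left_comm, mul_comm]
        exact (I : Submodule (conductorOrder A c) A).smul_mem ⟨_, hd' k hk⟩ hm
      · rw [mul_add]; exact add_mem hx hy
    have h3 : z ∈ (I : Submodule (conductorOrder A c) A) * (↑I⁻¹ : Submodule _ A) := by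
      rw [I.mul_inv, mem_one_iff_mem_order]; exact hz
    exact h2 z h3
  have hpe : ∃ i j : ℤ, ((d * e : ℕ) : ℤ) = i * p + j * q ∧ 0 = j * r := by
    rw [← hH' (d * e : ℕ) 0]
    convert hd1 1 (one_mem _) using 1
    apply B.ext <;> simp [he0]
  have hre : ∃ i j : ℤ, 0 = i * p + j * q ∧ ((d * e : ℕ) : ℤ) = j * r := by
    rw [← hH' 0 (d * e : ℕ)]
    convert hd1 (B.elt 0 c) ((B.mem_conductorOrder c _).2 ⟨⟨0, by simp⟩, 1, by simp⟩) using 1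
    apply B.ext <;> simp
    field_simp
  have hde : ((d * e : ℕ) : ℤ) ≠ 0 := by exact_mod_cast (mul_pos hd he).ne'
  have hr0 : 0 < r := by
    rcases hr.lt_or_eq with h | rfl
    · exact h
    · obtain ⟨i, j, -, h⟩ := hre
      exact absurd h (by simpa using hde)
  have hp0 : 0 < p := by
    rcases hp.lt_or_eq with h | rfl
    · exact h
    · obtain ⟨i, j, h, h'⟩ := hpe
      obtain rfl : j = 0 := by
        rcases mul_eq_zero.1 h'.symm with h | h
        · exact h
        · exact absurd h hr0.ne'
      exact absurd h (by simpa using hde)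
  have hmod := Int.emod_add_mul_ediv q p
  refine ⟨p, q % p, r, hp0, hr0, Int.emod_nonneg _ hp0.ne', Int.emod_lt_of_pos _ hp0, ?_, fun z => ?_⟩
  · have : (p : ℚ) ≠ 0 := by exact_mod_cast hp0.ne'
    have : (r : ℚ) ≠ 0 := by exact_mod_cast hr0.ne'
    have hdet : B.det (B.elt (p / e) 0) (B.elt ((q % p : ℤ) / e) (r * c / e)) =
        p / e * (r * c / e) := by simp [det]
    rw [hdet]
    positivity
  · have hmodQ : ((q % p : ℤ) : ℚ) = q - p * (q / p : ℤ) := by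
      rw [eq_sub_iff_add_eq]; exact_mod_cast hmod
    constructor
    · intro hz
      obtain ⟨⟨m, hm⟩, k, hk⟩ := (B.mem_conductorOrder c _).1 (hI z hz)
      simp at hm hk
      have hz' : z = B.elt (m / e) (k * c / e) := by
        apply B.ext
        · rw [re_elt, ← hm]; field_simp
        · rw [im_elt, mul_comm, ← hk]; field_simp
      rw [hz', hH'] at hz
      obtain ⟨i, j, rfl, rfl⟩ := hz
      refine ⟨i + j * (q / p), j, ?_⟩
      rw [hz']
      apply B.ext
      · simp [hmodQ]; ring
      · simp; ring
    · rintro ⟨m, k, rfl⟩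
      have : (m : A) * B.elt (p / e) 0 + k * B.elt ((q % p : ℤ) / e) (r * c / e) =
          B.elt (((m - k * (q / p)) * p + k * q : ℤ) / e) ((k * r : ℤ) * c / e) := by
        apply B.ext
        · simp [hmodQ]; ring
        · simp; ring
      rw [this, hH']
      exact ⟨_, _, rfl, rfl⟩

lemma exists_isBasis (B : QuadraticCoords A) {c : ℕ+} (I : InvertibleIdeal (conductorOrder A c)) :
    ∃ x y : A, B.IsBasis (I : Submodule (conductorOrder A c) A) x y := by
  obtain ⟨e, he, h⟩ := B.exists_nat_mul_mem_of_fg c I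
  obtain ⟨p, q, r, -, -, -, -, h'⟩ := B.exists_hermite_basis I he h
  exact ⟨_, _, h'⟩

/-- The rational basis given by a pair of nonzero determinant. -/
noncomputable def basisOfDet (B : QuadraticCoords A) {x y : A} (h : B.det x y ≠ 0) :
    Module.Basis (Fin 2) ℚ A :=
  .mk (v := ![x, y])
    (by
      rw [LinearIndependent.pair_iff]
      intro p q hpq
      refine B.comb_inj h (p' := 0) (q' := 0) ?_
      simpa [Algebra.smul_def] using hpq)
    (by
      rintro z -
      obtain ⟨p, q, rfl⟩ := B.exists_comb h z
      rw [Matrix.range_cons, Matrix.range_cons, Matrix.range_empty, Set.union_empty,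
        Set.singleton_union, Submodule.mem_span_pair]
      exact ⟨p, q, by simp [Algebra.smul_def]⟩)

lemma IsBasis.closure_eq {O : Subring A} {I : Submodule O A} {x y : A} (h : B.IsBasis I x y) :
    I.toAddSubgroup = .closure (Set.range (B.basisOfDet h.1)) := by
  rw [basisOfDet, Module.Basis.coe_mk, Matrix.range_cons, Matrix.range_cons, Matrix.range_empty,
    Set.union_empty, Set.singleton_union]
  ext z
  rw [Submodule.mem_toAddSubgroup, h.2, AddSubgroup.mem_closure_pair]
  simp [eq_comm]

/-- The norm of an integral ideal as a determinant. -/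
lemma IsBasis.norm_eq {c : ℕ+} {a : IntegralIdeal (conductorOrder A c)} {x y : A}
    (h : B.IsBasis (a.1 : Submodule (conductorOrder A c) A) x y) :
    (a.norm : ℚ) = |B.det x y| / c := by
  have hc0 : ((c : ℕ) : ℚ) ≠ 0 := by exact_mod_cast c.pos.ne'
  have h1 : B.IsBasis (1 : Submodule (conductorOrder A c) A) 1 (B.elt 0 c) := by
    refine ⟨by simp [det], fun z => ?_⟩
    rw [mem_one_iff_mem_order, B.mem_conductorOrder]
    constructor
    · rintro ⟨⟨m, hm⟩, k, hk⟩
      refine ⟨m, k, ?_⟩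
      apply B.ext
      · simp [hm]
      · simp [hk, mul_comm]
    · rintro ⟨m, k, rfl⟩
      exact ⟨⟨m, by simp⟩, k, by simp [mul_comm]⟩
  rw [IntegralIdeal.norm, AddSubgroup.relIndex_eq_abs_det _ _ a.2 _ _ h.closure_eq h1.closure_eq,
    Module.Basis.det_apply, Matrix.det_fin_two]
  have hrepr : ∀ z : A, (B.basisOfDet h1.1).repr z 0 = B.re z ∧
      (B.basisOfDet h1.1).repr z 1 = B.im z / c := by
    intro z
    set b := B.basisOfDet h1.1
    have h0 := b.sum_repr z
    have hb0 : b 0 = 1 := by simp [b, basisOfDet]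
    have hb1 : b 1 = B.elt 0 c := by simp [b, basisOfDet]
    rw [Fin.sum_univ_two, hb0, hb1, Algebra.smul_def, Algebra.smul_def] at h0
    have h2 := congrArg B.re h0
    have h3 := congrArg B.im h0
    simp at h2 h3
    exact ⟨h2, by rw [← h3]; field_simp⟩
  simp only [Module.Basis.toMatrix_apply, hrepr]
  have hx : B.basisOfDet h.1 0 = x := by simp [basisOfDet]
  have hy : B.basisOfDet h.1 1 = y := by simp [basisOfDet]
  rw [hx, hy, det, ← abs_of_pos (show (0 : ℚ) < c by exact_mod_cast c.pos), ← abs_div,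
    abs_of_pos (show (0 : ℚ) < c by exact_mod_cast c.pos)]
  congr 1
  ring

lemma hasNorm_norm (B : QuadraticCoords A) {c : ℕ+} (a : IntegralIdeal (conductorOrder A c)) :
    B.HasNorm a.1 a.norm := by
  obtain ⟨x, y, h⟩ := B.exists_isBasis a.1
  rw [h.norm_eq]
  exact h.hasNorm

end QuadraticCoords

/-! ### Cubic forms attached to lattices -/

namespace BinaryCubicForm

/-- Some form in every orbit of nonzero discriminant has a Hessian with nonzero leading
coefficient. -/
lemma exists_smul_hessian_ne_zero (f : BinaryCubicForm) (hf : f.disc ≠ 0) :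
    ∃ γ : SL(2, ℤ), (γ • f).x₁ ^ 2 - 3 * (γ • f).x₀ * (γ • f).x₂ ≠ 0 := by
  by_contra! h
  let S : SL(2, ℤ) := ⟨!![0, -1; 1, 0], by simp [Matrix.det_fin_two]⟩
  let T : SL(2, ℤ) := ⟨!![1, 1; 0, 1], by simp [Matrix.det_fin_two]⟩
  have h1 := h 1
  have h2 := h S
  have h3 := h T
  rw [one_smul] at h1
  rw [smul_x₀, smul_x₁, smul_x₂] at h2 h3
  simp [S] at h2
  simp [T] at h3
  have h4 : f.x₁ * f.x₂ - 9 * f.x₀ * f.x₃ = 0 := by linear_combination h3 - h1 - h2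
  have h5 : 3 * f.disc = 0 := by
    rw [disc]
    linear_combination (4 * (f.x₂ ^ 2 - 3 * f.x₁ * f.x₃)) * h1 - (f.x₁ * f.x₂ - 9 * f.x₀ * f.x₃) * h4
  omega

end BinaryCubicForm

namespace QuadraticCoords

variable {A : Type*} [CommRing A] [Algebra ℚ A] (B : QuadraticCoords A)

/-- The form `f` is `im (ε (x u + y v) ^ 3)`. -/
def IsFormOf (ε x y : A) (f : BinaryCubicForm) : Prop :=
  (f.x₀ : ℚ) = B.im (ε * x ^ 3) ∧ (f.x₁ : ℚ) = 3 * B.im (ε * x ^ 2 * y) ∧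
    (f.x₂ : ℚ) = 3 * B.im (ε * x * y ^ 2) ∧ (f.x₃ : ℚ) = B.im (ε * y ^ 3)

lemma im_sq_sub (p x y : A) :
    B.im (p * x * y) ^ 2 - B.im (p * x ^ 2) * B.im (p * y ^ 2) = B.nm p * B.det x y ^ 2 := by
  simp only [pow_two, im_mul, re_mul, nm, det]; ring

lemma im_mul_sub (p x y : A) :
    B.im (p * x ^ 2 * y) * B.im (p * x * y ^ 2) - B.im (p * x ^ 3) * B.im (p * y ^ 3) =
      B.nm p * B.pair x y * B.det x y ^ 2 := by
  simp only [pow_succ, pow_zero, one_mul, im_mul, re_mul, nm, det, pair]; ring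

variable {B}

/-- The coefficients of the Hessian of an attached form are those of the norm form of the lattice,
up to a constant. -/
lemma IsFormOf.hessian {ε x y : A} {f : BinaryCubicForm} (h : B.IsFormOf ε x y f) :
    (f.x₁ : ℚ) ^ 2 - 3 * f.x₀ * f.x₂ = 9 * (B.nm ε * B.det x y ^ 2 * B.nm x) ∧
      (f.x₁ : ℚ) * f.x₂ - 9 * f.x₀ * f.x₃ = 9 * (B.nm ε * B.det x y ^ 2 * B.pair x y) ∧
      (f.x₂ : ℚ) ^ 2 - 3 * f.x₁ * f.x₃ = 9 * (B.nm ε * B.det x y ^ 2 * B.nm y) := by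
  obtain ⟨h0, h1, h2, h3⟩ := h
  rw [h0, h1, h2, h3]
  refine ⟨?_, ?_, ?_⟩
  · have := B.im_sq_sub (ε * x) x y
    rw [nm_mul, show ε * x * x * y = ε * x ^ 2 * y by ring,
      show ε * x * x ^ 2 = ε * x ^ 3 by ring] at this
    linear_combination 9 * this
  · linear_combination 9 * B.im_mul_sub ε x y
  · have := B.im_sq_sub (ε * y) x y
    rw [nm_mul, show ε * y * x * y = ε * x * y ^ 2 by ring,
      show ε * y * x ^ 2 = ε * x ^ 2 * y by ring, show ε * y * y ^ 2 = ε * y ^ 3 by ring] at this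
    linear_combination 9 * this

lemma IsFormOf.disc_eq {ε x y : A} {f : BinaryCubicForm} (h : B.IsFormOf ε x y f) :
    (f.disc : ℚ) = -27 * (B.disc * B.nm ε ^ 2 * B.det x y ^ 6) := by
  obtain ⟨h1, h2, h3⟩ := h.hessian
  have h4 := B.pair_sq x y
  have h5 : -3 * (f.disc : ℚ) = ((f.x₁ : ℚ) * f.x₂ - 9 * f.x₀ * f.x₃) ^ 2 -
      4 * ((f.x₁ : ℚ) ^ 2 - 3 * f.x₀ * f.x₂) * ((f.x₂ : ℚ) ^ 2 - 3 * f.x₁ * f.x₃) := by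
    rw [BinaryCubicForm.disc]; push_cast; ring
  rw [h1, h2, h3] at h5
  linear_combination (-1 / 3) * h5 - 27 * (B.nm ε * B.det x y ^ 2) ^ 2 * h4

variable (B) in
lemma im_intCast_mul (m : ℤ) (z : A) : B.im (m * z) = m * B.im z := by simp

/-- Changing the basis of the lattice by `γ` changes the form by `γ`. -/
lemma IsFormOf.smul {ε x y : A} {f : BinaryCubicForm} (h : B.IsFormOf ε x y f) (γ : SL(2, ℤ)) :
    B.IsFormOf ε (γ 0 0 * x + γ 0 1 * y) (γ 1 0 * x + γ 1 1 * y) (γ • f) := by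
  obtain ⟨h0, h1, h2, h3⟩ := h
  have key : ∀ m₀ m₁ m₂ m₃ : ℤ, B.im (m₀ * (ε * x ^ 3) + m₁ * (ε * x ^ 2 * y) +
      m₂ * (ε * x * y ^ 2) + m₃ * (ε * y ^ 3)) = m₀ * B.im (ε * x ^ 3) + m₁ * B.im (ε * x ^ 2 * y) +
      m₂ * B.im (ε * x * y ^ 2) + m₃ * B.im (ε * y ^ 3) := by
    intro m₀ m₁ m₂ m₃
    simp only [im_add, im_intCast_mul]
  set a := γ 0 0
  set b := γ 0 1
  set c := γ 1 0
  set d := γ 1 1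
  refine ⟨?_, ?_, ?_, ?_⟩
  · rw [BinaryCubicForm.smul_x₀]
    push_cast
    rw [h0, h1, h2, h3]
    have := key (a ^ 3) (3 * a ^ 2 * b) (3 * a * b ^ 2) (b ^ 3)
    push_cast at this
    rw [show ε * (a * x + b * y) ^ 3 = (a : A) ^ 3 * (ε * x ^ 3) + 3 * a ^ 2 * b * (ε * x ^ 2 * y) +
      3 * a * b ^ 2 * (ε * x * y ^ 2) + b ^ 3 * (ε * y ^ 3) by ring, this]
    ring
  · rw [BinaryCubicForm.smul_x₁]
    push_cast
    rw [h0, h1, h2, h3]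
    have := key (a ^ 2 * c) (a ^ 2 * d + 2 * a * b * c) (2 * a * b * d + b ^ 2 * c) (b ^ 2 * d)
    push_cast at this
    rw [show ε * (a * x + b * y) ^ 2 * (c * x + d * y) = (a : A) ^ 2 * c * (ε * x ^ 3) +
      (a ^ 2 * d + 2 * a * b * c) * (ε * x ^ 2 * y) +
      (2 * a * b * d + b ^ 2 * c) * (ε * x * y ^ 2) + b ^ 2 * d * (ε * y ^ 3) by ring, this]
    ring
  · rw [BinaryCubicForm.smul_x₂]
    push_cast
    rw [h0, h1, h2, h3]
    have := key (a * c ^ 2) (2 * a * c * d + b * c ^ 2) (a * d ^ 2 + 2 * b * c * d) (b * d ^ 2)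
    push_cast at this
    rw [show ε * (a * x + b * y) * (c * x + d * y) ^ 2 = (a : A) * c ^ 2 * (ε * x ^ 3) +
      (2 * a * c * d + b * c ^ 2) * (ε * x ^ 2 * y) +
      (a * d ^ 2 + 2 * b * c * d) * (ε * x * y ^ 2) + b * d ^ 2 * (ε * y ^ 3) by ring, this]
    ring
  · rw [BinaryCubicForm.smul_x₃]
    push_cast
    rw [h0, h1, h2, h3]
    have := key (c ^ 3) (3 * c ^ 2 * d) (3 * c * d ^ 2) (d ^ 3)
    push_cast at this
    rw [show ε * (c * x + d * y) ^ 3 = (c : A) ^ 3 * (ε * x ^ 3) + 3 * c ^ 2 * d * (ε * x ^ 2 * y) +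
      3 * c * d ^ 2 * (ε * x * y ^ 2) + d ^ 3 * (ε * y ^ 3) by ring, this]
    ring

lemma det_smul (γ : SL(2, ℤ)) (x y : A) :
    B.det (γ 0 0 * x + γ 0 1 * y) (γ 1 0 * x + γ 1 1 * y) = B.det x y := by
  rw [det_comb]
  have h := γ.det_coe
  rw [Matrix.det_fin_two] at h
  have h' : ((γ 0 0 : ℤ) * γ 1 1 - γ 0 1 * γ 1 0 : ℚ) = 1 := by exact_mod_cast h
  rw [h', one_mul]

/-- A pair is determined, up to a common factor, by its norm form and its determinant up to a
common factor. -/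
lemma exists_unit_of_similar {x y x' y' : A} {m : ℚ} (hm : m ≠ 0) (hd : B.det x y ≠ 0)
    (h1 : B.nm x' = m * B.nm x) (h2 : B.pair x' y' = m * B.pair x y)
    (h3 : B.nm y' = m * B.nm y) (h4 : B.det x' y' = m * B.det x y) :
    ∃ κ : Aˣ, x' = κ * x ∧ y' = κ * y := by
  obtain ⟨p, q, hpq⟩ := B.exists_comb hd 1
  -- the conjugate products of `x', y'` are those of `x, y` multiplied by `m`
  have hxx : B.conj x' * x' = algebraMap ℚ A m * (B.conj x * x) := by
    rw [mul_comm, mul_conj, h1, mul_comm (B.conj x), mul_conj, map_mul]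
  have hyy : B.conj y' * y' = algebraMap ℚ A m * (B.conj y * y) := by
    rw [mul_comm, mul_conj, h3, mul_comm (B.conj y), mul_conj, map_mul]
  have hxy : B.conj x' * y' = algebraMap ℚ A m * (B.conj x * y) := by
    simp only [det, pair] at h2 h4
    apply B.ext
    · simp
      linear_combination (1 / 2) * h2 + (-B.t / 2 : ℚ) * h4
    · simp
      linear_combination h4
  have hyx : B.conj y' * x' = algebraMap ℚ A m * (B.conj y * x) := by
    have := congrArg B.conj hxy
    simp only [conj_mul, conj_conj, conj_algebraMap] at this
    rw [mul_comm, this, mul_comm x]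
  set κ := algebraMap ℚ A p * x' + algebraMap ℚ A q * y' with hκ
  have hcx : B.conj κ * x' = algebraMap ℚ A m * x := by
    have h5 := congrArg B.conj hpq
    simp only [conj_mul, conj_add, conj_algebraMap] at h5
    rw [show B.conj (1 : A) = 1 by apply B.ext <;> simp] at h5
    simp only [hκ, conj_mul, conj_add, conj_algebraMap]
    linear_combination (algebraMap ℚ A p) * hxx + algebraMap ℚ A q * hyx - algebraMap ℚ A m * x * h5
  have hcy : B.conj κ * y' = algebraMap ℚ A m * y := by
    have h5 := congrArg B.conj hpq
    simp only [conj_mul, conj_add, conj_algebraMap] at h5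
    rw [show B.conj (1 : A) = 1 by apply B.ext <;> simp] at h5
    simp only [hκ, conj_mul, conj_add, conj_algebraMap]
    linear_combination (algebraMap ℚ A p) * hxy + algebraMap ℚ A q * hyy - algebraMap ℚ A m * y * h5
  have hcκ : B.conj κ * κ = algebraMap ℚ A m := by
    conv_lhs => arg 2; rw [hκ]
    linear_combination algebraMap ℚ A p * hcx + algebraMap ℚ A q * hcy - algebraMap ℚ A m * hpq
  have hm1 := algebraMap_mul_inv (A := A) hm
  have hu : IsUnit κ := IsUnit.of_mul_eq_one (B.conj κ * algebraMap ℚ A m⁻¹) (by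
    linear_combination algebraMap ℚ A m⁻¹ * hcκ + hm1)
  obtain ⟨u, hu⟩ := hu
  refine ⟨u, ?_, ?_⟩ <;> rw [hu]
  · linear_combination (-x' * algebraMap ℚ A m⁻¹) * hcκ + (κ * x - x') * hm1 +
      κ * algebraMap ℚ A m⁻¹ * hcx
  · linear_combination (-y' * algebraMap ℚ A m⁻¹) * hcκ + (κ * y - y') * hm1 +
      κ * algebraMap ℚ A m⁻¹ * hcy

/-- The linear functional `z ↦ im (η z)` determines `η`, already on the cubic monomials in a
basis. -/
lemma eq_zero_of_im_eq_zero {η x y : A} (hd : B.det x y ≠ 0) (h0 : B.im (η * x ^ 3) = 0)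
    (h1 : B.im (η * x ^ 2 * y) = 0) (h2 : B.im (η * x * y ^ 2) = 0) (h3 : B.im (η * y ^ 3) = 0) :
    η = 0 := by
  have key : ∀ z : A, B.im (η * z) = 0 := by
    intro z
    obtain ⟨p, q, hpq⟩ := B.exists_comb hd 1
    obtain ⟨r, s, hz⟩ := B.exists_comb hd z
    have e : η * z = algebraMap ℚ A (p ^ 2 * r) * (η * x ^ 3) +
        algebraMap ℚ A (p ^ 2 * s + 2 * p * q * r) * (η * x ^ 2 * y) +
        algebraMap ℚ A (2 * p * q * s + q ^ 2 * r) * (η * x * y ^ 2) +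
        algebraMap ℚ A (q ^ 2 * s) * (η * y ^ 3) := by
      rw [show η * z = η * (1 * 1 * z) by ring, hz]
      nth_rewrite 1 [hpq]
      nth_rewrite 1 [hpq]
      simp only [map_add, map_mul, map_pow, map_ofNat]
      ring
    have hq : ∀ (a : ℚ) (w : A), B.im (algebraMap ℚ A a * w) = a * B.im w := fun a w => by
      rw [im_mul, re_algebraMap, im_algebraMap]; ring
    rw [e]
    simp only [im_add, hq, h0, h1, h2, h3]
    ring
  apply B.ext
  · have := key (B.elt 0 1)
    have h4 := key 1
    rw [mul_one] at h4
    simp [h4] at this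
    simpa using this
  · simpa using key 1

/-- An attached form determines the lattice and the multiplier up to scaling. -/
theorem IsFormOf.unique {ε ε' x y x' y' : A} {f : BinaryCubicForm}
    (h : B.IsFormOf ε x y f) (h' : B.IsFormOf ε' x' y' f)
    (ho : 0 < B.nm ε * B.det x y) (ho' : 0 < B.nm ε' * B.det x' y') :
    ∃ κ : Aˣ, x' = κ * x ∧ y' = κ * y ∧ ε = ε' * κ ^ 3 := by
  obtain ⟨a1, a2, a3⟩ := h.hessian
  obtain ⟨b1, b2, b3⟩ := h'.hessian
  rw [a1] at b1
  rw [a2] at b2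
  rw [a3] at b3
  have hε : B.nm ε ≠ 0 := left_ne_zero_of_mul ho.ne'
  have hd : B.det x y ≠ 0 := right_ne_zero_of_mul ho.ne'
  have hε' : B.nm ε' ≠ 0 := left_ne_zero_of_mul ho'.ne'
  have hd' : B.det x' y' ≠ 0 := right_ne_zero_of_mul ho'.ne'
  set m := B.nm ε * B.det x y ^ 2 / (B.nm ε' * B.det x' y' ^ 2) with hm
  have hm0 : m ≠ 0 := by rw [hm]; positivity
  have c1 : B.nm x' = m * B.nm x := by rw [hm]; field_simp; linear_combination -b1 / 9
  have c2 : B.pair x' y' = m * B.pair x y := by rw [hm]; field_simp; linear_combination -b2 / 9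
  have c3 : B.nm y' = m * B.nm y := by rw [hm]; field_simp; linear_combination -b3 / 9
  have c4 : B.det x' y' = m * B.det x y := by
    have e1 := B.pair_sq x y
    have e2 := B.pair_sq x' y'
    rw [c1, c2, c3] at e2
    have e3 : B.det x' y' ^ 2 = (m * B.det x y) ^ 2 := by
      apply mul_left_cancel₀ B.disc_ne
      linear_combination m ^ 2 * e1 - e2
    rcases sq_eq_sq_iff_eq_or_eq_neg.1 e3 with h | h
    · exact h
    · -- the opposite sign is excluded by the two orientations
      exfalso
      have e4 : m * (B.nm ε' * B.det x' y') * B.det x' y' = B.nm ε * B.det x y ^ 2 := by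
        rw [hm]; field_simp
      rw [h] at e4
      have e5 : m ^ 2 * (B.nm ε' * B.det x' y') * B.det x y = -(B.nm ε * B.det x y) * B.det x y := by
        rw [h]; linear_combination -e4
      have e6 := mul_right_cancel₀ hd e5
      have : 0 < m ^ 2 * (B.nm ε' * B.det x' y') := by positivity
      linarith
  obtain ⟨κ, hx, hy⟩ := exists_unit_of_similar hm0 hd c1 c2 c3 c4
  refine ⟨κ, hx, hy, ?_⟩
  obtain ⟨p0, p1, p2, p3⟩ := h
  obtain ⟨q0, q1, q2, q3⟩ := h'
  rw [← sub_eq_zero]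
  apply eq_zero_of_im_eq_zero hd
  · rw [q0, hx] at p0
    rw [show (ε - ε' * κ ^ 3) * x ^ 3 = ε * x ^ 3 - ε' * (κ * x) ^ 3 by ring, im_sub, p0, sub_self]
  · rw [q1, hx, hy] at p1
    rw [show (ε - ε' * κ ^ 3) * x ^ 2 * y = ε * x ^ 2 * y - ε' * (κ * x) ^ 2 * (κ * y) by ring,
      im_sub]
    linear_combination -p1 / 3
  · rw [q2, hx, hy] at p2
    rw [show (ε - ε' * κ ^ 3) * x * y ^ 2 = ε * x * y ^ 2 - ε' * (κ * x) * (κ * y) ^ 2 by ring,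
      im_sub]
    linear_combination -p2 / 3
  · rw [q3, hy] at p3
    rw [show (ε - ε' * κ ^ 3) * y ^ 3 = ε * y ^ 3 - ε' * (κ * y) ^ 3 by ring, im_sub, p3, sub_self]

lemma IsFormOf.mul_unit {ε x y : A} {f : BinaryCubicForm} (h : B.IsFormOf ε x y f) (κ : Aˣ) :
    B.IsFormOf (ε * ↑(κ⁻¹ ^ 3)) (κ * x) (κ * y) f := by
  have hκ : ((κ⁻¹ ^ 3 : Aˣ) : A) * κ ^ 3 = 1 := by
    rw [← Units.val_pow_eq_pow_val, ← Units.val_mul]; simp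
  obtain ⟨h0, h1, h2, h3⟩ := h
  refine ⟨?_, ?_, ?_, ?_⟩
  · rw [h0]; congr 1; linear_combination (-ε * x ^ 3) * hκ
  · rw [h1]; congr 2; linear_combination (-ε * x ^ 2 * y) * hκ
  · rw [h2]; congr 2; linear_combination (-ε * x * y ^ 2) * hκ
  · rw [h3]; congr 1; linear_combination (-ε * y ^ 3) * hκ

lemma IsFormOf.conj {ε x y : A} {f : BinaryCubicForm} (h : B.IsFormOf ε x y f) :
    B.IsFormOf (-B.conj ε) (B.conj x) (B.conj y) f := by
  obtain ⟨h0, h1, h2, h3⟩ := h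
  have key : ∀ z, B.im (- B.conj z) = B.im z := fun z => by simp
  refine ⟨?_, ?_, ?_, ?_⟩
  · rw [h0, ← key]; simp only [pow_succ, pow_zero, one_mul, conj_mul, neg_mul]
  · rw [h1, ← key]; simp only [pow_succ, pow_zero, one_mul, conj_mul, neg_mul]
  · rw [h2, ← key]; simp only [pow_succ, pow_zero, one_mul, conj_mul, neg_mul]
  · rw [h3, ← key]; simp only [pow_succ, pow_zero, one_mul, conj_mul, neg_mul]

/-- A dual form whose discriminant has the square class of the algebra is attached to a pair: for
`Δ r² = H₁² - 4 H₀ H₂` with the Hessian `(H₀, H₁, H₂)`, the pair is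
`(H₀, (H₁ + r √Δ) / 2)`. -/
theorem exists_isFormOf (B : QuadraticCoords A) {f : BinaryCubicForm} (hf : f.IsDual) {r : ℚ}
    (hr : r ≠ 0) (hD : (f.disc : ℚ) = -27 * (B.disc * r ^ 2))
    (hA : f.x₁ ^ 2 - 3 * f.x₀ * f.x₂ ≠ 0) :
    ∃ ε x y : A, 0 < B.nm ε * B.det x y ∧ B.IsFormOf ε x y f := by
  suffices h : ∃ ε x y : A, B.IsFormOf ε x y f by
    obtain ⟨ε, x, y, h⟩ := h
    have h1 := h.disc_eq
    rw [hD] at h1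
    have h2 : (B.disc * B.nm ε ^ 2 * B.det x y ^ 6) ≠ 0 := by
      have := mul_ne_zero B.disc_ne (pow_ne_zero 2 hr)
      intro h0
      rw [h0] at h1
      apply this
      linarith
    have h3 : B.nm ε * B.det x y ≠ 0 := by
      intro h0
      apply h2
      linear_combination (B.disc * B.nm ε * B.det x y ^ 5) * h0
    rcases h3.lt_or_gt with h4 | h4
    · refine ⟨_, _, _, ?_, h.conj⟩
      rw [nm_neg, nm_conj, det_conj]
      linarith
    · exact ⟨ε, x, y, h4, h⟩
  obtain ⟨⟨b, hb⟩, e, he⟩ := hf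
  set a := f.x₀ with ha
  set d := f.x₃ with hd
  set P : ℚ := b ^ 2 - a * e with hP
  set Q : ℚ := b * e - a * d with hQ
  set R : ℚ := e ^ 2 - b * d with hR
  have hP0 : P ≠ 0 := by
    intro h0
    apply hA
    have h1 : b ^ 2 - a * e = 0 := by rw [hP] at h0; exact_mod_cast h0
    rw [hb, he]; linear_combination 9 * h1
  have hQ2 : Q ^ 2 - 4 * P * R = B.disc * r ^ 2 := by
    have : (f.disc : ℚ) = -27 * (Q ^ 2 - 4 * P * R) := by
      rw [BinaryCubicForm.disc, hb, he, hP, hQ, hR]; push_cast; ring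
    rw [this] at hD
    linarith
  -- `y = (Q + r (2 w - t)) / 2` is a root of `Y ^ 2 - Q Y + P R`
  set y := B.elt ((Q - r * B.t) / 2) r with hy
  have hyy : y ^ 2 = algebraMap ℚ A Q * y - algebraMap ℚ A (P * R) := by
    rw [pow_two]
    have hdisc : (B.disc : ℚ) = B.t ^ 2 - 4 * B.n := by simp [QuadraticCoords.disc]
    rw [hdisc] at hQ2
    apply B.ext
    · rw [re_sub, re_algebraMap, re_mul, re_mul, re_algebraMap, im_algebraMap]
      simp [hy]
      linear_combination (-1 / 4) * hQ2
    · rw [im_sub, im_algebraMap, im_mul, im_mul, re_algebraMap, im_algebraMap]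
      simp [hy]
      ring
  set x := algebraMap ℚ A P with hx
  have hlin : ∀ (q : ℚ) (z : A), B.im (algebraMap ℚ A q * z) = q * B.im z := fun q z => by
    rw [im_mul, re_algebraMap, im_algebraMap]; ring
  -- the multiplier is determined by the first two coefficients
  set ε := B.elt ((b / P ^ 2 - a / P ^ 3 * ((Q - r * B.t) / 2 + B.t * r)) / r) (a / P ^ 3) with hε
  have i0 : B.im ε = a / P ^ 3 := by simp [hε]
  have i1 : B.im (ε * y) = b / P ^ 2 := by
    simp [hε, hy]; field_simp; ring
  have i2 : B.im (ε * y ^ 2) = e / P := by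
    rw [hyy, show ε * (algebraMap ℚ A Q * y - algebraMap ℚ A (P * R)) =
      algebraMap ℚ A Q * (ε * y) - algebraMap ℚ A (P * R) * ε by ring, im_sub, hlin, hlin, i0, i1]
    field_simp
    rw [hP, hQ, hR]; ring
  have i3 : B.im (ε * y ^ 3) = d := by
    rw [show ε * y ^ 3 = ε * y * y ^ 2 by ring, hyy,
      show ε * y * (algebraMap ℚ A Q * y - algebraMap ℚ A (P * R)) =
      algebraMap ℚ A Q * (ε * y ^ 2) - algebraMap ℚ A (P * R) * (ε * y) by ring, im_sub, hlin, hlin,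
      i1, i2]
    field_simp
    rw [hP, hQ, hR]; ring
  refine ⟨ε, x, y, ?_, ?_, ?_, ?_⟩
  · rw [show ε * x ^ 3 = algebraMap ℚ A (P ^ 3) * ε by rw [hx, map_pow]; ring, hlin, i0]
    field_simp
    rfl
  · rw [show ε * x ^ 2 * y = algebraMap ℚ A (P ^ 2) * (ε * y) by rw [hx, map_pow]; ring, hlin, i1,
      hb]
    push_cast; field_simp
  · rw [show ε * x * y ^ 2 = algebraMap ℚ A P * (ε * y ^ 2) by rw [hx]; ring, hlin, i2, he]
    push_cast; field_simp
  · rw [i3]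

end QuadraticCoords

/-! ### Orbits of forms and ideal classes -/

lemma mul_mul_mem_cube {A : Type*} [CommRing A] {O : Subring A} {I : InvertibleIdeal O} (δ : Aˣ)
    {x y z : A}
    (hx : x ∈ (I : Submodule O A)) (hy : y ∈ (I : Submodule O A)) (hz : z ∈ (I : Submodule O A)) :
    (δ : A) * (x * y * z) ∈ ((principalIdeal O δ * I ^ 3 : InvertibleIdeal O) : Submodule O A) := by
  rw [mem_principalIdeal_mul, Units.inv_mul_cancel_left, Units.val_pow_eq_pow_val, pow_succ, pow_two]
  exact Submodule.mul_mem_mul (Submodule.mul_mem_mul hx hy) hz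

namespace QuadraticCoords

variable {A : Type*} [CommRing A] [Algebra ℚ A] (B : QuadraticCoords A)

/-- The form `f` is attached to the invertible ideal `I` of `𝒪_c`, the multiplier `δ` and the basis
`x, y` of `I`: it is `im (δ (x u + y v) ^ 3) / c`. The basis is oriented by the sign of
`nm δ * det x y`, which does not change under scaling by units of `A` of negative norm. -/
def Attached {c : ℕ+} (I : InvertibleIdeal (conductorOrder A c)) (δ : Aˣ) (x y : A)
    (f : BinaryCubicForm) : Prop :=
  B.IsBasis (I : Submodule (conductorOrder A c) A) x y ∧ 0 < B.nm δ * B.det x y ∧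
    B.IsFormOf (algebraMap ℚ A (c : ℚ)⁻¹ * δ) x y f

variable {B}

lemma im_inv_mul (c : ℕ+) (z : A) : B.im (algebraMap ℚ A (c : ℚ)⁻¹ * z) = B.im z / c := by
  rw [im_mul, re_algebraMap, im_algebraMap]; ring

lemma IsBasis.left_mem {O : Subring A} {I : Submodule O A} {x y : A} (h : B.IsBasis I x y) :
    x ∈ I := (h.2 x).2 ⟨1, 0, by simp⟩

lemma IsBasis.right_mem {O : Subring A} {I : Submodule O A} {x y : A} (h : B.IsBasis I x y) :
    y ∈ I := (h.2 y).2 ⟨0, 1, by simp⟩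

/-- Integrality of the attached form, in terms of the ideal `δ I ^ 3`. -/
lemma IsBasis.cube_le_one_iff {c : ℕ+} {I : InvertibleIdeal (conductorOrder A c)} {x y : A}
    (h : B.IsBasis (I : Submodule (conductorOrder A c) A) x y) (δ : Aˣ) :
    ((principalIdeal _ δ * I ^ 3 : InvertibleIdeal (conductorOrder A c)) : Submodule (conductorOrder A c) A) ≤ 1 ↔
      (∃ m : ℤ, B.im (δ * x ^ 3) = c * m) ∧ (∃ m : ℤ, B.im (δ * x ^ 2 * y) = c * m) ∧
        (∃ m : ℤ, B.im (δ * x * y ^ 2) = c * m) ∧ ∃ m : ℤ, B.im (δ * y ^ 3) = c * m := by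
  rw [B.le_one_iff]
  constructor
  · intro H
    have hx := h.left_mem
    have hy := h.right_mem
    refine ⟨?_, ?_, ?_, ?_⟩
    · convert H _ (mul_mul_mem_cube δ hx hx hx) using 4; ring
    · convert H _ (mul_mul_mem_cube δ hx hx hy) using 4; ring
    · convert H _ (mul_mul_mem_cube δ hx hy hy) using 4; ring
    · convert H _ (mul_mul_mem_cube δ hy hy hy) using 4; ring
  · rintro ⟨⟨m₀, h0⟩, ⟨m₁, h1⟩, ⟨m₂, h2⟩, m₃, h3⟩ z hz
    rw [mem_principalIdeal_mul, Units.val_pow_eq_pow_val, pow_succ, pow_two] at hz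
    have key : ∀ w ∈ (I : Submodule (conductorOrder A c) A) * (I : Submodule _ A) *
        (I : Submodule _ A), ∃ m : ℤ, B.im (δ * w) = c * m := by
      intro w hw
      refine Submodule.mul_induction_on hw (fun u hu k hk => ?_) ?_
      · refine Submodule.mul_induction_on hu (fun i hi j hj => ?_) ?_
        · obtain ⟨p, q, rfl⟩ := (h.2 i).1 hi
          obtain ⟨p', q', rfl⟩ := (h.2 j).1 hj
          obtain ⟨p'', q'', rfl⟩ := (h.2 k).1 hk
          have e : (δ : A) * ((p * x + q * y) * (p' * x + q' * y) * (p'' * x + q'' * y)) =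
              ((p * p' * p'' : ℤ) : A) * (δ * x ^ 3) +
              ((p * p' * q'' + p * q' * p'' + q * p' * p'' : ℤ) : A) * (δ * x ^ 2 * y) +
              ((p * q' * q'' + q * p' * q'' + q * q' * p'' : ℤ) : A) * (δ * x * y ^ 2) +
              ((q * q' * q'' : ℤ) : A) * (δ * y ^ 3) := by
            push_cast; ring
          rw [e]
          simp only [im_add, im_intCast_mul, h0, h1, h2, h3]
          refine ⟨(p * p' * p'') * m₀ + (p * p' * q'' + p * q' * p'' + q * p' * p'') * m₁ +
            (p * q' * q'' + q * p' * q'' + q * q' * p'') * m₂ + q * q' * q'' * m₃, ?_⟩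
          push_cast; ring
        · rintro u v ⟨m, hm⟩ ⟨m', hm'⟩
          exact ⟨m + m', by rw [add_mul, mul_add, im_add, hm, hm']; push_cast; ring⟩
      · rintro u v ⟨m, hm⟩ ⟨m', hm'⟩
        exact ⟨m + m', by rw [mul_add, im_add, hm, hm']; push_cast; ring⟩
    have := key _ hz
    rwa [Units.mul_inv_cancel_left] at this

/-- An ideal has a basis of prescribed orientation. -/
lemma exists_oriented_basis (B : QuadraticCoords A) {c : ℕ+}
    (I : InvertibleIdeal (conductorOrder A c)) (δ : Aˣ) :
    ∃ x y : A, B.IsBasis (I : Submodule (conductorOrder A c) A) x y ∧ 0 < B.nm δ * B.det x y := by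
  obtain ⟨x, y, h⟩ := B.exists_isBasis I
  rcases (mul_ne_zero (B.nm_ne_zero δ) h.1).lt_or_gt with h' | h'
  · have hd : B.det y x = - B.det x y := by simp only [det]; ring
    refine ⟨y, x, ⟨by rw [hd]; exact neg_ne_zero.2 h.1, fun z => ?_⟩, by rw [hd]; linarith⟩
    rw [h.2, exists_comm]
    simp only [add_comm]
  · exact ⟨x, y, h, h'⟩

lemma exists_attached (B : QuadraticCoords A) {c : ℕ+} (I : InvertibleIdeal (conductorOrder A c))
    (δ : Aˣ) (h : ((principalIdeal _ δ * I ^ 3 : InvertibleIdeal (conductorOrder A c)) :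
      Submodule (conductorOrder A c) A) ≤ 1) :
    ∃ (x y : A) (f : BinaryCubicForm), B.Attached I δ x y f ∧ f.IsDual := by
  obtain ⟨x, y, hb, ho⟩ := B.exists_oriented_basis I δ
  obtain ⟨⟨m₀, h0⟩, ⟨m₁, h1⟩, ⟨m₂, h2⟩, m₃, h3⟩ := (hb.cube_le_one_iff δ).1 h
  have hc : ((c : ℕ) : ℚ) ≠ 0 := by exact_mod_cast c.pos.ne'
  refine ⟨x, y, ⟨m₀, 3 * m₁, 3 * m₂, m₃⟩, ⟨hb, ho, ?_, ?_, ?_, ?_⟩, ⟨m₁, rfl⟩, m₂, rfl⟩ <;>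
    simp only [mul_assoc, im_inv_mul] at h0 h1 h2 h3 ⊢
  · rw [h0]; field_simp
  · rw [h1]; push_cast; field_simp
  · rw [h2]; push_cast; field_simp
  · rw [h3]; field_simp

lemma Attached.cube_le_one {c : ℕ+} {I : InvertibleIdeal (conductorOrder A c)} {δ : Aˣ} {x y : A}
    {f : BinaryCubicForm} (h : B.Attached I δ x y f) (hf : f.IsDual) :
    ((principalIdeal _ δ * I ^ 3 : InvertibleIdeal (conductorOrder A c)) : Submodule (conductorOrder A c) A) ≤ 1 := by
  obtain ⟨hb, -, h0, h1, h2, h3⟩ := h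
  obtain ⟨⟨m₁, hm₁⟩, m₂, hm₂⟩ := hf
  have hc : ((c : ℕ) : ℚ) ≠ 0 := by exact_mod_cast c.pos.ne'
  rw [hm₁] at h1
  rw [hm₂] at h2
  rw [hb.cube_le_one_iff]
  simp only [mul_assoc, im_inv_mul] at h0 h1 h2 h3 ⊢
  refine ⟨⟨f.x₀, ?_⟩, ⟨m₁, ?_⟩, ⟨m₂, ?_⟩, f.x₃, ?_⟩
  · rw [h0]; field_simp
  · push_cast at h1; field_simp at h1; linear_combination -h1
  · push_cast at h2; field_simp at h2; linear_combination -h2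
  · rw [h3]; field_simp

lemma Attached.disc_eq {c : ℕ+} {I : InvertibleIdeal (conductorOrder A c)} {δ : Aˣ} {x y : A}
    {f : BinaryCubicForm} (h : B.Attached I δ x y f) {a : IntegralIdeal (conductorOrder A c)}
    (ha : a.1 = principalIdeal _ δ * I ^ 3) :
    f.disc = -27 * (B.disc * c ^ 2 * a.norm ^ 2) := by
  have hc : ((c : ℕ) : ℚ) ≠ 0 := by exact_mod_cast c.pos.ne'
  have h1 := h.2.2.disc_eq
  have h2 : (a.norm : ℚ) = |B.nm δ| * (|B.det x y| / c) ^ 3 := by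
    have h3 := B.hasNorm_norm a
    rw [ha] at h3
    exact h3.unique ((B.hasNorm_principalIdeal δ).mul h.1.hasNorm.pow)
  have h4 : (a.norm : ℚ) ^ 2 = B.nm δ ^ 2 * B.det x y ^ 6 / c ^ 6 := by
    rw [h2, mul_pow, sq_abs, ← pow_mul, div_pow]
    have : |B.det x y| ^ (3 * 2) = B.det x y ^ 6 := by
      rw [show 3 * 2 = 2 * 3 by norm_num, pow_mul, sq_abs, ← pow_mul]
    rw [this]; ring
  have h5 : B.nm (algebraMap ℚ A (c : ℚ)⁻¹) = ((c : ℚ)⁻¹) ^ 2 := by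
    rw [nm, re_algebraMap, im_algebraMap]; ring
  rw [nm_mul, h5] at h1
  have h6 : (f.disc : ℚ) = -27 * (B.disc * c ^ 2 * a.norm ^ 2) := by
    rw [h1, h4]; field_simp
  exact_mod_cast h6

/-- Two bases of the same orientation differ by an element of `SL(2, ℤ)`. -/
lemma IsBasis.exists_smul {O : Subring A} {I : Submodule O A} {x y x' y' : A}
    (h : B.IsBasis I x y) (h' : B.IsBasis I x' y') (ho : 0 < B.det x y * B.det x' y') :
    ∃ γ : SL(2, ℤ), x' = γ 0 0 * x + γ 0 1 * y ∧ y' = γ 1 0 * x + γ 1 1 * y := by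
  obtain ⟨a, b, hx⟩ := (h.2 x').1 h'.left_mem
  obtain ⟨c, d, hy⟩ := (h.2 y').1 h'.right_mem
  obtain ⟨a', b', hx'⟩ := (h'.2 x).1 h.left_mem
  obtain ⟨c', d', hy'⟩ := (h'.2 y).1 h.right_mem
  have e1 : B.det x' y' = (a * d - b * c) * B.det x y := by rw [hx, hy, det_comb]
  have e2 : B.det x y = (a' * d' - b' * c') * B.det x' y' := by
    conv_lhs => rw [hx', hy']
    rw [det_comb]
  have e3 : ((a' * d' - b' * c') * (a * d - b * c) : ℚ) = 1 := by
    apply mul_right_cancel₀ h.1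
    rw [mul_assoc, ← e1, ← e2, one_mul]
  have e4 : (a' * d' - b' * c') * (a * d - b * c) = 1 := by exact_mod_cast e3
  have e5 : 0 < a * d - b * c := by
    rw [e1] at ho
    have : (0 : ℚ) < a * d - b * c := by
      have h0 : 0 < B.det x y ^ 2 := by have := h.1; positivity
      by_contra hneg
      push Not at hneg
      nlinarith
    exact_mod_cast this
  have e6 : a * d - b * c = 1 := by
    rcases Int.mul_eq_one_iff_eq_one_or_neg_one.1 e4 with h | h <;> omega
  exact ⟨⟨!![a, b; c, d], by rw [Matrix.det_fin_two]; simpa using e6⟩, by simpa using hx,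
    by simpa using hy⟩

lemma IsFormOf.form_unique {ε x y : A} {f g : BinaryCubicForm} (h : B.IsFormOf ε x y f)
    (h' : B.IsFormOf ε x y g) : f = g := by
  obtain ⟨h0, h1, h2, h3⟩ := h
  obtain ⟨h0', h1', h2', h3'⟩ := h'
  apply BinaryCubicForm.ext
  · exact_mod_cast h0.trans h0'.symm
  · exact_mod_cast h1.trans h1'.symm
  · exact_mod_cast h2.trans h2'.symm
  · exact_mod_cast h3.trans h3'.symm

/-- Forms attached to equivalent data lie in the same orbit. -/
theorem Attached.exists_smul {c : ℕ+} {I : InvertibleIdeal (conductorOrder A c)} {δ κ : Aˣ}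
    {x y x' y' : A} {f f' : BinaryCubicForm} (h : B.Attached I δ x y f)
    (h' : B.Attached (principalIdeal _ κ * I) (δ * κ⁻¹ ^ 3) x' y' f') :
    ∃ γ : SL(2, ℤ), f' = γ • f := by
  obtain ⟨hb, ho, hf⟩ := h
  obtain ⟨hb', ho', hf'⟩ := h'
  have hκ := B.nm_ne_zero κ
  have hκ' : B.nm (κ⁻¹ : Aˣ) = (B.nm κ)⁻¹ := by
    apply eq_inv_of_mul_eq_one_left
    rw [← nm_mul, Units.inv_mul, nm_one]
  have h1 : B.nm ((δ * κ⁻¹ ^ 3 : Aˣ) : A) = B.nm δ * (B.nm κ)⁻¹ ^ 3 := by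
    rw [Units.val_mul, nm_mul, pow_succ, pow_two, Units.val_mul, Units.val_mul, nm_mul, nm_mul, hκ']
    ring
  obtain ⟨γ, rfl, rfl⟩ := (hb.principalIdeal_mul κ).exists_smul hb' (by
    rw [det_mul_left]
    rw [h1] at ho'
    have hpos := mul_pos ho ho'
    have h2 : B.nm δ * B.det x y * (B.nm δ * (B.nm κ)⁻¹ ^ 3 * B.det x' y') =
      (B.nm δ * (B.nm κ)⁻¹ ^ 2) ^ 2 * (B.nm κ * B.det x y * B.det x' y') := by
      field_simp
    rw [h2] at hpos
    exact pos_of_mul_pos_right hpos (sq_nonneg _))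
  refine ⟨γ, hf'.form_unique ?_⟩
  have h3 := (hf.mul_unit κ).smul γ
  rwa [mul_assoc, ← Units.val_mul] at h3

/-- Forms in the same orbit are attached to equivalent data. -/
theorem Attached.unique {c c' : ℕ+} {I : InvertibleIdeal (conductorOrder A c)}
    {I' : InvertibleIdeal (conductorOrder A c')} {δ δ' : Aˣ} {x y x' y' : A}
    {f : BinaryCubicForm} {γ : SL(2, ℤ)} (h : B.Attached I δ x y f)
    (h' : B.Attached I' δ' x' y' (γ • f)) :
    ∃ κ : Aˣ, x' = κ * (γ 0 0 * x + γ 0 1 * y) ∧ y' = κ * (γ 1 0 * x + γ 1 1 * y) ∧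
      c = c' ∧ (∀ z, z ∈ (I' : Submodule (conductorOrder A c') A) ↔
        (↑κ⁻¹ : A) * z ∈ (I : Submodule (conductorOrder A c) A)) ∧
      algebraMap ℚ A (c : ℚ)⁻¹ * δ = algebraMap ℚ A (c' : ℚ)⁻¹ * δ' * κ ^ 3 := by
  obtain ⟨hb, ho, hf⟩ := h
  obtain ⟨hb', ho', hf'⟩ := h'
  have hq : ∀ (c : ℕ+) (z : A), B.nm (algebraMap ℚ A (c : ℚ)⁻¹ * z) = ((c : ℚ)⁻¹) ^ 2 * B.nm z :=
    fun c z => by rw [nm_mul]; congr 1; rw [nm, re_algebraMap, im_algebraMap]; ring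
  have hpos : ∀ c : ℕ+, (0 : ℚ) < ((c : ℚ)⁻¹) ^ 2 := fun c => by
    have : (0 : ℚ) < c := by exact_mod_cast c.pos
    positivity
  obtain ⟨κ, hx, hy, hε⟩ := (hf.smul γ).unique hf'
    (by rw [hq, det_smul, mul_assoc]; exact mul_pos (hpos c) ho)
    (by rw [hq, mul_assoc]; exact mul_pos (hpos c') ho')
  have hbγ : B.IsBasis (I : Submodule (conductorOrder A c) A) (γ 0 0 * x + γ 0 1 * y)
      (γ 1 0 * x + γ 1 1 * y) := by
    have hγ := γ.det_coe
    rw [Matrix.det_fin_two] at hγ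
    have hγ' : (γ 0 0 * γ 1 1 - γ 0 1 * γ 1 0 : A) = 1 := by
      exact_mod_cast congrArg (Int.cast (R := A)) hγ
    refine ⟨by rw [det_smul]; exact hb.1, fun z => ?_⟩
    rw [hb.2]
    constructor
    · rintro ⟨m, k, rfl⟩
      refine ⟨m * γ 1 1 - k * γ 1 0, k * γ 0 0 - m * γ 0 1, ?_⟩
      push_cast
      linear_combination (-m * x - k * y : A) * hγ'
    · rintro ⟨m, k, rfl⟩
      refine ⟨m * γ 0 0 + k * γ 1 0, m * γ 0 1 + k * γ 1 1, ?_⟩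
      push_cast
      ring
  have hI : ∀ z, z ∈ (I' : Submodule (conductorOrder A c') A) ↔
      (↑κ⁻¹ : A) * z ∈ (I : Submodule (conductorOrder A c) A) := by
    intro z
    rw [hb'.2, ← mem_principalIdeal_mul, (hbγ.principalIdeal_mul κ).2, hx, hy]
  refine ⟨κ, hx, hy, ?_, hI, hε⟩
  refine B.conductor_unique fun z => ?_
  rw [mem_order_iff_mul_mem I, mem_order_iff_mul_mem I']
  constructor
  · intro H w hw
    rw [hI] at hw ⊢
    rw [mul_left_comm]
    exact H _ hw
  · intro H w hw
    have := H (κ * w) (by rw [hI, Units.inv_mul_cancel_left]; exact hw)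
    rwa [hI, mul_left_comm, Units.inv_mul_cancel_left] at this

/-- The stabilizer of an attached form is the group of cube roots of unity of the order:
multiplication by such a unit maps the basis of `I` to another basis of the same orientation, and
the matrix of this change of basis stabilizes the form. -/
theorem Attached.stabCard_eq {c : ℕ+} {I : InvertibleIdeal (conductorOrder A c)} {δ : Aˣ} {x y : A}
    {f : BinaryCubicForm} (h : B.Attached I δ x y f) :
    f.stabCard = Nat.card {u : (conductorOrder A c)ˣ // u ^ 3 = 1} := by
  have hinj : ∀ z w : A, z * x = w * x → z * y = w * y → z = w := by
    intro z w h1 h2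
    obtain ⟨p, q, hpq⟩ := B.exists_comb h.1.1 1
    linear_combination (z - w) * hpq + algebraMap ℚ A p * h1 + algebraMap ℚ A q * h2
  have key : ∀ u : {u : (conductorOrder A c)ˣ // u ^ 3 = 1},
      ∃ γ : MulAction.stabilizer SL(2, ℤ) f,
        (u.1 : conductorOrder A c) * x = γ.1 0 0 * x + γ.1 0 1 * y ∧
        (u.1 : conductorOrder A c) * y = γ.1 1 0 * x + γ.1 1 1 * y := by
    rintro ⟨u, hu⟩
    set κ : Aˣ := Units.map (conductorOrder A c).subtype.toMonoidHom u with hκ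
    have hκ3 : κ ^ 3 = 1 := by rw [hκ, ← map_pow, hu, map_one]
    have hnm : B.nm κ = 1 := by
      have h1 : B.nm κ ^ 3 = 1 := by
        have : B.nm ((κ ^ 3 : Aˣ) : A) = B.nm κ ^ 3 := by
          rw [pow_succ, pow_two, Units.val_mul, Units.val_mul, nm_mul, nm_mul]; ring
        rw [← this, hκ3, Units.val_one, nm_one]
      rcases (pow_eq_one_iff_of_ne_zero (by norm_num)).1 h1 with h2 | ⟨-, h2⟩
      · exact h2
      · exact absurd h2 (by decide)
    have hκI : principalIdeal (conductorOrder A c) κ * I = I := by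
      have : principalIdeal (conductorOrder A c) κ = principalIdeal _ 1 :=
        ((principalIdeal_eq_iff 1 κ).2 ⟨u, by simp [hκ]⟩).symm
      rw [this, principalIdeal, map_one, one_mul]
    have hb := h.1.principalIdeal_mul κ
    rw [hκI] at hb
    obtain ⟨γ, h1, h2⟩ := h.1.exists_smul hb (by
      rw [det_mul_left, hnm, one_mul]; exact mul_self_pos.2 h.1.1)
    refine ⟨⟨γ, ?_⟩, h1, h2⟩
    have h3 := h.2.2.smul γ
    have h4 := h.2.2.mul_unit κ
    rw [← h1, ← h2] at h3
    rw [inv_pow, hκ3, inv_one, Units.val_one, mul_one] at h4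
    exact h3.form_unique h4
  choose φ hφ hφ' using key
  refine (Nat.card_congr (Equiv.ofBijective φ ⟨fun u v huv => ?_, fun γ => ?_⟩)).symm
  · apply Subtype.ext
    apply Units.ext
    apply Subtype.ext
    apply hinj
    · rw [hφ, hφ, huv]
    · rw [hφ', hφ', huv]
  · have hγ : γ.1 • f = f := γ.2
    obtain ⟨κ, h1, h2, -, h3, h4⟩ := Attached.unique (γ := γ.1⁻¹) (f := f) h (by
      rw [inv_smul_eq_iff.2 hγ.symm]; exact h)
    have hκ3 : κ ^ 3 = 1 := by
      have hc : algebraMap ℚ A (c : ℚ) * algebraMap ℚ A (c : ℚ)⁻¹ = 1 :=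
        algebraMap_mul_inv (by exact_mod_cast c.pos.ne')
      apply Units.ext
      rw [Units.val_pow_eq_pow_val, Units.val_one]
      have h5 : (δ : A) = δ * κ ^ 3 := by
        linear_combination (algebraMap ℚ A (c : ℚ)) * h4 - (δ - δ * κ ^ 3 : A) * hc
      have h6 : (↑δ⁻¹ : A) * δ = 1 := Units.inv_mul δ
      linear_combination (-(↑δ⁻¹ : A)) * h5 - (κ ^ 3 - 1 : A) * h6
    have hmem : (κ : A) ∈ conductorOrder A c ∧ (↑κ⁻¹ : A) ∈ conductorOrder A c := by
      rw [mem_order_iff_mul_mem I, mem_order_iff_mul_mem I]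
      refine ⟨fun z hz => ?_, fun z hz => (h3 z).1 hz⟩
      rw [h3, Units.inv_mul_cancel_left]; exact hz
    have hdet := γ.1.det_coe
    rw [Matrix.det_fin_two] at hdet
    have hdet' : (γ.1 0 0 * γ.1 1 1 - γ.1 0 1 * γ.1 1 0 : A) = 1 := by
      exact_mod_cast congrArg (Int.cast (R := A)) hdet
    have hκx : (κ : A) * x = γ.1 0 0 * x + γ.1 0 1 * y := by
      rw [Matrix.SpecialLinearGroup.SL2_inv_expl] at h1 h2
      simp at h1 h2
      linear_combination (-κ * x : A) * hdet' - γ.1 0 0 * h1 - γ.1 0 1 * h2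
    have hκy : (κ : A) * y = γ.1 1 0 * x + γ.1 1 1 * y := by
      rw [Matrix.SpecialLinearGroup.SL2_inv_expl] at h1 h2
      simp at h1 h2
      linear_combination (-κ * y : A) * hdet' - γ.1 1 0 * h1 - γ.1 1 1 * h2
    let u : (conductorOrder A c)ˣ :=
      ⟨⟨κ, hmem.1⟩, ⟨↑κ⁻¹, hmem.2⟩, Subtype.ext (by simp), Subtype.ext (by simp)⟩
    have hu : u ^ 3 = 1 := by
      apply Units.ext
      apply Subtype.ext
      have := congrArg Units.val hκ3
      simpa [u] using this
    refine ⟨⟨u, hu⟩, ?_⟩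
    have e1 := (hφ ⟨u, hu⟩).symm.trans hκx
    have e2 := (hφ' ⟨u, hu⟩).symm.trans hκy
    have comb : ∀ a b a' b' : ℤ, (a * x + b * y : A) = a' * x + b' * y → a = a' ∧ b = b' := by
      intro a b a' b' hh
      have := B.comb_inj h.1.1 (p := a) (q := b) (p' := a') (q' := b') (by simpa using hh)
      exact ⟨by exact_mod_cast this.1, by exact_mod_cast this.2⟩
    apply Subtype.ext
    ext i j
    fin_cases i <;> fin_cases j
    · exact (comb _ _ _ _ e1).1
    · exact (comb _ _ _ _ e1).2
    · exact (comb _ _ _ _ e2).1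
    · exact (comb _ _ _ _ e2).2

end QuadraticCoords

/-! ### Parametrization of orbits -/

/-- The units of `𝒪_c` modulo cubes. -/
abbrev UnitsModCubes (A : Type*) [CommRing A] (c : ℕ+) : Type _ :=
  (conductorOrder A c)ˣ ⧸ (powMonoidHom 3 : (conductorOrder A c)ˣ →* (conductorOrder A c)ˣ).range

/-- The parameters of the orbits of forms attached to the quadratic algebra `A`: a conductor `c`, an
integral ideal `𝔞` of `𝒪_c`, a class whose cube is the class of `𝔞`, and a unit of `𝒪_c` modulo
cubes. -/
abbrev CubicParam (A : Type*) [CommRing A] : Type _ :=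
  Σ c : ℕ+, Σ a : IntegralIdeal (conductorOrder A c),
    {C : OrderClassGroup (conductorOrder A c) // C ^ 3 = a.cls} × UnitsModCubes A c

section

variable {A : Type*} [CommRing A] {O : Subring A}

/-- A unit of an order, as a unit of the algebra. -/
def orderUnit (u : Oˣ) : Aˣ := Units.map O.subtype.toMonoidHom u

lemma principalIdeal_orderUnit (u : Oˣ) : principalIdeal O (orderUnit u) = 1 := by
  have : principalIdeal O (orderUnit u) = principalIdeal O 1 :=
    ((principalIdeal_eq_iff 1 _).2 ⟨u, by simp [orderUnit]⟩).symm
  rw [this, principalIdeal, map_one]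

lemma exists_orderUnit {δ ε : Aˣ} (h : principalIdeal O δ = principalIdeal O ε) :
    ∃ u : Oˣ, ε = orderUnit u * δ := by
  obtain ⟨u, hu⟩ := (principalIdeal_eq_iff δ ε).1 h
  exact ⟨u, Units.ext hu⟩

lemma orderUnit_mul (u v : Oˣ) : orderUnit (u * v) = orderUnit u * orderUnit v := map_mul _ _ _

lemma orderUnit_inv (u : Oˣ) : orderUnit u⁻¹ = (orderUnit u)⁻¹ := map_inv _ _

lemma orderUnit_pow (u : Oˣ) (m : ℕ) : orderUnit (u ^ m) = orderUnit u ^ m := map_pow _ _ _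

lemma orderUnit_injective : Function.Injective (orderUnit : Oˣ → Aˣ) :=
  Units.map_injective O.subtype_injective

lemma mk_principalIdeal_mul (κ : Aˣ) (I : InvertibleIdeal O) :
    (QuotientGroup.mk (principalIdeal O κ * I) : OrderClassGroup O) = QuotientGroup.mk I :=
  QuotientGroup.eq.2 ⟨κ⁻¹, by
    change principalIdeal O κ⁻¹ = _
    rw [principalIdeal_inv, mul_inv, mul_assoc, inv_mul_cancel, mul_one]⟩

lemma exists_principalIdeal_mul {I J : InvertibleIdeal O}
    (h : (QuotientGroup.mk I : OrderClassGroup O) = QuotientGroup.mk J) :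
    ∃ κ : Aˣ, J = principalIdeal O κ * I := by
  obtain ⟨κ, hκ⟩ := QuotientGroup.eq.1 h
  exact ⟨κ, by rw [principalIdeal, hκ, mul_comm I⁻¹, inv_mul_cancel_right]⟩

end

namespace QuadraticCoords

variable {A : Type*} [CommRing A] [Algebra ℚ A]

/-- The orbits of dual forms whose discriminant has the square class of `A` are parametrized by
`CubicParam A`. -/
theorem exists_parametrization (B : QuadraticCoords A) :
    ∃ Ψ : CubicParam A → BinaryCubicForm,
      (∀ p, (Ψ p).IsDual ∧ (Ψ p).disc = -27 * (B.disc * p.1 ^ 2 * p.2.1.norm ^ 2) ∧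
        (Ψ p).stabCard = Nat.card {u : (conductorOrder A p.1)ˣ // u ^ 3 = 1}) ∧
      (∀ p p' (γ : SL(2, ℤ)), Ψ p' = γ • Ψ p → p = p') ∧
      ∀ (f : BinaryCubicForm) (r : ℚ), f.IsDual → r ≠ 0 →
        (f.disc : ℚ) = -27 * (B.disc * r ^ 2) → ∃ p, ∃ γ : SL(2, ℤ), f = γ • Ψ p := by
  -- A representative `I` of each class `C` and a base point `δ` with `𝔞 = δ I ^ 3`; the other
  -- multipliers with this property are the `δ u` for units `u` of the order.
  have hbase : ∀ (c : ℕ+) (a : IntegralIdeal (conductorOrder A c))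
      (C : {C : OrderClassGroup (conductorOrder A c) // C ^ 3 = a.cls}),
      ∃ (I : InvertibleIdeal (conductorOrder A c)) (δ : Aˣ),
        QuotientGroup.mk I = C.1 ∧ a.1 = principalIdeal _ δ * I ^ 3 := by
    rintro c a ⟨C, hC⟩
    obtain ⟨I, rfl⟩ := QuotientGroup.mk_surjective C
    obtain ⟨δ, hδ⟩ := exists_principalIdeal_mul (I := I ^ 3) (J := a.1) hC
    exact ⟨I, δ, rfl, hδ⟩
  choose I₀ δ₀ hI₀ ha₀ using hbase
  have hform : ∀ p : CubicParam A, ∃ (x y : A) (f : BinaryCubicForm),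
      B.Attached (I₀ p.1 p.2.1 p.2.2.1) (δ₀ p.1 p.2.1 p.2.2.1 * orderUnit p.2.2.2.out) x y f ∧
        f.IsDual := by
    rintro ⟨c, a, C, u⟩
    apply B.exists_attached
    rw [principalIdeal_mul, principalIdeal_orderUnit, mul_one, ← ha₀]
    exact a.2
  choose X Y Ψ hΨ hdual using hform
  refine ⟨Ψ, fun p => ⟨hdual p, ?_, (hΨ p).stabCard_eq⟩, ?_, ?_⟩
  · apply (hΨ p).disc_eq
    rw [principalIdeal_mul, principalIdeal_orderUnit, mul_one, ← ha₀]
  · -- Equivalent forms have the same lattice and multiplier up to a factor `κ`: `I₀' = κ I₀` and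
    -- `δ₀ u = δ₀' u' κ ^ 3`. This gives equality of `c`, `𝔞` and `C`; then `κ` is a unit of the
    -- order, and `u` and `u'` differ by its cube.
    rintro p p' γ hγ
    have h' := hΨ p'
    rw [hγ] at h'
    obtain ⟨κ, -, -, hc, hI, hδ⟩ := (hΨ p).unique h'
    obtain ⟨c, a, C, u⟩ := p
    obtain ⟨c', a', C', u'⟩ := p'
    obtain rfl : c = c' := hc
    clear hγ h'
    dsimp only at hI hδ
    have hI' : I₀ c a' C' = principalIdeal _ κ * I₀ c a C := by
      apply Units.ext
      ext z
      rw [hI, mem_principalIdeal_mul]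
    have hδ' : δ₀ c a C * orderUnit u.out = δ₀ c a' C' * orderUnit u'.out * κ ^ 3 := by
      have hc : algebraMap ℚ A (c : ℚ) * algebraMap ℚ A (c : ℚ)⁻¹ = 1 :=
        algebraMap_mul_inv (by exact_mod_cast c.pos.ne')
      apply Units.ext
      rw [Units.val_mul _ (κ ^ 3), Units.val_pow_eq_pow_val]
      linear_combination (algebraMap ℚ A (c : ℚ)) * hδ -
        (((δ₀ c a C * orderUnit u.out : Aˣ) : A) -
          ((δ₀ c a' C' * orderUnit u'.out : Aˣ) : A) * κ ^ 3) * hc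
    obtain rfl : a = a' := by
      apply Subtype.ext
      have h1 := ha₀ c a C
      have h2 := ha₀ c a' C'
      have h3 := congrArg (principalIdeal (conductorOrder A c)) hδ'
      simp only [principalIdeal_mul, principalIdeal_orderUnit, mul_one, principalIdeal_pow] at h3
      rw [h1, h2, hI', h3, mul_pow, mul_assoc]
    obtain rfl : C = C' := by
      apply Subtype.ext
      rw [← hI₀ c a C, ← hI₀ c a C', hI', mk_principalIdeal_mul]
    have h1 : principalIdeal (conductorOrder A c) 1 = principalIdeal _ κ := by
      rw [principalIdeal, map_one]
      exact (mul_eq_right.1 hI'.symm).symm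
    obtain ⟨v, hv⟩ := exists_orderUnit h1
    rw [mul_one] at hv
    rw [hv, ← orderUnit_pow, mul_assoc, ← orderUnit_mul] at hδ'
    have h2 := orderUnit_injective (mul_left_cancel hδ')
    have h3 : u = u' := by
      rw [← QuotientGroup.out_eq' u, ← QuotientGroup.out_eq' u', eq_comm, QuotientGroup.eq, h2]
      exact ⟨v, by simp⟩
    rw [h3]
  · -- The lattice and the multiplier of `f` determine `c`, `I`, `𝔞` and `C`. Scaling moves `I` to the
    -- representative of `C`, and `δ` then differs from the base point by a unit of the order.
    intro f r hf hr hD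
    have hf0 : f.disc ≠ 0 := by
      intro h0
      rw [h0] at hD
      have := mul_ne_zero B.disc_ne (pow_ne_zero 2 hr)
      apply this
      push_cast at hD
      linarith
    obtain ⟨γ₁, hγ₁⟩ := f.exists_smul_hessian_ne_zero hf0
    obtain ⟨ε, x, y, ho, hform⟩ := B.exists_isFormOf (hf.smul γ₁) hr
      (by rw [BinaryCubicForm.disc_smul, hD]) hγ₁
    obtain ⟨c, J, J', hJ, hb, -, -⟩ := B.exists_invertibleIdeal (right_ne_zero_of_mul ho.ne')
    have hc0 : (0 : ℚ) < (c : ℕ) := by exact_mod_cast c.pos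
    have hc : algebraMap ℚ A (c : ℚ) * algebraMap ℚ A (c : ℚ)⁻¹ = 1 := algebraMap_mul_inv hc0.ne'
    have hnm : B.nm (algebraMap ℚ A (c : ℚ) * ε) = c ^ 2 * B.nm ε := by
      rw [nm_mul]; congr 1; rw [nm, re_algebraMap, im_algebraMap]; ring
    obtain ⟨δ, hδ⟩ := B.isUnit_of_nm_ne_zero (z := algebraMap ℚ A (c : ℚ) * ε) (by
      rw [hnm]; exact mul_ne_zero (by positivity) (left_ne_zero_of_mul ho.ne'))
    let I : InvertibleIdeal (conductorOrder A c) := ⟨J, J', hJ, by rwa [mul_comm]⟩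
    have hatt : B.Attached I δ x y (γ₁ • f) := by
      refine ⟨hb, ?_, ?_⟩
      · rw [hδ, hnm, mul_assoc]; positivity
      · convert hform using 1
        rw [hδ]; linear_combination ε * hc
    let a : IntegralIdeal (conductorOrder A c) :=
      ⟨principalIdeal _ δ * I ^ 3, hatt.cube_le_one (hf.smul γ₁)⟩
    have ha : a.1 = principalIdeal _ δ * I ^ 3 := rfl
    let C : {C : OrderClassGroup (conductorOrder A c) // C ^ 3 = a.cls} :=
      ⟨QuotientGroup.mk I, by
        rw [IntegralIdeal.cls, ha, mk_principalIdeal_mul, QuotientGroup.mk_pow]⟩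
    obtain ⟨κ, hκ⟩ := exists_principalIdeal_mul (hI₀ c a C).symm
    have h1 : principalIdeal (conductorOrder A c) δ = principalIdeal _ (δ₀ c a C * κ ^ 3) := by
      have h2 := ha₀ c a C
      rw [hκ, ha, mul_pow, ← mul_assoc] at h2
      rw [principalIdeal_mul, principalIdeal_pow]
      exact mul_right_cancel h2
    obtain ⟨u₀, hu₀⟩ := exists_orderUnit h1
    obtain ⟨⟨_, v, rfl⟩, hw⟩ := QuotientGroup.mk_out_eq_mul
      (powMonoidHom 3 : (conductorOrder A c)ˣ →* (conductorOrder A c)ˣ).range u₀⁻¹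
    have h3 := hΨ ⟨c, a, C, QuotientGroup.mk u₀⁻¹⟩
    dsimp only at h3
    have hκ' : I₀ c a C = principalIdeal _ (κ * (orderUnit v)⁻¹) * I := by
      rw [hκ, principalIdeal_mul, ← orderUnit_inv, principalIdeal_orderUnit, mul_one]
    have hδ' : δ₀ c a C * orderUnit (QuotientGroup.mk u₀⁻¹ : (conductorOrder A c)ˣ ⧸
        (powMonoidHom 3 : (conductorOrder A c)ˣ →* (conductorOrder A c)ˣ).range).out =
        δ * (κ * (orderUnit v)⁻¹)⁻¹ ^ 3 := by
      rw [hw]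
      simp only [powMonoidHom_apply, orderUnit_mul, orderUnit_inv, orderUnit_pow]
      rw [eq_mul_inv_of_mul_eq hu₀]
      simp only [mul_inv, inv_inv, mul_pow, inv_pow]
      rw [show orderUnit u₀ * δ * (κ ^ 3)⁻¹ * ((orderUnit u₀)⁻¹ * orderUnit v ^ 3) =
        orderUnit u₀ * (orderUnit u₀)⁻¹ * (δ * ((κ ^ 3)⁻¹ * orderUnit v ^ 3)) by ac_rfl,
        mul_inv_cancel, one_mul]
    rw [hκ', hδ'] at h3
    obtain ⟨γ, hγ⟩ := hatt.exists_smul h3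
    refine ⟨⟨c, a, C, QuotientGroup.mk u₀⁻¹⟩, (γ * γ₁)⁻¹, ?_⟩
    rw [hγ, smul_smul γ, inv_smul_smul]

end QuadraticCoords

/-! ### Sums over integral lattices -/

/-- The weight `max(1, |n|) ^ (-τ)`. -/
noncomputable def intWeight (τ : ℝ) (n : ℤ) : ℝ := (max 1 |(n : ℝ)|) ^ (-τ)

lemma intWeight_nonneg (τ : ℝ) (n : ℤ) : 0 ≤ intWeight τ n := by
  unfold intWeight; positivity

lemma summable_intWeight {τ : ℝ} (hτ : 1 < τ) : Summable (intWeight τ) := by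
  have h : Summable fun n : ℕ => (n : ℝ) ^ (-τ) := Real.summable_nat_rpow.2 (by linarith)
  have key : Summable fun n : ℕ => intWeight τ n := by
    rw [← summable_nat_add_iff 1] at h ⊢
    refine h.congr fun n => ?_
    rw [intWeight]
    congr 1
    push_cast
    rw [abs_of_nonneg (by positivity), max_eq_right]
    linarith [(Nat.cast_nonneg n : (0 : ℝ) ≤ n)]
  refine Summable.of_nat_of_neg key ?_
  simpa [intWeight] using key

lemma summable_intWeight_three {τ : ℝ} (hτ : 1 < τ) :
    Summable fun v : ℤ × ℤ × ℤ => intWeight τ v.1 * (intWeight τ v.2.1 * intWeight τ v.2.2) := by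
  have h := summable_intWeight hτ
  have hn := intWeight_nonneg τ
  exact h.mul_of_nonneg (h.mul_of_nonneg h hn hn) hn fun v => mul_nonneg (hn _) (hn _)

lemma summable_intWeight_four {τ : ℝ} (hτ : 1 < τ) :
    Summable fun v : ℤ × ℤ × ℤ × ℤ => intWeight τ v.1 *
      (intWeight τ v.2.1 * (intWeight τ v.2.2.1 * intWeight τ v.2.2.2)) := by
  have h := summable_intWeight hτ
  have hn := intWeight_nonneg τ
  exact h.mul_of_nonneg (summable_intWeight_three hτ) hn
    fun v => mul_nonneg (hn _) (mul_nonneg (hn _) (hn _))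

lemma rpow_neg_le_intWeight {τ x : ℝ} (hτ : 0 ≤ τ) {n : ℤ} (h1 : 1 ≤ x) (h : |(n : ℝ)| ≤ x) :
    x ^ (-τ) ≤ intWeight τ n :=
  Real.rpow_le_rpow_of_nonpos (by positivity) (max_le h1 h) (by linarith)

/-! ### Cubic characters of finite abelian groups -/

lemma nonempty_characters_mulEquiv (G : Type*) [CommGroup G] [Finite G] :
    Nonempty ((G →* ℂˣ) ≃* G) := by
  have : NeZero (Monoid.exponent G) := ⟨Monoid.exponent_ne_zero_of_finite⟩
  exact CommGroup.monoidHom_mulEquiv_of_hasEnoughRootsOfUnity G ℂ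

lemma finite_characters (G : Type*) [CommGroup G] [Finite G] : Finite (G →* ℂˣ) :=
  have ⟨e⟩ := nonempty_characters_mulEquiv G
  Finite.of_equiv _ e.symm.toEquiv

/-- Orthogonality: the sum of the cubic characters at `g` counts the cube roots of `g`. -/
lemma tsum_cubic_characters {G : Type*} [CommGroup G] [Finite G] (g : G) :
    ∑' χ : {χ : G →* ℂˣ // χ ^ 3 = 1}, ((χ.1 g : ℂˣ) : ℂ) = Nat.card {C : G // C ^ 3 = g} := by
  obtain ⟨e⟩ := nonempty_characters_mulEquiv G
  have := finite_characters G
  have hcard : Nat.card {χ : G →* ℂˣ // χ ^ 3 = 1} = Nat.card {C : G // C ^ 3 = 1} :=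
    Nat.card_congr (e.toEquiv.subtypeEquiv fun χ => by
      change χ ^ 3 = 1 ↔ e χ ^ 3 = 1
      rw [← map_pow, EmbeddingLike.map_eq_one_iff])
  have := Fintype.ofFinite {χ : G →* ℂˣ // χ ^ 3 = 1}
  rw [tsum_fintype]
  by_cases hg : ∃ h : G, h ^ 3 = g
  · obtain ⟨h, rfl⟩ := hg
    have h1 : ∀ χ : {χ : G →* ℂˣ // χ ^ 3 = 1}, ((χ.1 (h ^ 3) : ℂˣ) : ℂ) = 1 := by
      rintro ⟨χ, hχ⟩
      rw [map_pow, ← MonoidHom.pow_apply, hχ]; simp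
    rw [Finset.sum_congr rfl fun χ _ => h1 χ, Finset.sum_const, Finset.card_univ,
      ← Nat.card_eq_fintype_card, hcard, nsmul_one]
    congr 1
    exact Nat.card_congr ((Equiv.mulRight h).subtypeEquiv fun C => by
      change C ^ 3 = 1 ↔ (C * h) ^ 3 = h ^ 3
      rw [mul_pow, mul_eq_right])
  · have hempty : IsEmpty {C : G // C ^ 3 = g} := ⟨fun C => hg ⟨C.1, C.2⟩⟩
    rw [Nat.card_of_isEmpty, Nat.cast_zero]
    let R := (powMonoidHom 3 : G →* G).range
    have hgR : (QuotientGroup.mk g : G ⧸ R) ≠ 1 := by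
      rw [Ne, QuotientGroup.eq_one_iff]
      rintro ⟨h, hh⟩
      exact hg ⟨h, hh⟩
    have : NeZero (Monoid.exponent (G ⧸ R)) := ⟨Monoid.exponent_ne_zero_of_finite⟩
    obtain ⟨ψ, hψ⟩ := CommGroup.exists_apply_ne_one_of_hasEnoughRootsOfUnity (G ⧸ R) ℂ hgR
    set χ₀ : G →* ℂˣ := ψ.comp (QuotientGroup.mk' R) with hχ₀
    have h3 : χ₀ ^ 3 = 1 := by
      ext x
      have : (QuotientGroup.mk' R x) ^ 3 = 1 := by
        rw [← map_pow]
        exact (QuotientGroup.eq_one_iff _).2 ⟨x, rfl⟩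
      rw [MonoidHom.pow_apply, hχ₀, MonoidHom.comp_apply, ← map_pow, this, map_one]; rfl
    -- multiplication by `χ₀` permutes the cubic characters
    let E : {χ : G →* ℂˣ // χ ^ 3 = 1} ≃ {χ : G →* ℂˣ // χ ^ 3 = 1} :=
      (Equiv.mulLeft χ₀).subtypeEquiv fun χ => by
        change χ ^ 3 = 1 ↔ (χ₀ * χ) ^ 3 = 1
        have hmul : (χ₀ * χ) ^ 3 = χ ^ 3 := by
          ext x
          have hx : χ₀ x ^ 3 = 1 := by rw [← MonoidHom.pow_apply, h3]; rfl
          rw [MonoidHom.pow_apply, MonoidHom.mul_apply, mul_pow, hx, one_mul, MonoidHom.pow_apply]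
        rw [hmul]
    have hS := Equiv.sum_comp E fun χ : {χ : G →* ℂˣ // χ ^ 3 = 1} => ((χ.1 g : ℂˣ) : ℂ)
    have hE : ∀ χ, (((E χ).1 g : ℂˣ) : ℂ) = ((χ₀ g : ℂˣ) : ℂ) * ((χ.1 g : ℂˣ) : ℂ) := fun χ => by
      change (((χ₀ * χ.1) g : ℂˣ) : ℂ) = _
      rw [MonoidHom.mul_apply, Units.val_mul]
    simp only [hE, ← Finset.mul_sum] at hS
    have hne : ((χ₀ g : ℂˣ) : ℂ) - 1 ≠ 0 := by
      rw [sub_ne_zero]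
      exact fun h => hψ (Units.ext h)
    refine (mul_eq_zero.1 ?_).resolve_left hne
    rw [sub_mul, one_mul, sub_eq_zero]
    exact hS

namespace QuadraticCoords

variable {A : Type*} [CommRing A] [Algebra ℚ A]

/-! ### Finiteness of the class group -/

lemma mul_mem_order {c : ℕ+} (B : QuadraticCoords A) {I : InvertibleIdeal (conductorOrder A c)}
    {N : ℚ} (hN : B.HasNorm I N) {x y : A} (hx : x ∈ (I : Submodule (conductorOrder A c) A))
    (hy : y ∈ (I : Submodule (conductorOrder A c) A)) :
    algebraMap ℚ A N⁻¹ * B.conj x * y ∈ conductorOrder A c := by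
  rw [← mem_one_iff_mem_order, ← I.inv_mul]
  exact Submodule.mul_mem_mul (hN.inv_mem hx) hy

/-- The norms and pairings on `I` are integral multiples of the norm of `I`. -/
lemma exists_int_nm (B : QuadraticCoords A) {c : ℕ+} {I : InvertibleIdeal (conductorOrder A c)}
    {N : ℚ} (hN : B.HasNorm I N) {x y : A} (hx : x ∈ (I : Submodule (conductorOrder A c) A))
    (hy : y ∈ (I : Submodule (conductorOrder A c) A)) :
    (∃ a : ℤ, B.nm x = N * a) ∧ ∃ b : ℤ, B.pair x y = N * b := by
  have hN0 := hN.1.ne'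
  constructor
  · obtain ⟨⟨a, ha⟩, -⟩ := (B.mem_conductorOrder c _).1 (B.mul_mem_order hN hx hx)
    refine ⟨a, ?_⟩
    rw [mul_assoc, mul_comm (B.conj x), mul_conj, ← map_mul, re_algebraMap] at ha
    rw [← ha]; field_simp
  · obtain ⟨⟨a, ha⟩, b, hb⟩ := (B.mem_conductorOrder c _).1 (B.mul_mem_order hN hx hy)
    refine ⟨2 * a + B.t * (c * b), ?_⟩
    have h1 : B.pair x y = N * (2 * B.re (algebraMap ℚ A N⁻¹ * B.conj x * y) +
        B.t * B.im (algebraMap ℚ A N⁻¹ * B.conj x * y)) := by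
      simp [pair]; field_simp; ring
    rw [h1, ha, hb]; push_cast; ring

lemma pair_add_mul (B : QuadraticCoords A) (x y : A) (k : ℤ) :
    B.pair x (y + k * x) = B.pair x y + 2 * k * B.nm x := by
  simp [pair, nm]; ring

lemma nm_add_mul (B : QuadraticCoords A) (x y : A) (k : ℤ) :
    B.nm (x + k * y) = B.nm x + k * B.pair x y + k ^ 2 * B.nm y := by
  simp [pair, nm]; ring

lemma IsBasis.swap {B : QuadraticCoords A} {O : Subring A} {I : Submodule O A} {x y : A}
    (h : B.IsBasis I x y) : B.IsBasis I y x := by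
  have hd : B.det y x = - B.det x y := by simp only [det]; ring
  refine ⟨by rw [hd]; exact neg_ne_zero.2 h.1, fun z => ?_⟩
  rw [h.2, exists_comm]
  simp only [add_comm]

lemma IsBasis.add_mul {B : QuadraticCoords A} {O : Subring A} {I : Submodule O A} {x y : A}
    (h : B.IsBasis I x y) (k : ℤ) : B.IsBasis I (x + k * y) y := by
  have hd : B.det (x + k * y) y = B.det x y := by simp [det]; ring
  refine ⟨by rw [hd]; exact h.1, fun z => ?_⟩
  rw [h.2]
  constructor
  · rintro ⟨m, l, rfl⟩
    exact ⟨m, l - m * k, by push_cast; ring⟩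
  · rintro ⟨m, l, rfl⟩
    exact ⟨m, l + m * k, by push_cast; ring⟩

/-- An invertible ideal contains an element of small nonzero norm: reduction of the norm form. -/
lemma exists_small_norm (B : QuadraticCoords A) {c : ℕ+} {I : InvertibleIdeal (conductorOrder A c)}
    {N : ℚ} (hN : B.HasNorm I N) :
    ∃ x ∈ (I : Submodule (conductorOrder A c) A), ∃ a : ℤ, a ≠ 0 ∧ B.nm x = N * a ∧
      a.natAbs ≤ B.disc.natAbs * c ^ 2 := by
  have hN0 := hN.1.ne'
  have hex : ∃ (m : ℕ) (x y : A) (a : ℤ), B.IsBasis (I : Submodule (conductorOrder A c) A) x y ∧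
      a ≠ 0 ∧ B.nm x = N * a ∧ a.natAbs = m := by
    by_contra! hno
    have hzero : ∀ x y : A, B.IsBasis (I : Submodule (conductorOrder A c) A) x y → B.nm x = 0 := by
      intro x y h
      obtain ⟨⟨a, ha⟩, -⟩ := B.exists_int_nm hN h.left_mem h.left_mem
      by_contra hx
      exact hno a.natAbs x y a h (by rintro rfl; simp at ha; exact hx ha) ha rfl
    obtain ⟨x, y, h⟩ := B.exists_isBasis I
    have h1 := hzero _ _ h
    have h2 := hzero _ _ h.swap
    have h3 := hzero _ _ (h.add_mul 1)
    rw [nm_add_mul, h1, h2] at h3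
    have h4 := B.pair_sq x y
    have h5 : B.pair x y = 0 := by simpa using h3
    rw [h5, h1] at h4
    exact mul_ne_zero B.disc_ne (pow_ne_zero 2 h.1) (by linarith)
  classical
  obtain ⟨x, y₀, a, hb₀, ha0, ha, hm⟩ := Nat.find_spec hex
  have hmin : ∀ (x' y' : A) (a' : ℤ), B.IsBasis (I : Submodule (conductorOrder A c) A) x' y' →
      a' ≠ 0 → B.nm x' = N * a' → a.natAbs ≤ a'.natAbs := by
    intro x' y' a' h1 h2 h3
    rw [hm]
    exact Nat.find_min' hex ⟨x', y', a', h1, h2, h3, rfl⟩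
  -- translate so that the middle coefficient is at most the leading one
  obtain ⟨-, b₀, hb₀'⟩ := B.exists_int_nm hN hb₀.left_mem hb₀.right_mem
  obtain ⟨k, hk⟩ : ∃ k : ℤ, |b₀ + 2 * k * a| ≤ |a| := by
    refine ⟨-(round ((b₀ : ℚ) / (2 * a))), ?_⟩
    have h1 := abs_sub_round ((b₀ : ℚ) / (2 * a))
    have ha' : (a : ℚ) ≠ 0 := by exact_mod_cast ha0
    have h2 : ((b₀ : ℚ) + 2 * (-(round ((b₀ : ℚ) / (2 * a))) : ℤ) * a) =
      2 * a * ((b₀ : ℚ) / (2 * a) - round ((b₀ : ℚ) / (2 * a))) := by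
      push_cast; field_simp; ring
    have h3 : |(b₀ : ℚ) + 2 * (-(round ((b₀ : ℚ) / (2 * a))) : ℤ) * a| ≤ |(a : ℚ)| := by
      rw [h2, abs_mul, abs_mul, abs_two]
      nlinarith [abs_nonneg (a : ℚ)]
    exact_mod_cast h3
  set y := y₀ + k * x with hy
  have hb : B.IsBasis (I : Submodule (conductorOrder A c) A) x y := (hb₀.swap.add_mul k).swap
  set b := b₀ + 2 * k * a with hbdef
  have hpair : B.pair x y = N * b := by
    rw [hy, pair_add_mul, hb₀', ha, hbdef]; push_cast; ring
  obtain ⟨⟨e, he⟩, -⟩ := B.exists_int_nm hN hb.right_mem hb.right_mem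
  have hdisc : b ^ 2 - 4 * a * e = B.disc * c ^ 2 := by
    have h1 := B.pair_sq x y
    have h2 : N = |B.det x y| / c := hN.unique hb.hasNorm
    have hc : ((c : ℕ) : ℚ) ≠ 0 := by exact_mod_cast c.pos.ne'
    have h3 : B.det x y ^ 2 = N ^ 2 * c ^ 2 := by
      rw [h2, div_pow, sq_abs]; field_simp
    rw [hpair, ha, he, h3] at h1
    have h4 : ((b ^ 2 - 4 * a * e : ℤ) : ℚ) = (B.disc * c ^ 2 : ℤ) := by
      push_cast
      apply mul_left_cancel₀ (pow_ne_zero 2 hN0)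
      linear_combination h1
    exact_mod_cast h4
  have hsq : a ^ 2 ≤ |(B.disc : ℤ) * c ^ 2| := by
    by_cases he0 : e = 0
    · have hb0 : b ≠ 0 := by
        rintro h0
        rw [h0, he0] at hdisc
        have : (B.disc : ℤ) * c ^ 2 ≠ 0 := mul_ne_zero B.disc_ne_zero (by positivity)
        apply this; linarith
      -- the values `a + b` and `a - b` are represented, and one of them is smaller than `a`
      have hpm : ∀ s : ℤ, s ^ 2 = 1 → a + s * b ≠ 0 → |a| ≤ |a + s * b| := by
        intro s hs h0
        have h1 := hmin _ _ (a + s * b) (hb.add_mul s) h0 (by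
          rw [nm_add_mul, ha, hpair, he, he0]; push_cast; ring)
        rw [Int.abs_eq_natAbs, Int.abs_eq_natAbs]
        exact_mod_cast h1
      have h1 := hpm 1 (by norm_num)
      have h2 := hpm (-1) (by norm_num)
      have h3 : a ^ 2 = b ^ 2 := by
        rw [sq_eq_sq_iff_abs_eq_abs]
        by_contra hne
        have h4 : |b| < |a| := lt_of_le_of_ne hk (Ne.symm hne)
        have h5 := h1 (by
          intro h0
          exact hne (by rw [show a = -b by linarith, abs_neg]))
        have h6 := h2 (by
          intro h0
          exact hne (by rw [show a = b by linarith]))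
        have hb0' := abs_pos.2 hb0
        rcases abs_cases a with ⟨q1, _⟩ | ⟨q1, _⟩ <;> rcases abs_cases b with ⟨q2, _⟩ | ⟨q2, _⟩ <;>
          rcases abs_cases (a + 1 * b) with ⟨q3, _⟩ | ⟨q3, _⟩ <;>
          rcases abs_cases (a + -1 * b) with ⟨q4, _⟩ | ⟨q4, _⟩ <;> omega
      rw [h3, ← hdisc, he0]
      simp
    · have h1 := hmin _ _ e hb.swap he0 he
      have h2 : |a| ≤ |e| := by
        rw [Int.abs_eq_natAbs, Int.abs_eq_natAbs]; exact_mod_cast h1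
      have h3 : 4 * |a| * |e| ≤ |(B.disc : ℤ) * c ^ 2| + b ^ 2 := by
        rw [← hdisc]
        have : 4 * |a| * |e| = |b ^ 2 - (b ^ 2 - 4 * a * e)| := by
          rw [sub_sub_cancel, abs_mul, abs_mul]; rfl
        rw [this]
        have h := abs_sub (b ^ 2) (b ^ 2 - 4 * a * e)
        rw [abs_of_nonneg (sq_nonneg b)] at h
        linarith
      have h4 : b ^ 2 ≤ |a| * |a| := by
        rw [← sq_abs b, pow_two]; exact mul_self_le_mul_self (abs_nonneg _) hk
      have h5 : |a| * |a| ≤ |a| * |e| := mul_le_mul_of_nonneg_left h2 (abs_nonneg _)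
      have h6 : a ^ 2 = |a| * |a| := by rw [← sq_abs, pow_two]
      have := mul_nonneg (abs_nonneg a) (abs_nonneg e)
      rw [h6]; linarith
  refine ⟨x, hb.left_mem, a, ha0, ha, ?_⟩
  have h1 : a.natAbs ^ 2 ≤ B.disc.natAbs * c ^ 2 := by
    have h2 : (a.natAbs : ℤ) ^ 2 ≤ B.disc.natAbs * c ^ 2 := by
      rw [Int.natAbs_sq]
      refine hsq.trans (le_of_eq ?_)
      rw [abs_mul, Int.abs_eq_natAbs, abs_of_nonneg (by positivity)]
    exact_mod_cast h2
  exact (Nat.le_self_pow two_ne_zero _).trans h1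

/-- Every ideal class contains an ideal with `𝒪_c ⊆ I ⊆ e⁻¹ 𝒪_c`, with `e` independent of the
class. -/
lemma exists_bounded_representative (B : QuadraticCoords A) {c : ℕ+}
    (C : OrderClassGroup (conductorOrder A c)) :
    ∃ J : InvertibleIdeal (conductorOrder A c), QuotientGroup.mk J = C ∧
      (1 : A) ∈ (J : Submodule (conductorOrder A c) A) ∧
      ∀ z ∈ (J : Submodule (conductorOrder A c) A),
        (((B.disc.natAbs * c ^ 2).factorial : ℕ) : A) * z ∈ conductorOrder A c := by
  obtain ⟨I, rfl⟩ := QuotientGroup.mk_surjective C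
  obtain ⟨u, v, hI⟩ := B.exists_isBasis I
  have hN := hI.hasNorm
  set N := |B.det u v| / c
  obtain ⟨x, hx, a, ha0, ha, hle⟩ := B.exists_small_norm hN
  have ha0' : (a : ℚ) ≠ 0 := by exact_mod_cast ha0
  obtain ⟨κ, rfl⟩ := B.isUnit_of_nm_ne_zero (z := x) (by
    rw [ha]; exact mul_ne_zero hN.1.ne' ha0')
  refine ⟨principalIdeal _ κ⁻¹ * I, mk_principalIdeal_mul _ _, ?_, fun z hz => ?_⟩
  · rw [mem_principalIdeal_mul, inv_inv, mul_one]; exact hx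
  · rw [mem_principalIdeal_mul, inv_inv] at hz
    have h1 := B.mul_mem_order hN hx hz
    obtain ⟨k, hk⟩ : a ∣ ((B.disc.natAbs * c ^ 2).factorial : ℕ) := by
      rw [← Int.natAbs_dvd]
      exact_mod_cast Nat.dvd_factorial (Int.natAbs_pos.2 ha0) hle
    have h2 : (((B.disc.natAbs * c ^ 2).factorial : ℕ) : A) = a * k := by
      exact_mod_cast congrArg (Int.cast (R := A)) hk
    have h3 : algebraMap ℚ A N⁻¹ * B.conj κ * (κ * z) = a * z := by
      have h4 : algebraMap ℚ A N⁻¹ * algebraMap ℚ A N = 1 := by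
        rw [mul_comm]; exact algebraMap_mul_inv hN.1.ne'
      have h5 := B.mul_conj (κ : A)
      rw [ha, map_mul, map_intCast] at h5
      linear_combination (algebraMap ℚ A N⁻¹ * z) * h5 + a * z * h4
    rw [h3] at h1
    rw [h2, mul_comm (a : A), mul_assoc]
    exact mul_mem (intCast_mem _ k) h1

lemma IsBasis.eq_of_eq {B : QuadraticCoords A} {O : Subring A} {I J : InvertibleIdeal O} {x y : A}
    (hI : B.IsBasis (I : Submodule O A) x y) (hJ : B.IsBasis (J : Submodule O A) x y) : I = J :=
  Units.ext (SetLike.ext fun z => by rw [hI.2, hJ.2])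

theorem finite_orderClassGroup (B : QuadraticCoords A) (c : ℕ+) :
    Finite (OrderClassGroup (conductorOrder A c)) := by
  set e := (B.disc.natAbs * c ^ 2).factorial with he
  have he0 : 0 < e := Nat.factorial_pos _
  have heQ : (e : ℚ) ≠ 0 := by exact_mod_cast he0.ne'
  have hcQ : ((c : ℕ) : ℚ) ≠ 0 := by exact_mod_cast c.pos.ne'
  have key : ∀ C : OrderClassGroup (conductorOrder A c),
      ∃ (v : Finset.Icc (0 : ℤ) e × Finset.Icc (0 : ℤ) e × Finset.Icc (0 : ℤ) e)
        (J : InvertibleIdeal (conductorOrder A c)), QuotientGroup.mk J = C ∧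
        B.IsBasis (J : Submodule (conductorOrder A c) A) (B.elt ((v.1.1 : ℚ) / e) 0)
          (B.elt ((v.2.1.1 : ℚ) / e) ((v.2.2.1 : ℚ) * c / e)) := by
    intro C
    obtain ⟨J, hJ, h1, h2⟩ := B.exists_bounded_representative C
    obtain ⟨p, q, r, hp, hr, hq, hqp, hb⟩ := B.exists_hermite_basis J he0 h2
    have hO : ∀ z ∈ conductorOrder A c, z ∈ (J : Submodule (conductorOrder A c) A) := fun z hz => by
      simpa using (mem_order_iff_mul_mem J z).1 hz 1 h1
    have hr' : r ≤ e := by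
      have hw := hO (B.elt 0 c) ((B.mem_conductorOrder c _).2 ⟨⟨0, by simp⟩, 1, by simp⟩)
      obtain ⟨m, k, hmk⟩ := (hb.2 _).1 hw
      have h3 := congrArg B.im hmk
      simp at h3
      field_simp at h3
      have h4 : (e : ℤ) = k * r := by
        have : (e : ℚ) = k * r := by linarith
        exact_mod_cast this
      exact Int.le_of_dvd (by exact_mod_cast he0) ⟨k, by rw [h4, mul_comm]⟩
    have hp' : p ≤ e := by
      obtain ⟨m, k, hmk⟩ := (hb.2 _).1 h1
      have h3 := congrArg B.im hmk
      have h4 := congrArg B.re hmk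
      simp at h3 h4
      have hk : k = 0 := by
        rcases h3 with h | h
        · exact h
        · rcases h with h | h
          · exact absurd h hr.ne'
          · exact absurd h he0.ne'
      rw [hk] at h4
      simp at h4
      field_simp at h4
      have h5 : (e : ℤ) = m * p := by exact_mod_cast h4
      exact Int.le_of_dvd (by exact_mod_cast he0) ⟨m, by rw [h5, mul_comm]⟩
    exact ⟨⟨⟨p, Finset.mem_Icc.2 ⟨hp.le, hp'⟩⟩, ⟨q, Finset.mem_Icc.2 ⟨hq, by omega⟩⟩,
      ⟨r, Finset.mem_Icc.2 ⟨hr.le, hr'⟩⟩⟩, J, hJ, hb⟩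
  choose v J hJ hb using key
  refine Finite.of_injective v fun C C' h => ?_
  have h1 := hb C
  rw [h] at h1
  rw [← hJ C, ← hJ C', h1.eq_of_eq (hb C')]

/-! ### The `L`-series of an order -/

lemma norm_pos (B : QuadraticCoords A) {c : ℕ+} (a : IntegralIdeal (conductorOrder A c)) :
    0 < a.norm := by
  exact_mod_cast (B.hasNorm_norm a).1

/-- An ideal of norm `p r` has a basis `p, q + r c w` with `0 ≤ q < p`, so the series over the
integral ideals is dominated by a series over triples of integers. -/
theorem summable_norm_rpow (B : QuadraticCoords A) (c : ℕ+) {σ : ℝ} (hσ : 2 < σ) :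
    Summable fun a : IntegralIdeal (conductorOrder A c) => (a.norm : ℝ) ^ (-σ) := by
  have key : ∀ a : IntegralIdeal (conductorOrder A c), ∃ v : ℤ × ℤ × ℤ,
      0 < v.1 ∧ 0 < v.2.2 ∧ 0 ≤ v.2.1 ∧ v.2.1 < v.1 ∧ (a.norm : ℤ) = v.1 * v.2.2 ∧
      B.IsBasis (a.1 : Submodule (conductorOrder A c) A) (B.elt v.1 0) (B.elt v.2.1 (v.2.2 * c)) := by
    intro a
    obtain ⟨p, q, r, hp, hr, hq, hqp, hb⟩ := B.exists_hermite_basis a.1 one_pos (fun z hz => by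
      rw [Nat.cast_one, one_mul, ← mem_one_iff_mem_order]; exact a.2 hz)
    simp only [Nat.cast_one, div_one] at hb
    refine ⟨(p, q, r), hp, hr, hq, hqp, ?_, hb⟩
    have h1 := hb.norm_eq
    have hcQ : (0 : ℚ) < (c : ℕ) := by exact_mod_cast c.pos
    have hpQ : (0 : ℚ) < p := by exact_mod_cast hp
    have hrQ : (0 : ℚ) < r := by exact_mod_cast hr
    have hd : B.det (B.elt p 0) (B.elt q (r * c)) = p * (r * c) := by simp [det]
    rw [hd, abs_of_pos (by positivity)] at h1
    have h2 : (a.norm : ℚ) = p * r := by rw [h1]; field_simp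
    exact_mod_cast h2
  choose v hp hr hq hqp hnorm hb using key
  have hinj : Function.Injective v := fun a a' h => by
    have h1 := hb a
    rw [h] at h1
    exact Subtype.ext (h1.eq_of_eq (hb a'))
  set τ := σ / 2 with hτ
  have hτ1 : 1 < τ := by rw [hτ]; linarith
  refine Summable.of_nonneg_of_le (fun a => by positivity) (fun a => ?_)
    ((summable_intWeight_three hτ1).comp_injective hinj)
  have h1 : (a.norm : ℝ) = (v a).1 * (v a).2.2 := by exact_mod_cast hnorm a
  have p1 : (1 : ℝ) ≤ (v a).1 := by exact_mod_cast hp a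
  have r1 : (1 : ℝ) ≤ (v a).2.2 := by exact_mod_cast hr a
  have q1 : (0 : ℝ) ≤ (v a).2.1 := by exact_mod_cast hq a
  have qp1 : ((v a).2.1 : ℝ) ≤ (v a).1 := by exact_mod_cast (hqp a).le
  have hτ0 : 0 ≤ τ := by linarith
  rw [h1, Real.mul_rpow (by linarith) (by linarith)]
  have e1 : ((v a).1 : ℝ) ^ (-σ) = ((v a).1 : ℝ) ^ (-τ) * ((v a).1 : ℝ) ^ (-τ) := by
    rw [← Real.rpow_add (by linarith)]; congr 1; rw [hτ]; ring
  have e2 : ((v a).2.2 : ℝ) ^ (-σ) ≤ ((v a).2.2 : ℝ) ^ (-τ) :=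
    Real.rpow_le_rpow_of_exponent_le r1 (by rw [hτ]; linarith)
  have f1 := rpow_neg_le_intWeight (n := (v a).1) hτ0 p1 (by rw [abs_of_pos (by linarith)])
  have f2 := rpow_neg_le_intWeight (n := (v a).2.1) hτ0 p1 (by rwa [abs_of_nonneg q1])
  have f3 := rpow_neg_le_intWeight (n := (v a).2.2) hτ0 r1 (by rw [abs_of_pos (by linarith)])
  rw [e1, mul_assoc]
  change _ ≤ intWeight τ (v a).1 * (intWeight τ (v a).2.1 * intWeight τ (v a).2.2)
  have g1 : (0 : ℝ) ≤ ((v a).1 : ℝ) ^ (-τ) := by positivity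
  have g2 : (0 : ℝ) ≤ ((v a).2.2 : ℝ) ^ (-σ) := by positivity
  exact mul_le_mul f1 (mul_le_mul f2 (e2.trans f3) g2 (intWeight_nonneg _ _))
    (mul_nonneg g1 g2) (intWeight_nonneg _ _)

lemma norm_cpow (B : QuadraticCoords A) {c : ℕ+} (a : IntegralIdeal (conductorOrder A c)) (w : ℂ) :
    ‖(a.norm : ℂ) ^ (-w)‖ = (a.norm : ℝ) ^ (-w.re) := by
  rw [Complex.norm_natCast_cpow_of_pos (B.norm_pos a), Complex.neg_re]

theorem summable_orderLTerm (B : QuadraticCoords A) {c : ℕ+} {w : ℂ} (hw : 2 < w.re)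
    (χ : CubicCharacter (conductorOrder A c)) : Summable (orderLTerm χ.1 w) := by
  refine Summable.of_norm_bounded (B.summable_norm_rpow c hw) fun a => le_of_eq ?_
  have h1 : ‖((χ.1 a.cls : ℂˣ) : ℂ)‖ = 1 := by
    refine Complex.norm_eq_one_of_pow_eq_one (n := 3) ?_ (by norm_num)
    rw [← Units.val_pow_eq_pow_val, ← MonoidHom.pow_apply, χ.2]; simp
  rw [orderLTerm, norm_mul, h1, one_mul, B.norm_cpow]

theorem cubicLSumConverges (B : QuadraticCoords A) (c : ℕ+) {w : ℂ} (hw : 2 < w.re) :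
    CubicLSumConverges A c w :=
  ⟨B.finite_orderClassGroup c, fun χ => B.summable_orderLTerm hw χ⟩

theorem cubicLSum_eq (B : QuadraticCoords A) (c : ℕ+) {w : ℂ} (hw : 2 < w.re) :
    cubicLSum A c w = ∑' a : IntegralIdeal (conductorOrder A c),
      (Nat.card {C : OrderClassGroup (conductorOrder A c) // C ^ 3 = a.cls} : ℂ) *
        (a.norm : ℂ) ^ (-w) := by
  have := B.finite_orderClassGroup c
  have : Finite (OrderClassGroup (conductorOrder A c) →* ℂˣ) :=
    finite_characters (OrderClassGroup (conductorOrder A c))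
  have := Fintype.ofFinite (CubicCharacter (conductorOrder A c))
  rw [cubicLSum, tsum_fintype]
  simp only [orderLSeries]
  rw [← Summable.tsum_finsetSum fun χ _ => B.summable_orderLTerm hw χ]
  refine tsum_congr fun a => ?_
  have h := tsum_cubic_characters a.cls
  rw [tsum_fintype] at h
  refine Eq.trans ?_ (congrArg (· * (a.norm : ℂ) ^ (-w)) h)
  exact (Finset.sum_mul _ _ _).symm

end QuadraticCoords

/-! ### Units of quadratic orders modulo cubes -/

lemma card_quotient_cubes_of_finite (G : Type*) [CommGroup G] [Finite G] :
    Nat.card (G ⧸ (powMonoidHom 3 : G →* G).range) = Nat.card {u : G // u ^ 3 = 1} := by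
  have h1 : Nat.card {u : G // u ^ 3 = 1} = Nat.card (powMonoidHom 3 : G →* G).ker :=
    Nat.card_congr (Equiv.subtypeEquivRight fun u => by rw [MonoidHom.mem_ker]; rfl)
  have h2 := (powMonoidHom 3 : G →* G).range.card_eq_card_quotient_mul_card_subgroup
  have h3 := (powMonoidHom 3 : G →* G).ker.card_eq_card_quotient_mul_card_subgroup
  have h4 := Nat.card_congr (QuotientGroup.quotientKerEquivRange (powMonoidHom 3 : G →* G)).toEquiv
  rw [h4, h2, mul_comm] at h3
  rw [h1]
  exact Nat.eq_of_mul_eq_mul_left Nat.card_pos h3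

lemma card_quotient_cubes_of_sq_eq_one (G : Type*) [CommGroup G] (h : ∀ u : G, u ^ 2 = 1) :
    Nat.card (G ⧸ (powMonoidHom 3 : G →* G).range) = 1 := by
  have : (powMonoidHom 3 : G →* G).range = ⊤ := by
    rw [MonoidHom.range_eq_top]
    intro u
    exact ⟨u, by rw [powMonoidHom_apply, pow_succ, h, one_mul]⟩
  rw [this]
  exact Subgroup.index_top

namespace QuadraticCoords

variable {A : Type*} [CommRing A] [Algebra ℚ A]

/-- The coordinates of a unit of `𝒪_c`, which has norm `1` or `-1`. -/
lemma exists_unit_coords (B : QuadraticCoords A) {c : ℕ+} (u : (conductorOrder A c)ˣ) :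
    ∃ p q : ℤ, B.re (u : conductorOrder A c) = p ∧ B.im (u : conductorOrder A c) = c * q ∧
      (B.nm (u : conductorOrder A c) = 1 ∨ B.nm (u : conductorOrder A c) = -1) := by
  have hint : ∀ z : conductorOrder A c, ∃ m : ℤ, B.nm z = m := by
    intro z
    obtain ⟨⟨p, hp⟩, q, hq⟩ := (B.mem_conductorOrder c _).1 z.2
    exact ⟨p ^ 2 + B.t * p * (c * q) + B.n * (c * q) ^ 2, by rw [nm, hp, hq]; push_cast; ring⟩
  obtain ⟨⟨p, hp⟩, q, hq⟩ := (B.mem_conductorOrder c _).1 (u : conductorOrder A c).2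
  refine ⟨p, q, hp, hq, ?_⟩
  obtain ⟨m, hm⟩ := hint u
  obtain ⟨m', hm'⟩ := hint (↑u⁻¹ : conductorOrder A c)
  have h1 : B.nm (((u * u⁻¹ : (conductorOrder A c)ˣ) : conductorOrder A c) : A) = m * m' := by
    rw [Units.val_mul, Subring.coe_mul, nm_mul, hm, hm']
  rw [mul_inv_cancel, Units.val_one, Subring.coe_one, nm_one] at h1
  have h2 : m * m' = 1 := by exact_mod_cast h1.symm
  rw [hm]
  rcases Int.mul_eq_one_iff_eq_one_or_neg_one.1 h2 with ⟨h, -⟩ | ⟨h, -⟩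
  · left; rw [h]; simp
  · right; rw [h]; simp

lemma unit_ext (B : QuadraticCoords A) {c : ℕ+} {u v : (conductorOrder A c)ˣ}
    (h1 : B.re (u : conductorOrder A c) = B.re (v : conductorOrder A c))
    (h2 : B.im (u : conductorOrder A c) = B.im (v : conductorOrder A c)) : u = v :=
  Units.ext (Subtype.ext (B.ext h1 h2))

lemma four_mul_nm (B : QuadraticCoords A) (z : A) :
    4 * B.nm z = (2 * B.re z + B.t * B.im z) ^ 2 - B.disc * B.im z ^ 2 := by
  simp only [nm, disc]; push_cast; ring

/-- For negative discriminant, `4 nm = (2 re + t im) ^ 2 + |Δ| im ^ 2` bounds the coordinates of a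
unit. -/
theorem finite_units_of_disc_neg (B : QuadraticCoords A) (hB : B.disc < 0) (c : ℕ+) :
    Finite (conductorOrder A c)ˣ := by
  have key : ∀ u : (conductorOrder A c)ˣ,
      ∃ v : Finset.Icc (-2 : ℤ) 2 × Finset.Icc (-2 : ℤ) 2,
        2 * B.re (u : conductorOrder A c) + B.t * B.im (u : conductorOrder A c) = v.1.1 ∧
        B.im (u : conductorOrder A c) = c * v.2.1 := by
    intro u
    obtain ⟨p, q, hp, hq, hn⟩ := B.exists_unit_coords u
    have h1 := B.four_mul_nm (u : conductorOrder A c)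
    rw [hp, hq] at h1 ⊢
    have h2 : (2 * p + B.t * (c * q)) ^ 2 - B.disc * (c * q) ^ 2 ≤ 4 := by
      have : ((2 * p + B.t * (c * q)) ^ 2 - B.disc * (c * q) ^ 2 : ℚ) ≤ 4 := by
        rw [← h1]; rcases hn with h | h <;> rw [h] <;> norm_num
      exact_mod_cast this
    have hc : (1 : ℤ) ≤ (c : ℕ) := by exact_mod_cast c.pos
    have h3 : 0 ≤ -B.disc * (c * q) ^ 2 := mul_nonneg (by omega) (sq_nonneg _)
    have h4 : q ^ 2 ≤ -B.disc * (c * q) ^ 2 := by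
      have : 1 * (1 * q ^ 2) ≤ -B.disc * ((c : ℕ) ^ 2 * q ^ 2) :=
        mul_le_mul (by omega) (mul_le_mul_of_nonneg_right (by nlinarith) (sq_nonneg q))
          (by positivity) (by omega)
      linarith [mul_pow ((c : ℕ) : ℤ) q 2]
    have h5 : |2 * p + B.t * (c * q)| ≤ 2 := abs_le_of_sq_le_sq (by linarith) (by norm_num)
    have h6 : |q| ≤ 2 := abs_le_of_sq_le_sq (by nlinarith [sq_nonneg (2 * p + B.t * (c * q))])
      (by norm_num)
    exact ⟨⟨⟨2 * p + B.t * (c * q), Finset.mem_Icc.2 (abs_le.1 h5)⟩,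
      ⟨q, Finset.mem_Icc.2 (abs_le.1 h6)⟩⟩, by push_cast; ring, rfl⟩
  choose v h1 h2 using key
  refine Finite.of_injective v fun u u' h => ?_
  have e1 := h1 u
  have e2 := h2 u
  rw [h, ← h1] at e1
  rw [h, ← h2] at e2
  refine B.unit_ext ?_ e2
  rw [e2] at e1
  linarith

/-- In an order of `ℚ × ℚ` every unit squares to `1`, since both of its components are `1` or
`-1`. -/
lemma unit_sq_eq_one (B : QuadraticCoords A) (ht : B.t = 1) (hn : B.n = 0) {c : ℕ+}
    (u : (conductorOrder A c)ˣ) : u ^ 2 = 1 := by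
  obtain ⟨p, q, hp, hq, h⟩ := B.exists_unit_coords u
  rw [nm, hp, hq, ht, hn] at h
  have h1 : p * (p + c * q) = 1 ∨ p * (p + c * q) = -1 := by
    rcases h with h | h
    · left; push_cast at h; exact_mod_cast (by linear_combination h : (p * (p + c * q) : ℚ) = 1)
    · right; push_cast at h; exact_mod_cast (by linear_combination h : (p * (p + c * q) : ℚ) = -1)
  have hu : IsUnit p ∧ IsUnit (p + c * q) := by
    rw [← IsUnit.mul_iff]
    rcases h1 with h | h <;> rw [h] <;> decide
  have h2 := Int.isUnit_sq hu.1
  have h3 := Int.isUnit_sq hu.2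
  have h2' : (p : ℚ) ^ 2 = 1 := by exact_mod_cast h2
  have h3' : (p + c * q : ℚ) ^ 2 = 1 := by exact_mod_cast h3
  apply B.unit_ext <;>
    rw [Units.val_pow_eq_pow_val, Subring.coe_pow, pow_two, Units.val_one, Subring.coe_one]
  · rw [re_mul, hp, hq, hn, re_one]
    push_cast
    linear_combination h2'
  · rw [im_mul, hp, hq, ht, im_one]
    push_cast
    linear_combination h3' - h2'

/-- The embedding `w ↦ (t + s) / 2` of a quadratic algebra into `ℝ`, for `s` a square root of the
discriminant. -/
noncomputable def realEmb (B : QuadraticCoords A) (s : ℝ) (hs : s ^ 2 = B.disc) : A →+* ℝ where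
  toFun z := B.re z + B.im z * ((B.t + s) / 2)
  map_one' := by simp
  map_zero' := by simp
  map_add' x y := by simp; ring
  map_mul' x y := by
    have : s ^ 2 = B.t ^ 2 - 4 * B.n := by rw [hs, disc]; push_cast; ring
    simp
    linear_combination (-(B.im x : ℝ) * B.im y / 4) * this

lemma realEmb_apply (B : QuadraticCoords A) (s : ℝ) (hs : s ^ 2 = B.disc) (z : A) :
    B.realEmb s hs z = B.re z + B.im z * ((B.t + s) / 2) := rfl

lemma realEmb_mul_realEmb (B : QuadraticCoords A) (s : ℝ) (hs : s ^ 2 = B.disc) (z : A) :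
    B.realEmb s hs z * B.realEmb (-s) (by rw [neg_sq, hs]) z = B.nm z := by
  have : s ^ 2 = B.t ^ 2 - 4 * B.n := by rw [hs, disc]; push_cast; ring
  rw [realEmb_apply, realEmb_apply, nm]
  push_cast
  linear_combination (-(B.im z : ℝ) ^ 2 / 4) * this

/-- A discriminant is `0` or `1` modulo `4`, and `1` and `4` are squares. -/
lemma five_le_disc (B : QuadraticCoords A) (hpos : 0 < B.disc) (hsq : ¬IsSquare B.disc) :
    5 ≤ B.disc := by
  by_contra! h
  have h1 : B.disc % 4 = 0 ∨ B.disc % 4 = 1 := by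
    rw [disc]
    rcases Int.emod_two_eq_zero_or_one B.t with ht | ht
    · left
      obtain ⟨k, hk⟩ := Int.dvd_of_emod_eq_zero ht
      rw [hk]; ring_nf; omega
    · right
      obtain ⟨k, hk⟩ : ∃ k, B.t = 2 * k + 1 := ⟨B.t / 2, by omega⟩
      rw [hk]; ring_nf; omega
  have h2 : B.disc = 1 ∨ B.disc = 4 := by omega
  rcases h2 with h2 | h2
  · exact hsq ⟨1, by rw [h2]; norm_num⟩
  · exact hsq ⟨2, by rw [h2]; norm_num⟩

/-- A unit of a real quadratic order whose absolute value is close to `1` is `1` or `-1`. -/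
lemma unit_eq_one_or_neg_one (B : QuadraticCoords A) (hpos : 0 < B.disc) (hsq : ¬IsSquare B.disc)
    {s : ℝ} (hs : s ^ 2 = B.disc) (hs0 : 0 ≤ s) {c : ℕ+} (u : (conductorOrder A c)ˣ)
    (h1 : 1 ≤ |B.realEmb s hs (u : conductorOrder A c)|)
    (h2 : |B.realEmb s hs (u : conductorOrder A c)| ≤ 3 / 2) : u = 1 ∨ u = -1 := by
  obtain ⟨p, q, hp, hq, hn⟩ := B.exists_unit_coords u
  have hs5 : (11 / 5 : ℝ) < s := by
    have h5 : (5 : ℝ) ≤ B.disc := by exact_mod_cast B.five_le_disc hpos hsq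
    rw [← hs] at h5
    nlinarith
  set y := B.realEmb s hs (u : conductorOrder A c) with hy
  set y' := B.realEmb (-s) (by rw [neg_sq, hs]) (u : conductorOrder A c) with hy'
  have hprod : |y| * |y'| = 1 := by
    rw [← abs_mul, hy, hy', realEmb_mul_realEmb]
    rcases hn with h | h <;> rw [h] <;> simp
  have hdiff : y - y' = c * q * s := by
    rw [hy, hy', realEmb_apply, realEmb_apply, hq]; push_cast; ring
  have hq0 : q = 0 := by
    by_contra hq0
    have h3 : (1 : ℝ) ≤ |(c * q : ℝ)| := by
      have : (1 : ℤ) ≤ |((c : ℕ) * q : ℤ)| :=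
        Int.one_le_abs (mul_ne_zero (by exact_mod_cast c.pos.ne') hq0)
      exact_mod_cast this
    have h4 : |y - y'| ≤ |y| + |y'| := abs_sub _ _
    rw [hdiff, abs_mul, abs_of_nonneg hs0] at h4
    have h5 : |y| + |y'| ≤ 13 / 6 := by
      have h6 : 0 < |y| := by linarith
      have h7 : |y'| = 1 / |y| := by field_simp; linarith
      rw [h7]
      have : |y| * (|y| + 1 / |y|) ≤ |y| * (13 / 6) := by
        rw [mul_add, mul_one_div_cancel h6.ne']
        nlinarith
      exact le_of_mul_le_mul_left this h6
    nlinarith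
  rw [nm, hp, hq, hq0] at hn
  have hp1 : p = 1 ∨ p = -1 := by
    have : IsUnit p := by
      rcases hn with h | h
      · have h' : p * p = 1 := by
          push_cast at h; exact_mod_cast (by linear_combination h : (p * p : ℚ) = 1)
        exact IsUnit.of_mul_eq_one _ h'
      · push_cast at h
        nlinarith [sq_nonneg (p : ℚ)]
    exact Int.isUnit_iff.1 this
  rcases hp1 with h | h
  · left
    apply B.unit_ext
    · rw [hp, h]; simp
    · rw [hq, hq0]; simp
  · right
    apply B.unit_ext
    · rw [hp, h]; simp
    · rw [hq, hq0]; simp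

/-- Real quadratic orders have a unit that is not a root of unity: Pell's equation. -/
lemma exists_unit_ne (B : QuadraticCoords A) (hpos : 0 < B.disc) (hsq : ¬IsSquare B.disc) (c : ℕ+) :
    ∃ u : (conductorOrder A c)ˣ, u ≠ 1 ∧ u ≠ -1 := by
  have hc : (0 : ℤ) < (c : ℕ) := by exact_mod_cast c.pos
  obtain ⟨x, y, hxy, hy⟩ := Pell.exists_of_not_isSquare (d := B.disc * (c : ℕ) ^ 2)
    (by positivity) (by
      rintro ⟨r, hr⟩
      apply hsq
      have h1 : ((c : ℕ) : ℤ) ^ 2 ∣ r ^ 2 := ⟨B.disc, by rw [pow_two r, ← hr]; ring⟩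
      obtain ⟨k, rfl⟩ := (Int.pow_dvd_pow_iff two_ne_zero).1 h1
      refine ⟨k, ?_⟩
      apply mul_right_cancel₀ (pow_ne_zero 2 hc.ne')
      rw [hr]; ring)
  set z := B.elt (x - B.t * c * y) (2 * c * y) with hz
  have hzO : z ∈ conductorOrder A c :=
    (B.mem_conductorOrder c z).2 ⟨⟨x - B.t * c * y, by simp [hz]⟩, 2 * y, by simp [hz]; ring⟩
  have hnm : B.nm z = 1 := by
    have h2 : (x ^ 2 - B.disc * (c : ℕ) ^ 2 * y ^ 2 : ℚ) = 1 := by exact_mod_cast hxy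
    rw [disc] at h2
    push_cast at h2
    rw [nm, hz, re_elt, im_elt]
    linear_combination h2
  have hmul : z * B.conj z = 1 := by rw [mul_conj, hnm, map_one]
  refine ⟨⟨⟨z, hzO⟩, ⟨B.conj z, conj_mem_conductorOrder hzO⟩, Subtype.ext hmul,
    Subtype.ext ((mul_comm _ _).trans hmul)⟩, ?_, ?_⟩
  all_goals
    intro h
    have h1 := congrArg (fun u : (conductorOrder A c)ˣ => B.im (u : conductorOrder A c)) h
    simp [hz] at h1
    exact hy h1

/-- Modulo cubes, the units of a real quadratic order are generated by a fundamental unit. -/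
theorem card_units_mod_cubes_of_real (B : QuadraticCoords A) (hpos : 0 < B.disc)
    (hsq : ¬IsSquare B.disc) (c : ℕ+) :
    Nat.card ((conductorOrder A c)ˣ ⧸
      (powMonoidHom 3 : (conductorOrder A c)ˣ →* (conductorOrder A c)ˣ).range) = 3 := by
  set s := Real.sqrt B.disc with hsdef
  have hs : s ^ 2 = B.disc := Real.sq_sqrt (by exact_mod_cast hpos.le)
  have hs0 : 0 ≤ s := Real.sqrt_nonneg _
  set σ := B.realEmb s hs with hσ
  have hσ0 : ∀ u : (conductorOrder A c)ˣ, σ (u : conductorOrder A c) ≠ 0 := by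
    intro u h
    obtain ⟨-, -, -, -, hn⟩ := B.exists_unit_coords u
    have h1 := B.realEmb_mul_realEmb s hs (u : conductorOrder A c)
    rw [← hσ, h, zero_mul] at h1
    rcases hn with h2 | h2 <;> rw [h2] at h1 <;> norm_num at h1
  let L : Additive (conductorOrder A c)ˣ →+ ℝ :=
    { toFun := fun u => Real.log |σ (u.toMul : conductorOrder A c)|
      map_zero' := by simp
      map_add' := fun u v => by
        rw [toMul_add, Units.val_mul, Subring.coe_mul, map_mul, abs_mul,
          Real.log_mul (abs_ne_zero.2 (hσ0 _)) (abs_ne_zero.2 (hσ0 _))] }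
  have hL : ∀ u : (conductorOrder A c)ˣ,
      L (Additive.ofMul u) = Real.log |σ (u : conductorOrder A c)| := fun u => rfl
  have hsmall : ∀ u : (conductorOrder A c)ˣ, 0 ≤ L (Additive.ofMul u) →
      L (Additive.ofMul u) ≤ Real.log (3 / 2) → u = 1 ∨ u = -1 := by
    intro u h1 h2
    have hp := abs_pos.2 (hσ0 u)
    rw [hL] at h1 h2
    exact B.unit_eq_one_or_neg_one hpos hsq hs hs0 u ((Real.log_nonneg_iff hp).1 h1)
      ((Real.log_le_log_iff hp (by norm_num)).1 h2)
  have hlog : 0 < Real.log (3 / 2) := Real.log_pos (by norm_num)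
  have hL1 : ∀ u : (conductorOrder A c)ˣ, u = 1 ∨ u = -1 → L (Additive.ofMul u) = 0 := by
    rintro u (rfl | rfl) <;> rw [hL] <;> simp
  -- No unit has its logarithm in `(0, log (3 / 2))`, so the logarithms form a cyclic group.
  obtain ⟨b, hb⟩ := AddSubgroup.cyclic_of_isolated_zero (H := L.range) hlog (by
    rw [Set.disjoint_left]
    rintro _ ⟨u, rfl⟩ ⟨h1, h2⟩
    have h3 := hL1 _ (hsmall u.toMul h1.le h2.le)
    exact h1.ne' h3)
  obtain ⟨u₁, hu₁⟩ := B.exists_unit_ne hpos hsq c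
  have hrange : ∀ u : (conductorOrder A c)ˣ, ∃ n : ℤ, L (Additive.ofMul u) = n * b := by
    intro u
    have : L (Additive.ofMul u) ∈ L.range := ⟨_, rfl⟩
    rw [hb, AddSubgroup.mem_closure_singleton] at this
    obtain ⟨n, hn⟩ := this
    exact ⟨n, by rw [← hn, zsmul_eq_mul]⟩
  obtain ⟨u₀, hu₀⟩ : ∃ u₀ : (conductorOrder A c)ˣ, L (Additive.ofMul u₀) = b := by
    have : b ∈ L.range := by rw [hb]; exact AddSubgroup.subset_closure rfl
    obtain ⟨u, hu⟩ := this
    exact ⟨u.toMul, hu⟩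
  have hb0 : b ≠ 0 := by
    rintro rfl
    obtain ⟨n, hn⟩ := hrange u₁
    rw [mul_zero] at hn
    rcases hsmall u₁ hn.ge (by rw [hn]; exact hlog.le) with h | h
    · exact hu₁.1 h
    · exact hu₁.2 h
  -- `n u` is the exponent of the fundamental unit `u₀` in `u`, up to sign. Since `-1` is a cube, `u`
  -- is a cube iff `3 ∣ n u`.
  choose n hn using hrange
  have hnu : ∀ (u : (conductorOrder A c)ˣ) (m : ℤ), L (Additive.ofMul u) = m * b → n u = m := by
    intro u m h
    rw [hn] at h
    exact_mod_cast mul_right_cancel₀ hb0 h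
  have hnmul : ∀ u v, n (u * v) = n u + n v := by
    intro u v
    apply hnu
    rw [ofMul_mul, map_add, hn, hn]; push_cast; ring
  have hnpow : ∀ (u : (conductorOrder A c)ˣ) (m : ℤ), n (u ^ m) = m * n u := by
    intro u m
    apply hnu
    rw [ofMul_zpow, map_zsmul, hn, zsmul_eq_mul]; push_cast; ring
  have hn₀ : n u₀ = 1 := hnu _ _ (by rw [hu₀]; simp)
  let f : (conductorOrder A c)ˣ →* Multiplicative (ZMod 3) :=
    MonoidHom.mk' (fun u => Multiplicative.ofAdd (n u : ZMod 3)) fun u v => by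
      rw [hnmul, Int.cast_add, ofAdd_add]
  have hf : ∀ u, f u = Multiplicative.ofAdd (n u : ZMod 3) := fun u => rfl
  have hfsurj : Function.Surjective f := by
    intro k
    refine ⟨u₀ ^ (k.toAdd.val : ℤ), ?_⟩
    rw [hf, hnpow, hn₀]
    simp
  have hker : f.ker = (powMonoidHom 3 : (conductorOrder A c)ˣ →* (conductorOrder A c)ˣ).range := by
    ext u
    rw [MonoidHom.mem_ker, hf, ofAdd_eq_one, ZMod.intCast_zmod_eq_zero_iff_dvd]
    constructor
    · rintro ⟨m, hm⟩
      have h1 : L (Additive.ofMul (u * (u₀ ^ (-m)) ^ 3)) = 0 := by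
        rw [hn, hnmul, ← zpow_natCast, ← zpow_mul, hnpow, hn₀, hm]
        push_cast; ring
      have h2 := hsmall _ h1.ge (by rw [h1]; exact hlog.le)
      rcases h2 with h2 | h2
      · refine ⟨u₀ ^ m, ?_⟩
        rw [powMonoidHom_apply]
        rw [zpow_neg, inv_pow, mul_inv_eq_one] at h2
        exact h2.symm
      · refine ⟨-u₀ ^ m, ?_⟩
        rw [powMonoidHom_apply]
        rw [zpow_neg, inv_pow, mul_inv_eq_iff_eq_mul] at h2
        rw [h2, Odd.neg_pow (by decide), neg_one_mul]
    · rintro ⟨v, rfl⟩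
      refine ⟨n v, ?_⟩
      have := hnpow v 3
      rw [powMonoidHom_apply]
      exact_mod_cast this
  rw [← hker, Nat.card_congr (QuotientGroup.quotientKerEquivOfSurjective f hfsurj).toEquiv]
  simp

end QuadraticCoords

/-! ### Reduction of binary cubic forms and convergence over the orbits -/

/-- Reduction of the positive definite real binary quadratic form
`α u² + 2 β u v + δ v²`, by moving its root to the fundamental domain of the modular group. -/
lemma exists_reduced_posDef {α β δ : ℝ} (hα : 0 < α) (hD : 0 < α * δ - β ^ 2) :
    ∃ g : SL(2, ℤ), ∃ α' δ' : ℝ,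
      α' = α * g 0 0 ^ 2 + 2 * β * g 0 0 * g 0 1 + δ * g 0 1 ^ 2 ∧
      δ' = α * g 1 0 ^ 2 + 2 * β * g 1 0 * g 1 1 + δ * g 1 1 ^ 2 ∧
      α' ≤ δ' ∧ 3 * (α' * δ') ≤ 4 * (α * δ - β ^ 2) := by
  set s := Real.sqrt (α * δ - β ^ 2) with hs
  have hs0 : 0 < s := Real.sqrt_pos.2 hD
  have hs2 : s ^ 2 = α * δ - β ^ 2 := Real.sq_sqrt hD.le
  let z : UpperHalfPlane := ⟨⟨β / α, s / α⟩, div_pos hs0 hα⟩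
  obtain ⟨h, hh⟩ := ModularGroup.exists_smul_mem_fd z
  have hdet : (h 0 0 : ℝ) * h 1 1 - h 0 1 * h 1 0 = 1 := by
    have := h.det_coe
    rw [Matrix.det_fin_two] at this
    exact_mod_cast this
  -- the substitution of the form that matches the Moebius transformation of its root
  let g : SL(2, ℤ) := ⟨!![h 1 1, h 1 0; h 0 1, h 0 0], by
    have := h.det_coe
    rw [Matrix.det_fin_two] at this
    rw [Matrix.det_fin_two_of]; linarith⟩
  have e00 : g 0 0 = h 1 1 := rfl
  have e01 : g 0 1 = h 1 0 := rfl
  have e10 : g 1 0 = h 0 1 := rfl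
  have e11 : g 1 1 = h 0 0 := rfl
  set den : ℂ := (h 1 0 : ℂ) * z + h 1 1 with hden
  set num : ℂ := (h 0 0 : ℂ) * z + h 0 1 with hnum
  have hz : ((z : UpperHalfPlane) : ℂ) = ⟨β / α, s / α⟩ := rfl
  have hdenre : den.re = h 1 0 * (β / α) + h 1 1 := by simp [hden, hz]
  have hdenim : den.im = h 1 0 * (s / α) := by simp [hden, hz]
  have hnumre : num.re = h 0 0 * (β / α) + h 0 1 := by simp [hnum, hz]
  have hnumim : num.im = h 0 0 * (s / α) := by simp [hnum, hz]
  have hsmul : ((h • z : UpperHalfPlane) : ℂ) = num / den := by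
    rw [UpperHalfPlane.coe_specialLinearGroup_apply]; simp [hnum, hden]
  set w : ℂ := ((h • z : UpperHalfPlane) : ℂ) with hw
  have hdn : Complex.normSq den = h 1 0 ^ 2 * (δ / α) + 2 * h 1 0 * h 1 1 * (β / α) + h 1 1 ^ 2 := by
    rw [Complex.normSq_apply, hdenre, hdenim]
    field_simp
    linear_combination (h 1 0 : ℝ) ^ 2 * hs2
  have hnn : Complex.normSq num = h 0 0 ^ 2 * (δ / α) + 2 * h 0 0 * h 0 1 * (β / α) + h 0 1 ^ 2 := by
    rw [Complex.normSq_apply, hnumre, hnumim]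
    field_simp
    linear_combination (h 0 0 : ℝ) ^ 2 * hs2
  have hden0 : den ≠ 0 := by
    intro h0
    have hi : den.im = 0 := by rw [h0]; rfl
    have hr : den.re = 0 := by rw [h0]; rfl
    rw [hdenim] at hi
    have h10 : (h 1 0 : ℝ) = 0 := by
      rcases mul_eq_zero.1 hi with h | h
      · exact h
      · exact absurd h (div_pos hs0 hα).ne'
    rw [hdenre, h10] at hr
    rw [h10] at hdet
    simp at hr
    rw [hr] at hdet
    simp at hdet
  have hdpos : 0 < Complex.normSq den := Complex.normSq_pos.2 hden0
  have hwn : Complex.normSq num = Complex.normSq den * Complex.normSq w := by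
    rw [hsmul, Complex.normSq_div]; field_simp
  have hwim : w.im * Complex.normSq den = s / α := by
    rw [hsmul, Complex.div_im, hnumre, hnumim, hdenre, hdenim]
    field_simp
    linear_combination α * hdet
  obtain ⟨hf1, hf2⟩ := hh
  change 1 ≤ Complex.normSq w at hf1
  change |w.re| ≤ 1 / 2 at hf2
  have hf3 : w.re ^ 2 ≤ 1 / 4 := by
    rw [← sq_abs]; nlinarith [abs_nonneg w.re]
  have hwsq : Complex.normSq w = w.re ^ 2 + w.im ^ 2 := by rw [Complex.normSq_apply]; ring
  refine ⟨g, α * Complex.normSq den, α * Complex.normSq num, ?_, ?_, ?_, ?_⟩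
  · rw [e00, e01, hdn]; field_simp; ring
  · rw [e10, e11, hnn]; field_simp; ring
  · rw [hwn]
    exact mul_le_mul_of_nonneg_left (le_mul_of_one_le_right hdpos.le hf1) hα.le
  · have h1 : 3 * Complex.normSq w ≤ 4 * w.im ^ 2 := by linarith
    have h2 : (α * (w.im * Complex.normSq den)) ^ 2 = α * δ - β ^ 2 := by
      rw [hwim, mul_div_cancel₀ _ hα.ne', hs2]
    rw [← h2, hwn]
    nlinarith [mul_le_mul_of_nonneg_left h1 (sq_nonneg (α * Complex.normSq den))]

namespace BinaryCubicForm

/-- `f = (m₁ u + n₁ v)³ + (m₂ u + n₂ v)³` over the complex numbers. -/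
structure IsSumOfCubes (f : BinaryCubicForm) (m₁ n₁ m₂ n₂ : ℂ) : Prop where
  x₀ : (f.x₀ : ℂ) = m₁ ^ 3 + m₂ ^ 3
  x₁ : (f.x₁ : ℂ) = 3 * (m₁ ^ 2 * n₁ + m₂ ^ 2 * n₂)
  x₂ : (f.x₂ : ℂ) = 3 * (m₁ * n₁ ^ 2 + m₂ * n₂ ^ 2)
  x₃ : (f.x₃ : ℂ) = n₁ ^ 3 + n₂ ^ 3

lemma IsSumOfCubes.smul {f : BinaryCubicForm} {m₁ n₁ m₂ n₂ : ℂ}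
    (h : f.IsSumOfCubes m₁ n₁ m₂ n₂) (γ : SL(2, ℤ)) :
    (γ • f).IsSumOfCubes (m₁ * γ 0 0 + n₁ * γ 0 1) (m₁ * γ 1 0 + n₁ * γ 1 1)
      (m₂ * γ 0 0 + n₂ * γ 0 1) (m₂ * γ 1 0 + n₂ * γ 1 1) := by
  constructor
  · rw [smul_x₀]; push_cast; rw [h.x₀, h.x₁, h.x₂, h.x₃]; ring
  · rw [smul_x₁]; push_cast; rw [h.x₀, h.x₁, h.x₂, h.x₃]; ring
  · rw [smul_x₂]; push_cast; rw [h.x₀, h.x₁, h.x₂, h.x₃]; ring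
  · rw [smul_x₃]; push_cast; rw [h.x₀, h.x₁, h.x₂, h.x₃]; ring

lemma IsSumOfCubes.disc_eq {f : BinaryCubicForm} {m₁ n₁ m₂ n₂ : ℂ}
    (h : f.IsSumOfCubes m₁ n₁ m₂ n₂) : (f.disc : ℂ) = -27 * (m₁ * n₂ - m₂ * n₁) ^ 6 := by
  rw [disc]; push_cast; rw [h.x₀, h.x₁, h.x₂, h.x₃]; ring

/-- The coefficients of a form with nonzero discriminant form a linear recurrence whose
characteristic polynomial is the Hessian; `δ` is a square root of the discriminant of the
Hessian, `-3 disc`, and `p`, `q` are the coefficients in the closed form of the recurrence. -/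
lemma exists_closed_form {K : Type*} [Field K] [CharZero K] (f : BinaryCubicForm)
    (hA : f.x₁ ^ 2 - 3 * f.x₀ * f.x₂ ≠ 0) {δ : K} (hδ0 : δ ≠ 0) (hδ : δ ^ 2 = -3 * f.disc) :
    ∃ A B N : K, A = (f.x₁ ^ 2 - 3 * f.x₀ * f.x₂ : ℤ) ∧ B = (f.x₁ * f.x₂ - 9 * f.x₀ * f.x₃ : ℤ) ∧
      N = B * f.x₀ - 2 * A * f.x₁ / 3 ∧
      ∀ p q t r : K, p = f.x₀ / 2 + N / (2 * δ) → q = f.x₀ / 2 - N / (2 * δ) →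
        t = (B - δ) / (2 * A) → r = (B + δ) / (2 * A) →
        (f.x₀ : K) = p + q ∧ (f.x₁ : K) = 3 * (p * t + q * r) ∧
        (f.x₂ : K) = 3 * (p * t ^ 2 + q * r ^ 2) ∧ (f.x₃ : K) = p * t ^ 3 + q * r ^ 3 := by
  refine ⟨_, _, _, rfl, rfl, rfl, ?_⟩
  have hA' : ((f.x₁ ^ 2 - 3 * f.x₀ * f.x₂ : ℤ) : K) ≠ 0 := by exact_mod_cast hA
  obtain ⟨a, b, c, d⟩ := f
  simp only [disc] at hδ hA' ⊢
  push_cast at hδ hA' ⊢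
  set A : K := (b : K) ^ 2 - 3 * a * c with hAdef
  set B : K := (b : K) * c - 9 * a * d with hBdef
  set C : K := (c : K) ^ 2 - 3 * b * d with hCdef
  have hq : δ ^ 2 = B ^ 2 - 4 * A * C := by rw [hδ, hAdef, hBdef, hCdef]; ring
  rintro p q t r hp hq' ht hr
  have h0 : (a : K) = p + q := by rw [hp, hq']; ring
  have h1 : (b : K) = 3 * (p * t + q * r) := by
    rw [hp, hq', ht, hr]; field_simp; ring
  have et : A * t ^ 2 = B * t - C := by
    rw [ht]; field_simp; linear_combination hq
  have er : A * r ^ 2 = B * r - C := by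
    rw [hr]; field_simp; linear_combination hq
  -- the two instances of the recurrence
  have r2 : A * c = B * b - 3 * C * a := by rw [hAdef, hBdef, hCdef]; ring
  have r3 : 3 * A * d = B * c - C * b := by rw [hAdef, hBdef, hCdef]; ring
  have h2 : (c : K) = 3 * (p * t ^ 2 + q * r ^ 2) := by
    apply mul_left_cancel₀ hA'
    linear_combination r2 + B * h1 - 3 * C * h0 - 3 * p * et - 3 * q * er
  refine ⟨h0, h1, h2, ?_⟩
  apply mul_left_cancel₀ (mul_ne_zero three_ne_zero hA')
  linear_combination r3 + B * h2 - C * h1 - 3 * p * t * et - 3 * q * r * er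

lemma exists_real_cbrt (x : ℝ) : ∃ y : ℝ, y ^ 3 = x := by
  have h : ∀ x : ℝ, 0 ≤ x → ∃ y : ℝ, y ^ 3 = x := fun x hx =>
    ⟨x ^ (((3 : ℕ) : ℝ)⁻¹), Real.rpow_inv_natCast_pow hx three_ne_zero⟩
  rcases le_total 0 x with hx | hx
  · exact h x hx
  · obtain ⟨y, hy⟩ := h (-x) (by linarith)
    exact ⟨-y, by rw [Odd.neg_pow (by decide), hy, neg_neg]⟩

/-- A form whose Hessian has nonzero leading coefficient is a sum of two cubes of linear forms,
which are real or conjugate to each other. -/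
lemma exists_isSumOfCubes (f : BinaryCubicForm) (hf : f.disc ≠ 0)
    (hA : f.x₁ ^ 2 - 3 * f.x₀ * f.x₂ ≠ 0) :
    ∃ m₁ n₁ m₂ n₂ : ℂ, f.IsSumOfCubes m₁ n₁ m₂ n₂ ∧
      ((m₁.im = 0 ∧ n₁.im = 0 ∧ m₂.im = 0 ∧ n₂.im = 0) ∨
        (m₂ = star m₁ ∧ n₂ = star n₁)) := by
  rcases lt_or_gt_of_ne hf with h | h
  · have h' : (f.disc : ℝ) < 0 := by exact_mod_cast h
    obtain ⟨A, B, N, -, -, -, H⟩ := exists_closed_form (K := ℝ) f hA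
      (δ := Real.sqrt (-3 * f.disc)) (Real.sqrt_pos.2 (by linarith)).ne'
      (Real.sq_sqrt (by linarith))
    obtain ⟨h0, h1, h2, h3⟩ := H _ _ _ _ rfl rfl rfl rfl
    set δ := Real.sqrt (-3 * f.disc)
    obtain ⟨m, hm⟩ := exists_real_cbrt (f.x₀ / 2 + N / (2 * δ))
    obtain ⟨m', hm'⟩ := exists_real_cbrt (f.x₀ / 2 - N / (2 * δ))
    rw [← hm, ← hm'] at h0 h1 h2 h3
    refine ⟨m, (m * ((B - δ) / (2 * A)) : ℝ), m', (m' * ((B + δ) / (2 * A)) : ℝ), ⟨?_, ?_, ?_, ?_⟩,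
      Or.inl (by simp only [Complex.ofReal_im, and_self])⟩
    · rw [← Complex.ofReal_intCast, h0]; push_cast; ring
    · rw [← Complex.ofReal_intCast, h1]; push_cast; ring
    · rw [← Complex.ofReal_intCast, h2]; push_cast; ring
    · rw [← Complex.ofReal_intCast, h3]; push_cast; ring
  · have h' : (0 : ℝ) < f.disc := by exact_mod_cast h
    set s := Real.sqrt (3 * f.disc) with hs
    have hs0 : 0 < s := Real.sqrt_pos.2 (by linarith)
    have hs2 : s ^ 2 = 3 * f.disc := Real.sq_sqrt (by linarith)
    have hs2' : (s : ℂ) ^ 2 = 3 * f.disc := by exact_mod_cast hs2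
    obtain ⟨A, B, N, hA, hB, hN, H⟩ := exists_closed_form (K := ℂ) f hA
      (δ := s * Complex.I)
      (mul_ne_zero (by exact_mod_cast hs0.ne') Complex.I_ne_zero)
      (by rw [mul_pow, Complex.I_sq, hs2']; ring)
    have cA : star A = A := by rw [hA]; simp
    have cB : star B = B := by rw [hB]; simp
    have cN : star N = N := by rw [hN]; simp [cA, cB]
    obtain ⟨h0, h1, h2, h3⟩ := H _ _ _ _ rfl rfl rfl rfl
    set δ : ℂ := s * Complex.I with hδ
    have cδ : star δ = -δ := by simp [hδ]
    obtain ⟨m, hm⟩ := IsAlgClosed.exists_pow_nat_eq (f.x₀ / 2 + N / (2 * δ)) (n := 3) (by norm_num)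
    have hm' : star m ^ 3 = f.x₀ / 2 - N / (2 * δ) := by
      rw [← star_pow, hm]
      simp [cN, cδ, div_neg, sub_eq_add_neg]
    have ht : star ((B - δ) / (2 * A)) = (B + δ) / (2 * A) := by
      simp [cA, cB, cδ]
    rw [← hm, ← hm'] at h0 h1 h2 h3
    rw [← ht] at h1 h2 h3
    refine ⟨m, m * ((B - δ) / (2 * A)), star m, star (m * ((B - δ) / (2 * A))), ⟨h0, ?_, ?_, ?_⟩,
      Or.inr ⟨rfl, rfl⟩⟩
    · rw [h1, star_mul']; ring
    · rw [h2, star_mul']; ring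
    · rw [h3, star_mul']; ring

/-- The Gram determinant of the definite form `|ℓ₁|² + |ℓ₂|²`. -/
lemma gram_eq {m₁ n₁ m₂ n₂ : ℂ} (h : (m₁.im = 0 ∧ n₁.im = 0 ∧ m₂.im = 0 ∧ n₂.im = 0) ∨
      (m₂ = star m₁ ∧ n₂ = star n₁)) :
    (‖m₁‖ ^ 2 + ‖m₂‖ ^ 2) * (‖n₁‖ ^ 2 + ‖n₂‖ ^ 2)
      - (m₁.re * n₁.re + m₁.im * n₁.im + (m₂.re * n₂.re + m₂.im * n₂.im)) ^ 2
      = ‖m₁ * n₂ - m₂ * n₁‖ ^ 2 := by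
  simp only [← Complex.normSq_eq_norm_sq, Complex.normSq_apply]
  rcases h with ⟨h1, h2, h3, h4⟩ | ⟨rfl, rfl⟩
  · simp [h1, h2, h3, h4]; ring
  · simp; ring

lemma norm_sq_comb (m n : ℂ) (a b : ℤ) :
    ‖m * a + n * b‖ ^ 2 = ‖m‖ ^ 2 * a ^ 2 + 2 * (m.re * n.re + m.im * n.im) * a * b
      + ‖n‖ ^ 2 * b ^ 2 := by
  simp only [← Complex.normSq_eq_norm_sq, Complex.normSq_apply]
  simp; ring

/-- The coefficient bound for reduced forms with `x₀ ≠ 0`. The coefficients are at most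
`6 a³, 6 a² b, 6 a b², 6 b³` for the square roots `a ≤ b` of the diagonal coefficients of
`|ℓ₁|² + |ℓ₂|²`, and `(a b)⁶` is bounded by `disc`. -/
lemma IsSumOfCubes.prod_le {f : BinaryCubicForm} {m₁ n₁ m₂ n₂ : ℂ}
    (h : f.IsSumOfCubes m₁ n₁ m₂ n₂) (h0 : f.x₀ ≠ 0)
    (hle : ‖m₁‖ ^ 2 + ‖m₂‖ ^ 2 ≤ ‖n₁‖ ^ 2 + ‖n₂‖ ^ 2)
    (hdet : 3 * ((‖m₁‖ ^ 2 + ‖m₂‖ ^ 2) * (‖n₁‖ ^ 2 + ‖n₂‖ ^ 2))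
      ≤ 4 * ‖m₁ * n₂ - m₂ * n₁‖ ^ 2) :
    max 1 |(f.x₀ : ℝ)| * (max 1 |(f.x₁ : ℝ)| * (max 1 |(f.x₂ : ℝ)| * max 1 |(f.x₃ : ℝ)|))
      ≤ 114 * |(f.disc : ℝ)| := by
  set a := Real.sqrt (‖m₁‖ ^ 2 + ‖m₂‖ ^ 2) with ha
  set b := Real.sqrt (‖n₁‖ ^ 2 + ‖n₂‖ ^ 2) with hb
  have ha0 : 0 ≤ a := Real.sqrt_nonneg _
  have hb0 : 0 ≤ b := Real.sqrt_nonneg _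
  have hab : a ≤ b := Real.sqrt_le_sqrt hle
  have ha2 : a ^ 2 = ‖m₁‖ ^ 2 + ‖m₂‖ ^ 2 := Real.sq_sqrt (by positivity)
  have hb2 : b ^ 2 = ‖n₁‖ ^ 2 + ‖n₂‖ ^ 2 := Real.sq_sqrt (by positivity)
  have hm1 : ‖m₁‖ ≤ a := Real.le_sqrt_of_sq_le (by nlinarith [norm_nonneg m₂])
  have hm2 : ‖m₂‖ ≤ a := Real.le_sqrt_of_sq_le (by nlinarith [norm_nonneg m₁])
  have hn1 : ‖n₁‖ ≤ b := Real.le_sqrt_of_sq_le (by nlinarith [norm_nonneg n₂])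
  have hn2 : ‖n₂‖ ≤ b := Real.le_sqrt_of_sq_le (by nlinarith [norm_nonneg n₁])
  have key : ∀ x : ℤ, |(x : ℝ)| = ‖(x : ℂ)‖ := fun x => by
    rw [Complex.norm_intCast]
  have t : ∀ (z w : ℂ) (x : ℝ), ‖z‖ ≤ x → ‖w‖ ≤ x → ‖z + w‖ ≤ 2 * x := fun z w x hz hw =>
    (norm_add_le z w).trans (by linarith)
  have b0 : |(f.x₀ : ℝ)| ≤ 2 * a ^ 3 := by
    rw [key, h.x₀]
    refine t _ _ _ ?_ ?_ <;> rw [norm_pow] <;> gcongr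
  have b1 : |(f.x₁ : ℝ)| ≤ 6 * (a ^ 2 * b) := by
    rw [key, h.x₁, norm_mul]
    have := t (m₁ ^ 2 * n₁) (m₂ ^ 2 * n₂) (a ^ 2 * b) (by rw [norm_mul, norm_pow]; gcongr)
      (by rw [norm_mul, norm_pow]; gcongr)
    have h3 : ‖(3 : ℂ)‖ = 3 := by simp
    rw [h3]; linarith
  have b2 : |(f.x₂ : ℝ)| ≤ 6 * (a * b ^ 2) := by
    rw [key, h.x₂, norm_mul]
    have := t (m₁ * n₁ ^ 2) (m₂ * n₂ ^ 2) (a * b ^ 2) (by rw [norm_mul, norm_pow]; gcongr)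
      (by rw [norm_mul, norm_pow]; gcongr)
    have h3 : ‖(3 : ℂ)‖ = 3 := by simp
    rw [h3]; linarith
  have b3 : |(f.x₃ : ℝ)| ≤ 2 * b ^ 3 := by
    rw [key, h.x₃]
    refine t _ _ _ ?_ ?_ <;> rw [norm_pow] <;> gcongr
  -- Integrality of `x₀ ≠ 0` bounds `a` from below, so that the same bounds hold for `max 1 |xᵢ|`.
  have c0 : (1 : ℝ) ≤ 2 * a ^ 3 := by
    refine le_trans ?_ b0
    exact_mod_cast Int.one_le_abs h0
  have c1 : a ^ 3 ≤ a ^ 2 * b := by rw [pow_succ]; gcongr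
  have c2 : a ^ 2 * b ≤ a * b ^ 2 := by
    have : a * (a * b) ≤ a * (b * b) := by gcongr
    linarith
  have c3 : a * b ^ 2 ≤ b ^ 3 := by
    have : a * b ^ 2 ≤ b * b ^ 2 := by gcongr
    linarith
  have d0 : max 1 |(f.x₀ : ℝ)| ≤ 6 * a ^ 3 := max_le (by linarith) (by linarith)
  have d1 : max 1 |(f.x₁ : ℝ)| ≤ 6 * (a ^ 2 * b) := max_le (by linarith) (by linarith)
  have d2 : max 1 |(f.x₂ : ℝ)| ≤ 6 * (a * b ^ 2) := max_le (by linarith) (by linarith)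
  have d3 : max 1 |(f.x₃ : ℝ)| ≤ 6 * b ^ 3 := max_le (by linarith) (by linarith)
  have hdisc : |(f.disc : ℝ)| = 27 * (‖m₁ * n₂ - m₂ * n₁‖ ^ 2) ^ 3 := by
    rw [key, h.disc_eq, norm_mul, norm_pow]
    have : ‖(-27 : ℂ)‖ = 27 := by simp
    rw [this]; ring
  have e : a ^ 2 * b ^ 2 ≤ 4 / 3 * ‖m₁ * n₂ - m₂ * n₁‖ ^ 2 := by rw [ha2, hb2]; linarith
  have e3 : (a ^ 2 * b ^ 2) ^ 3 ≤ (4 / 3 * ‖m₁ * n₂ - m₂ * n₁‖ ^ 2) ^ 3 := by gcongr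
  calc _ ≤ 6 * a ^ 3 * (6 * (a ^ 2 * b) * (6 * (a * b ^ 2) * (6 * b ^ 3))) := by gcongr
    _ = 1296 * (a ^ 2 * b ^ 2) ^ 3 := by ring
    _ ≤ 1296 * (4 / 3 * ‖m₁ * n₂ - m₂ * n₁‖ ^ 2) ^ 3 := by gcongr
    _ ≤ 114 * |(f.disc : ℝ)| := by
      -- `1296 * (4 / 3) ^ 3 = 3072 ≤ 114 * 27`
      rw [hdisc]
      nlinarith [pow_nonneg (sq_nonneg ‖m₁ * n₂ - m₂ * n₁‖) 3]

/-- Every orbit of nonzero discriminant contains a form whose coefficients are bounded in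
terms of the discriminant. The reducible case `x₀ = 0`, in which the definite form
`|ℓ₁|² + |ℓ₂|²` gives no bound, is reduced by a translation instead. -/
theorem exists_reduced (f : BinaryCubicForm) (hf : f.disc ≠ 0) :
    ∃ γ : SL(2, ℤ), ((γ • f).x₀ ≠ 0 ∧
      max 1 |((γ • f).x₀ : ℝ)| * (max 1 |((γ • f).x₁ : ℝ)| * (max 1 |((γ • f).x₂ : ℝ)| *
        max 1 |((γ • f).x₃ : ℝ)|)) ≤ 114 * |(f.disc : ℝ)|) ∨
      ((γ • f).x₀ = 0 ∧ (γ • f).x₁ ≠ 0 ∧ |(γ • f).x₂| ≤ |(γ • f).x₁|) := by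
  obtain ⟨γ₁, h₁⟩ := exists_smul_hessian_ne_zero f hf
  have hd : (γ₁ • f).disc ≠ 0 := by rwa [disc_smul]
  obtain ⟨m₁, n₁, m₂, n₂, hc, hr⟩ := exists_isSumOfCubes _ hd h₁
  have hg := gram_eq hr
  have hdet : 0 < ‖m₁ * n₂ - m₂ * n₁‖ ^ 2 := by
    have : m₁ * n₂ - m₂ * n₁ ≠ 0 := by
      intro h0
      have := hc.disc_eq
      rw [h0, zero_pow (by norm_num), mul_zero] at this
      exact hd (by exact_mod_cast this)
    positivity
  have hα : 0 < ‖m₁‖ ^ 2 + ‖m₂‖ ^ 2 := by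
    rcases eq_or_ne m₁ 0 with h1 | h1
    · rcases eq_or_ne m₂ 0 with h2 | h2
      · simp [h1, h2] at hdet
      · positivity
    · positivity
  obtain ⟨g, α', δ', e1, e2, hle, hle2⟩ := exists_reduced_posDef hα (hg ▸ hdet)
  rw [hg] at hle2
  have hc' := hc.smul g
  have hdet' : (m₁ * g 0 0 + n₁ * g 0 1) * (m₂ * g 1 0 + n₂ * g 1 1)
      - (m₂ * g 0 0 + n₂ * g 0 1) * (m₁ * g 1 0 + n₁ * g 1 1) = m₁ * n₂ - m₂ * n₁ := by
    have h : (g 0 0 : ℂ) * g 1 1 - g 0 1 * g 1 0 = 1 := by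
      have := g.det_coe
      rw [Matrix.det_fin_two] at this
      exact_mod_cast this
    linear_combination (m₁ * n₂ - m₂ * n₁) * h
  have ea : ‖m₁ * g 0 0 + n₁ * g 0 1‖ ^ 2 + ‖m₂ * g 0 0 + n₂ * g 0 1‖ ^ 2 = α' := by
    rw [norm_sq_comb, norm_sq_comb, e1]; ring
  have ed : ‖m₁ * g 1 0 + n₁ * g 1 1‖ ^ 2 + ‖m₂ * g 1 0 + n₂ * g 1 1‖ ^ 2 = δ' := by
    rw [norm_sq_comb, norm_sq_comb, e2]; ring
  by_cases h0 : (g • γ₁ • f).x₀ = 0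
  · have hd2 : (g • γ₁ • f).disc ≠ 0 := by rwa [disc_smul]
    set x := g • γ₁ • f with hx
    have hx1 : x.x₁ ≠ 0 := by
      intro h1
      apply hd2
      rw [disc, h0, h1]; ring
    obtain ⟨k, hk⟩ : ∃ k : ℤ, |x.x₂ + 2 * k * x.x₁| ≤ |x.x₁| := by
      refine ⟨-((x.x₂ + |x.x₁|) / (2 * |x.x₁|)) * x.x₁.sign, ?_⟩
      have hp : 0 < |x.x₁| := abs_pos.2 hx1
      have e : x.x₂ + 2 * (-((x.x₂ + |x.x₁|) / (2 * |x.x₁|)) * x.x₁.sign) * x.x₁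
          = x.x₂ - (2 * |x.x₁|) * ((x.x₂ + |x.x₁|) / (2 * |x.x₁|)) := by
        rw [← Int.sign_mul_self_eq_abs]; ring
      rw [e]
      have h1 := Int.emod_add_mul_ediv (x.x₂ + |x.x₁|) (2 * |x.x₁|)
      have h2 := Int.emod_nonneg (x.x₂ + |x.x₁|) (b := 2 * |x.x₁|) (by omega)
      have h3 := Int.emod_lt_of_pos (x.x₂ + |x.x₁|) (b := 2 * |x.x₁|) (by omega)
      rw [abs_le]
      constructor <;> linarith
    let τ : SL(2, ℤ) := ⟨!![1, 0; k, 1], by simp [Matrix.det_fin_two]⟩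
    have t00 : τ 0 0 = 1 := rfl
    have t01 : τ 0 1 = 0 := rfl
    have t10 : τ 1 0 = k := rfl
    have t11 : τ 1 1 = 1 := rfl
    refine ⟨τ * g * γ₁, Or.inr ?_⟩
    rw [mul_smul, mul_smul, ← hx]
    have y0 : (τ • x).x₀ = 0 := by rw [smul_x₀, t00, t01, h0]; ring
    have y1 : (τ • x).x₁ = x.x₁ := by rw [smul_x₁, t00, t01, t10, t11, h0]; ring
    have y2 : (τ • x).x₂ = x.x₂ + 2 * k * x.x₁ := by
      rw [smul_x₂, t00, t01, t10, t11, h0]; ring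
    exact ⟨y0, y1 ▸ hx1, by rw [y1, y2]; exact hk⟩
  · refine ⟨g * γ₁, Or.inl ?_⟩
    rw [mul_smul]
    refine ⟨h0, ?_⟩
    have := hc'.prod_le h0 (by rw [ea, ed]; exact hle) (by rw [ea, ed, hdet']; exact hle2)
    rwa [disc_smul, disc_smul] at this

/-- The coefficients of a form. -/
def equivProd : BinaryCubicForm ≃ ℤ × ℤ × ℤ × ℤ where
  toFun f := (f.x₀, f.x₁, f.x₂, f.x₃)
  invFun v := ⟨v.1, v.2.1, v.2.2.1, v.2.2.2⟩
  left_inv _ := rfl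
  right_inv _ := rfl

/-- A summable function on the set of all forms that bounds `|disc| ^ (-τ)` on reduced forms. -/
noncomputable def majorant (τ : ℝ) (f : BinaryCubicForm) : ℝ :=
  114 ^ τ * (intWeight τ f.x₀ * (intWeight τ f.x₁ * (intWeight τ f.x₂ * intWeight τ f.x₃))) +
    Set.indicator {f : BinaryCubicForm | f.x₀ = 0 ∧ f.x₁ ≠ 0} (fun f =>
      intWeight τ f.x₁ * (intWeight τ f.x₂ * intWeight τ (f.x₂ ^ 2 - 4 * f.x₁ * f.x₃))) f

lemma summable_majorant {τ : ℝ} (hτ : 1 < τ) : Summable (majorant τ) := by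
  refine Summable.add (Summable.mul_left _ ?_) ?_
  · have h := (summable_intWeight_four hτ).comp_injective equivProd.injective
    exact h.congr fun f => rfl
  · rw [← summable_subtype_iff_indicator]
    refine (summable_intWeight_three hτ).comp_injective
      (i := fun f : {f : BinaryCubicForm | f.x₀ = 0 ∧ f.x₁ ≠ 0} =>
        (f.1.x₁, f.1.x₂, f.1.x₂ ^ 2 - 4 * f.1.x₁ * f.1.x₃)) ?_
    rintro ⟨f, hf0, hf1⟩ ⟨g, hg0, hg1⟩ h
    simp only [Prod.mk.injEq] at h
    obtain ⟨h1, h2, h3⟩ := h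
    rw [← h1, ← h2] at h3
    have h4 : f.x₁ * f.x₃ = f.x₁ * g.x₃ := by linarith
    exact Subtype.ext (BinaryCubicForm.ext (hf0.trans hg0.symm) h1 h2 (mul_left_cancel₀ hf1 h4))

lemma exists_smul_le_majorant {τ : ℝ} (hτ : 0 ≤ τ) (f : BinaryCubicForm) (hf : f.disc ≠ 0) :
    ∃ γ : SL(2, ℤ), |(f.disc : ℝ)| ^ (-τ) ≤ majorant τ (γ • f) := by
  obtain ⟨γ, h⟩ := exists_reduced f hf
  refine ⟨γ, ?_⟩
  have hn := intWeight_nonneg τ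
  have hd1 : (1 : ℝ) ≤ |(f.disc : ℝ)| := by exact_mod_cast Int.one_le_abs hf
  rcases h with ⟨-, h⟩ | ⟨h0, h1, h2⟩
  · refine le_add_of_le_of_nonneg ?_ (Set.indicator_nonneg (fun f _ =>
      mul_nonneg (hn _) (mul_nonneg (hn _) (hn _))) _)
    simp only [intWeight]
    rw [← Real.mul_rpow (by positivity) (by positivity),
      ← Real.mul_rpow (by positivity) (by positivity),
      ← Real.mul_rpow (by positivity) (by positivity)]
    have e : (114 : ℝ) ^ τ = (114⁻¹ : ℝ) ^ (-τ) := by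
      rw [Real.rpow_neg (by norm_num), Real.inv_rpow (by norm_num), inv_inv]
    rw [e, ← Real.mul_rpow (by positivity) (by positivity)]
    refine Real.rpow_le_rpow_of_nonpos (by positivity) ?_ (by linarith)
    linarith
  · refine le_add_of_nonneg_of_le (mul_nonneg (by positivity)
      (mul_nonneg (hn _) (mul_nonneg (hn _) (mul_nonneg (hn _) (hn _))))) ?_
    rw [Set.indicator_of_mem (show γ • f ∈ {f : BinaryCubicForm | f.x₀ = 0 ∧ f.x₁ ≠ 0} from
      ⟨h0, h1⟩)]
    rw [← disc_smul γ f] at hf ⊢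
    set g := γ • f
    have e : g.disc = g.x₁ * g.x₁ * (g.x₂ ^ 2 - 4 * g.x₁ * g.x₃) := by rw [disc, h0]; ring
    set m := g.x₂ ^ 2 - 4 * g.x₁ * g.x₃
    have hm : m ≠ 0 := by rintro hm; rw [e, hm, mul_zero] at hf; exact hf rfl
    have p1 : (1 : ℝ) ≤ |(g.x₁ : ℝ)| := by exact_mod_cast Int.one_le_abs h1
    have p2 : (1 : ℝ) ≤ |(m : ℝ)| := by exact_mod_cast Int.one_le_abs hm
    have p3 : |(g.x₂ : ℝ)| ≤ |(g.x₁ : ℝ)| := by exact_mod_cast h2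
    rw [e]
    push_cast
    rw [abs_mul, abs_mul, Real.mul_rpow (by positivity) (by positivity),
      Real.mul_rpow (by positivity) (by positivity), mul_assoc]
    have f1 := rpow_neg_le_intWeight hτ p1 le_rfl
    have f2 := rpow_neg_le_intWeight hτ p1 p3
    have f3 := rpow_neg_le_intWeight hτ p2 le_rfl
    exact mul_le_mul f1 (mul_le_mul f2 f3 (by positivity) (hn _)) (by positivity) (hn _)

/-- The sum of `|disc / 27| ^ (-τ)` over the orbits of forms of nonzero discriminant converges
for `τ > 1`. -/
theorem summable_disc_rpow {τ : ℝ} (hτ : 1 < τ) (S : SubMulAction SL(2, ℤ) BinaryCubicForm)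
    (hS : ∀ x ∈ S, x.disc ≠ 0) :
    Summable fun ω : MulAction.orbitRel.Quotient SL(2, ℤ) S =>
      |((Quotient.out ω).1.disc : ℝ) / 27| ^ (-τ) := by
  have hex := fun ω : MulAction.orbitRel.Quotient SL(2, ℤ) S =>
    exists_smul_le_majorant (by linarith : 0 ≤ τ) (Quotient.out ω).1 (hS _ (Quotient.out ω).2)
  choose γ hγ using hex
  have hinj : Function.Injective fun ω : MulAction.orbitRel.Quotient SL(2, ℤ) S =>
      γ ω • (Quotient.out ω).1 := by
    intro ω ω' h
    rw [← Quotient.out_eq ω, ← Quotient.out_eq ω']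
    refine Quotient.sound ⟨(γ ω)⁻¹ * γ ω', ?_⟩
    apply Subtype.ext
    change ((γ ω)⁻¹ * γ ω') • (Quotient.out ω').1 = (Quotient.out ω).1
    rw [mul_smul, inv_smul_eq_iff]
    exact h.symm
  refine Summable.of_nonneg_of_le (fun ω => by positivity) (fun ω => ?_)
    (((summable_majorant hτ).comp_injective hinj).mul_left ((27 : ℝ) ^ τ))
  rw [abs_div, abs_of_pos (by norm_num : (0 : ℝ) < 27), Real.div_rpow (by positivity) (by norm_num),
    Real.rpow_neg (by norm_num : (0 : ℝ) ≤ 27), div_inv_eq_mul, mul_comm]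
  exact mul_le_mul_of_nonneg_left (hγ ω) (by positivity)

end BinaryCubicForm

/-! ### Quadratic fields in coordinates -/

open NumberField in
/-- The maximal order of a quadratic field has an integral basis that starts with `1`. -/
lemma exists_integralBasis_one (k : Type*) [Field k] [NumberField k]
    (hk : Module.finrank ℚ k = 2) : ∃ b : Module.Basis (Fin 2) ℤ (𝓞 k), b 0 = 1 := by
  have hk' : Module.finrank ℤ (𝓞 k) = 2 := by rw [RingOfIntegers.rank, hk]
  let b := Module.finBasisOfFinrankEq ℤ (𝓞 k) hk'
  obtain ⟨p, q, hpq⟩ : ∃ p q : ℤ, (1 : 𝓞 k) = p • b 0 + q • b 1 :=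
    ⟨b.repr 1 0, b.repr 1 1, by rw [← Fin.sum_univ_two fun i => b.repr 1 i • b i, b.sum_repr]⟩
  -- `1` is a primitive vector, because a positive integer with integral inverse is `1`
  have hcop : IsCoprime p q := by
    rw [Int.isCoprime_iff_gcd_eq_one]
    obtain ⟨p', hp'⟩ := Int.gcd_dvd_left p q
    obtain ⟨q', hq'⟩ := Int.gcd_dvd_right p q
    set g := Int.gcd p q
    set y : 𝓞 k := p' • b 0 + q' • b 1
    have hy : (1 : 𝓞 k) = (g : ℤ) • y := by
      rw [hpq, smul_add, smul_smul, smul_smul, ← hp', ← hq']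
    have hn := congrArg (Algebra.norm ℤ) hy
    rw [map_one, zsmul_eq_mul, map_mul] at hn
    have hg : IsUnit (Algebra.norm ℤ ((g : ℤ) : 𝓞 k)) := IsUnit.of_mul_eq_one _ hn.symm
    have e : Algebra.norm ℤ ((g : ℤ) : 𝓞 k) = (g : ℤ) ^ 2 := by
      have := Algebra.norm_algebraMap_of_basis b (g : ℤ)
      simpa using this
    rw [e, isUnit_pow_iff two_ne_zero, Int.isUnit_iff] at hg
    omega
  obtain ⟨u, v, huv⟩ := hcop
  have h1 : !![u, v; -q, p] * !![p, -v; q, u] = (1 : Matrix (Fin 2) (Fin 2) ℤ) := by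
    ext i j
    fin_cases i <;> fin_cases j <;> simp [Matrix.mul_apply] <;> linarith
  have h2 : !![p, -v; q, u] * !![u, v; -q, p] = (1 : Matrix (Fin 2) (Fin 2) ℤ) := by
    ext i j
    fin_cases i <;> fin_cases j <;> simp [Matrix.mul_apply] <;> linarith
  let b' := Module.Basis.ofEquivFun (b.equivFun ≪≫ₗ Matrix.toLin'OfInv h2 h1)
  refine ⟨b', ?_⟩
  apply b'.equivFun.injective
  have e1 : b.equivFun 1 = ![p, q] := by
    rw [hpq, map_add, map_smul, map_smul]
    ext i
    fin_cases i <;> simp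
  have e2 : b'.equivFun = b.equivFun ≪≫ₗ Matrix.toLin'OfInv h2 h1 :=
    Module.Basis.equivFun_ofEquivFun _
  have e3 : b'.equivFun 1 = ![1, 0] := by
    rw [e2, LinearEquiv.trans_apply, e1]
    change Matrix.toLin' !![u, v; -q, p] ![p, q] = _
    rw [Matrix.toLin'_apply]
    ext i
    fin_cases i <;> simp <;> linarith
  rw [e3]
  ext i
  fin_cases i <;> simp

open NumberField in
/-- Coordinates on a quadratic field. -/
theorem exists_quadraticCoords (k : Type*) [Field k] [NumberField k]
    (hk : Module.finrank ℚ k = 2) : ∃ B : QuadraticCoords k, B.disc = NumberField.discr k := by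
  obtain ⟨b, hb⟩ := exists_integralBasis_one k hk
  set t : ℤ := b.repr (b 1 * b 1) 1 with ht
  set n : ℤ := -b.repr (b 1 * b 1) 0 with hn
  have hw : b 1 * b 1 = t • b 1 - (n : 𝓞 k) := by
    have h := b.sum_repr (b 1 * b 1)
    rw [Fin.sum_univ_two, hb] at h
    rw [← h, hn, ht]
    simp only [zsmul_eq_mul]
    push_cast
    ring
  have hdisc : t ^ 2 - 4 * n = NumberField.discr k := by
    rw [← NumberField.discr_eq_discr k b]
    have t1 : Algebra.trace ℤ (𝓞 k) 1 = 2 := by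
      have := Algebra.trace_algebraMap_of_basis b 1
      simpa using this
    have tw : Algebra.trace ℤ (𝓞 k) (b 1) = t := by
      rw [Algebra.trace_eq_matrix_trace b, Matrix.trace, Fin.sum_univ_two]
      simp only [Matrix.diag, Algebra.leftMulMatrix_eq_repr_mul, hb, mul_one]
      rw [b.repr_self, Finsupp.single_apply, if_neg (by decide), zero_add]
    have tww : Algebra.trace ℤ (𝓞 k) (b 1 * b 1) = t ^ 2 - 2 * n := by
      have e : b 1 * b 1 = t • b 1 - n • (1 : 𝓞 k) := by rw [hw]; simp
      rw [e, map_sub, map_smul, map_smul, t1, tw]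
      simp only [smul_eq_mul]; ring
    rw [Algebra.discr_def, Matrix.det_fin_two]
    simp only [Algebra.traceMatrix_apply, Algebra.traceForm_apply, hb, one_mul, mul_one, t1, tw, tww]
    ring
  let bk := b.localizationLocalization ℚ (nonZeroDivisors ℤ) k
  set w : k := algebraMap (𝓞 k) k (b 1) with hwdef
  have hbk0 : bk 0 = 1 := by
    rw [Module.Basis.localizationLocalization_apply, hb, map_one]
  have hbk1 : bk 1 = w := Module.Basis.localizationLocalization_apply ..
  have hww : w * w = (t : k) * w - n := by
    rw [hwdef, ← map_mul, hw]
    simp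
  let co : k ≃ₗ[ℚ] ℚ × ℚ := bk.equivFun ≪≫ₗ LinearEquiv.finTwoArrow ℚ ℚ
  have hco : ∀ x y : ℚ, co (algebraMap ℚ k x + algebraMap ℚ k y * w) = (x, y) := by
    intro x y
    have h : algebraMap ℚ k x + algebraMap ℚ k y * w = x • bk 0 + y • bk 1 := by
      rw [hbk0, hbk1, Algebra.smul_def, Algebra.smul_def, mul_one]
    rw [h]
    change LinearEquiv.finTwoArrow ℚ ℚ (bk.equivFun _) = _
    rw [map_add, map_smul, map_smul]
    simp
  have hz : ∀ z : k, z = algebraMap ℚ k (co z).1 + algebraMap ℚ k (co z).2 * w := fun z =>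
    co.injective (by rw [hco])
  refine ⟨⟨t, n, co, ?_, ?_, ?_, ?_⟩, hdisc⟩
  · have := hco 1 0
    simpa using this
  · intro x y
    rw [← hco]
    congr 1
    conv_lhs => rw [hz x, hz y]
    simp only [map_sub, map_add, map_mul, map_intCast]
    linear_combination algebraMap ℚ k (co x).2 * algebraMap ℚ k (co y).2 * hww
  · intro z
    constructor
    · intro h
      obtain ⟨y, rfl⟩ : ∃ y : 𝓞 k, algebraMap (𝓞 k) k y = z := ⟨⟨z, h⟩, rfl⟩
      have hy := b.localizationLocalization_repr_algebraMap ℚ (nonZeroDivisors ℤ) k y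
      exact ⟨⟨b.repr y 0, hy 0⟩, b.repr y 1, hy 1⟩
    · rintro ⟨⟨x, hx⟩, y, hy⟩
      rw [hz z, hx, hy, map_intCast, map_intCast]
      exact add_mem (intCast_mem _ _) (mul_mem (intCast_mem _ _) (b 1).2)
  · rw [hdisc]; exact NumberField.discr_ne_zero k

/-- Coordinates on `ℚ × ℚ`. -/
def prodCoords : QuadraticCoords (ℚ × ℚ) where
  t := 1
  n := 0
  coord :=
    { toFun := fun z => (z.1, z.2 - z.1)
      invFun := fun z => (z.1, z.1 + z.2)
      map_add' := fun x y => by ext <;> simp; ring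
      map_smul' := fun c x => by ext <;> simp; ring
      left_inv := fun x => by ext <;> simp
      right_inv := fun x => by ext <;> simp }
  coord_one := by ext <;> simp
  coord_mul x y := by ext <;> simp; ring
  mem_integralClosure z := by
    have hint : ∀ q : ℚ, IsIntegral ℤ q ↔ ∃ a : ℤ, q = a := fun q => by
      rw [IsIntegrallyClosed.isIntegral_iff]
      exact ⟨fun ⟨a, h⟩ => ⟨a, h.symm⟩, fun ⟨a, h⟩ => ⟨a, h.symm⟩⟩
    change IsIntegral ℤ z ↔ (∃ a : ℤ, z.1 = a) ∧ ∃ b : ℤ, z.2 - z.1 = b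
    constructor
    · intro h
      obtain ⟨a, ha⟩ := (hint _).1 (h.map (RingHom.fst ℚ ℚ).toIntAlgHom)
      obtain ⟨b, hb⟩ := (hint _).1 (h.map (RingHom.snd ℚ ℚ).toIntAlgHom)
      change z.1 = a at ha
      change z.2 = b at hb
      exact ⟨⟨a, ha⟩, b - a, by rw [ha, hb]; push_cast; ring⟩
    · rintro ⟨⟨a, ha⟩, b, hb⟩
      have e : z = (a : ℚ × ℚ) + (b : ℚ × ℚ) * (0, 1) := by
        ext
        · simp [ha]
        · simp; linarith
      have h1 : IsIntegral ℤ ((0, 1) : ℚ × ℚ) := by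
        refine ⟨Polynomial.X ^ 2 - Polynomial.X, by monicity!, ?_⟩
        rw [Polynomial.eval₂_sub, Polynomial.eval₂_X_pow, Polynomial.eval₂_X]
        ext <;> simp
      rw [e]
      exact (isIntegral_intCast _).add ((isIntegral_intCast _).mul h1)
  disc_ne_zero := by norm_num

lemma t_prodCoords : prodCoords.t = 1 := rfl

lemma n_prodCoords : prodCoords.n = 0 := rfl

lemma disc_prodCoords : prodCoords.disc = 1 := rfl

attribute [irreducible] prodCoords

namespace QuadraticField

/-- Coordinates on a quadratic subfield of `ℂ`. -/
noncomputable def coords (k : QuadraticField) : QuadraticCoords k.1 :=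
  (exists_quadraticCoords k.1 k.2).choose

lemma disc_coords (k : QuadraticField) : k.coords.disc = NumberField.discr k.1 :=
  (exists_quadraticCoords k.1 k.2).choose_spec

/-- The square root `2 w - t` of the discriminant. -/
noncomputable def sqrtDisc (k : QuadraticField) : k.1 := k.coords.elt (-k.coords.t) 2

lemma sqrtDisc_sq (k : QuadraticField) :
    k.sqrtDisc ^ 2 = algebraMap ℚ k.1 k.coords.disc := by
  apply k.coords.ext
  · rw [pow_two, k.coords.re_mul, k.coords.re_algebraMap]
    simp [sqrtDisc, QuadraticCoords.disc]; ring
  · rw [pow_two, k.coords.im_mul, k.coords.im_algebraMap]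
    simp [sqrtDisc]; ring

lemma coe_sqrtDisc_sq (k : QuadraticField) : (k.sqrtDisc : ℂ) ^ 2 = k.coords.disc := by
  have := congrArg (fun z : k.1 => (z : ℂ)) k.sqrtDisc_sq
  simpa using this

lemma exists_eq_sqrtDisc (k : QuadraticField) (z : k.1) :
    ∃ p q : ℚ, z = algebraMap ℚ k.1 p + algebraMap ℚ k.1 q * k.sqrtDisc := by
  refine ⟨k.coords.re z + k.coords.t * k.coords.im z / 2, k.coords.im z / 2, ?_⟩
  apply k.coords.ext
  · rw [k.coords.re_add, k.coords.re_mul, k.coords.re_algebraMap, k.coords.re_algebraMap,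
      k.coords.im_algebraMap]
    simp [sqrtDisc]; ring
  · rw [k.coords.im_add, k.coords.im_mul, k.coords.im_algebraMap, k.coords.re_algebraMap,
      k.coords.im_algebraMap]
    simp [sqrtDisc]

lemma not_isSquare_disc (k : QuadraticField) : ¬IsSquare k.coords.disc := by
  rintro ⟨m, hm⟩
  have h := k.sqrtDisc_sq
  rw [hm, Int.cast_mul, map_mul] at h
  have h2 : (k.sqrtDisc - algebraMap ℚ k.1 m) * (k.sqrtDisc + algebraMap ℚ k.1 m) = 0 := by
    linear_combination h
  have h3 : k.coords.im k.sqrtDisc = 2 := by simp [sqrtDisc]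
  rcases mul_eq_zero.1 h2 with h | h
  · have := congrArg k.coords.im h
    rw [k.coords.im_sub, k.coords.im_algebraMap, h3, k.coords.im_zero] at this
    norm_num at this
  · have := congrArg k.coords.im h
    rw [k.coords.im_add, k.coords.im_algebraMap, h3, k.coords.im_zero] at this
    norm_num at this

lemma le_of_disc_eq {k k' : QuadraticField} {r r' : ℚ} (hr' : r' ≠ 0)
    (h : (k.coords.disc : ℚ) * r ^ 2 = k'.coords.disc * r' ^ 2) : k'.1 ≤ k.1 := by
  have h1 : ((k'.sqrtDisc : ℂ) * r' - k.sqrtDisc * r) * (k'.sqrtDisc * r' + k.sqrtDisc * r) = 0 := by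
    have h' : (k.coords.disc : ℂ) * r ^ 2 = k'.coords.disc * r' ^ 2 := by exact_mod_cast h
    linear_combination (r' : ℂ) ^ 2 * k'.coe_sqrtDisc_sq - (r : ℂ) ^ 2 * k.coe_sqrtDisc_sq - h'
  have hr : (r' : ℂ) ≠ 0 := by exact_mod_cast hr'
  have hQ : ∀ q : ℚ, (q : ℂ) ∈ k.1 := fun q => k.1.algebraMap_mem q
  have hs : (k'.sqrtDisc : ℂ) ∈ k.1 := by
    have hm : (k.sqrtDisc : ℂ) * r / r' ∈ k.1 := div_mem (mul_mem k.sqrtDisc.2 (hQ r)) (hQ r')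
    rcases mul_eq_zero.1 h1 with h2 | h2
    · have e : (k'.sqrtDisc : ℂ) = k.sqrtDisc * r / r' := by
        rw [eq_div_iff hr]; linear_combination h2
      rw [e]; exact hm
    · have e : (k'.sqrtDisc : ℂ) = -(k.sqrtDisc * r / r') := by
        rw [← neg_div, eq_div_iff hr]; linear_combination h2
      rw [e]; exact neg_mem hm
  intro z hz
  obtain ⟨p, q, hpq⟩ := k'.exists_eq_sqrtDisc ⟨z, hz⟩
  have e : z = (p : ℂ) + q * k'.sqrtDisc := by
    have := congrArg (fun z : k'.1 => (z : ℂ)) hpq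
    simpa using this
  rw [e]
  exact add_mem (hQ p) (mul_mem (hQ q) hs)

/-- The class of the discriminant modulo squares determines a quadratic field. -/
theorem eq_of_disc_eq {k k' : QuadraticField} {r r' : ℚ} (hr : r ≠ 0) (hr' : r' ≠ 0)
    (h : (k.coords.disc : ℚ) * r ^ 2 = k'.coords.disc * r' ^ 2) : k = k' :=
  Subtype.ext (le_antisymm (le_of_disc_eq hr h.symm) (le_of_disc_eq hr' h))

open Polynomial in
/-- Every class of nonsquare rational numbers modulo squares contains the discriminant of a
quadratic field. -/
theorem exists_disc_eq (D : ℤ) (hD : ¬IsSquare D) :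
    ∃ (k : QuadraticField) (r : ℚ), (D : ℚ) = k.coords.disc * r ^ 2 := by
  have hD' : ¬IsSquare (D : ℚ) := by rwa [Rat.isSquare_intCast_iff]
  obtain ⟨α, hα⟩ := IsAlgClosed.exists_pow_nat_eq (D : ℂ) two_pos
  have hmonic : (X ^ 2 - C (D : ℚ)).Monic := monic_X_pow_sub_C _ two_ne_zero
  have hdeg : (X ^ 2 - C (D : ℚ)).natDegree = 2 := natDegree_X_pow_sub_C
  have hirr : Irreducible (X ^ 2 - C (D : ℚ)) := by
    refine irreducible_of_degree_le_three_of_not_isRoot (by rw [hdeg]; decide) fun x hx => hD' ?_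
    rw [IsRoot.def, eval_sub, eval_pow, eval_X, eval_C, sub_eq_zero] at hx
    exact ⟨x, by rw [← hx, pow_two]⟩
  have hroot : aeval α (X ^ 2 - C (D : ℚ)) = 0 := by simp [hα]
  have hint : IsIntegral ℚ α := ⟨_, hmonic, by simpa [aeval_def] using hroot⟩
  have hfin : Module.finrank ℚ (IntermediateField.adjoin ℚ {α}) = 2 := by
    rw [IntermediateField.adjoin.finrank hint, ← minpoly.eq_of_irreducible_of_monic hirr hroot hmonic,
      hdeg]
  let k : QuadraticField := ⟨IntermediateField.adjoin ℚ {α}, hfin⟩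
  let a : k.1 := ⟨α, IntermediateField.mem_adjoin_simple_self ℚ α⟩
  obtain ⟨p, q, hpq⟩ := k.exists_eq_sqrtDisc a
  have ha : a ^ 2 = algebraMap ℚ k.1 D := Subtype.ext (by simpa using hα)
  have e : a ^ 2 = algebraMap ℚ k.1 (p ^ 2 + q ^ 2 * k.coords.disc) +
      algebraMap ℚ k.1 (2 * p * q) * k.sqrtDisc := by
    rw [hpq]
    simp only [map_add, map_mul, map_pow, map_ofNat]
    linear_combination (algebraMap ℚ k.1 q) ^ 2 * k.sqrtDisc_sq
  rw [ha] at e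
  have him := congrArg k.coords.im e
  have hre := congrArg k.coords.re e
  have hs : k.coords.im k.sqrtDisc = 2 := by simp [sqrtDisc]
  rw [k.coords.im_add, k.coords.im_mul, k.coords.re_algebraMap, k.coords.im_algebraMap,
    k.coords.im_algebraMap, k.coords.im_algebraMap, hs] at him
  rw [k.coords.re_add, k.coords.re_mul, k.coords.re_algebraMap, k.coords.re_algebraMap,
    k.coords.im_algebraMap, k.coords.re_algebraMap] at hre
  have hpq0 : p * q = 0 := by linarith
  rw [mul_assoc 2 p q, hpq0] at hre
  simp only [mul_zero, zero_mul, sub_zero, add_zero] at hre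
  rcases mul_eq_zero.1 hpq0 with rfl | rfl
  · exact ⟨k, q, by rw [hre]; ring⟩
  · exact absurd ⟨p, by rw [hre]; ring⟩ hD'

lemma isTotallyComplex_iff (k : QuadraticField) :
    NumberField.IsTotallyComplex k.1 ↔ k.coords.disc < 0 := by
  have h1 := NumberField.InfinitePlace.card_add_two_mul_card_eq_rank k.1
  rw [k.2] at h1
  have h2 := NumberField.sign_discr k.1
  rw [← NumberField.nrRealPlaces_eq_zero_iff, disc_coords, ← Int.sign_eq_neg_one_iff_neg, h2]
  constructor
  · intro h
    have : NumberField.InfinitePlace.nrComplexPlaces k.1 = 1 := by omega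
    rw [this, pow_one]
  · intro h
    have : NumberField.InfinitePlace.nrComplexPlaces k.1 ≠ 0 := by
      intro h0
      rw [h0] at h
      norm_num at h
    omega

lemma isTotallyReal_iff (k : QuadraticField) :
    NumberField.IsTotallyReal k.1 ↔ 0 < k.coords.disc := by
  have h1 := NumberField.InfinitePlace.card_add_two_mul_card_eq_rank k.1
  rw [k.2] at h1
  have h2 := NumberField.sign_discr k.1
  rw [← NumberField.nrComplexPlaces_eq_zero_iff, disc_coords, ← Int.sign_eq_one_iff_pos, h2]
  constructor
  · intro h
    rw [h, pow_zero]
  · intro h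
    have : NumberField.InfinitePlace.nrComplexPlaces k.1 ≠ 1 := by
      intro h0
      rw [h0] at h
      norm_num at h
    omega

end QuadraticField

/-! ### Dirichlet series over the parameters -/

/-- The parameters of `CubicParam A` over one conductor. -/
abbrev CubicFiber (A : Type*) [CommRing A] (c : ℕ+) : Type _ :=
  Σ a : IntegralIdeal (conductorOrder A c),
    {C : OrderClassGroup (conductorOrder A c) // C ^ 3 = a.cls} × UnitsModCubes A c

lemma ofReal_sq_cpow_neg {x : ℝ} (hx : 0 < x) (s : ℂ) :
    ((x ^ 2 : ℝ) : ℂ) ^ (-s) = (x : ℂ) ^ (-(2 * s)) := by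
  have h : (x : ℂ) ≠ 0 := by exact_mod_cast hx.ne'
  rw [pow_two, Complex.ofReal_mul, Complex.mul_cpow_ofReal_nonneg hx.le hx.le,
    ← Complex.cpow_add _ _ h]
  congr 1; ring

lemma cpow_neg_disc {d x y : ℝ} (hd : 0 < d) (hx : 0 < x) (hy : 0 < y) (s : ℂ) :
    ((d * x ^ 2 * y ^ 2 : ℝ) : ℂ) ^ (-s) =
      1 / (d : ℂ) ^ s * (1 / (x : ℂ) ^ (2 * s) * (y : ℂ) ^ (-(2 * s))) := by
  rw [Complex.ofReal_mul, Complex.mul_cpow_ofReal_nonneg (by positivity) (by positivity),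
    Complex.ofReal_mul, Complex.mul_cpow_ofReal_nonneg (by positivity) (by positivity),
    ofReal_sq_cpow_neg hx, ofReal_sq_cpow_neg hy, Complex.cpow_neg, Complex.cpow_neg]
  ring

namespace QuadraticCoords

/-- The series over one conductor. The number of units modulo cubes is absorbed in `κ`; as `κ` is
not zero, this number is finite. -/
lemma hasSum_fiber {A : Type*} [CommRing A] [Algebra ℚ A] (B : QuadraticCoords A) (c : ℕ+)
    {w : ℂ} (hw : 2 < w.re) {ω κ : ℂ} (hκ : κ ≠ 0) (h : ω * Nat.card (UnitsModCubes A c) = κ)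
    (hs : Summable fun x : CubicFiber A c => ω * (x.1.norm : ℂ) ^ (-w)) :
    HasSum (fun x : CubicFiber A c => ω * (x.1.norm : ℂ) ^ (-w)) (κ * cubicLSum A c w) := by
  have hfin : Finite (UnitsModCubes A c) := Nat.finite_of_card_ne_zero fun h0 => by
    rw [h0, Nat.cast_zero, mul_zero] at h
    exact hκ h.symm
  have := B.finite_orderClassGroup c
  convert hs.hasSum using 1
  rw [hs.tsum_sigma, B.cubicLSum_eq c hw, ← tsum_mul_left]
  refine tsum_congr fun a => ?_
  have := Fintype.ofFinite {C : OrderClassGroup (conductorOrder A c) // C ^ 3 = a.cls}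
  have := Fintype.ofFinite (UnitsModCubes A c)
  dsimp only
  rw [tsum_fintype, Finset.sum_const, Finset.card_univ, ← Nat.card_eq_fintype_card,
    Nat.card_prod, nsmul_eq_mul, ← h]
  push_cast
  ring

/-- The series over the parameters of a family of quadratic algebras. -/
theorem tsum_family {ι : Type} {A : ι → Type} [∀ i, CommRing (A i)] [∀ i, Algebra ℚ (A i)]
    (B : ∀ i, QuadraticCoords (A i)) {s : ℂ} (hs : 1 < s.re) {κ : ℂ} (hκ : κ ≠ 0)
    (ω : ∀ _ : ι, ℕ+ → ℂ) (hω : ∀ i c, ω i c * Nat.card (UnitsModCubes (A i) c) = κ)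
    (hsum : Summable fun p : Σ i, CubicParam (A i) => ω p.1 p.2.1 *
      ((|((B p.1).disc : ℝ)| * (p.2.1 : ℕ) ^ 2 * p.2.2.1.norm ^ 2 : ℝ) : ℂ) ^ (-s)) :
    (Summable fun p : ι × ℕ+ => κ / ((|(B p.1).disc| : ℤ) : ℂ) ^ s *
      (1 / (p.2 : ℂ) ^ (2 * s) * cubicLSum (A p.1) p.2 (2 * s))) ∧
    (∑' p : Σ i, CubicParam (A i), ω p.1 p.2.1 *
      ((|((B p.1).disc : ℝ)| * (p.2.1 : ℕ) ^ 2 * p.2.2.1.norm ^ 2 : ℝ) : ℂ) ^ (-s)) =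
    ∑' i, κ / ((|(B i).disc| : ℤ) : ℂ) ^ s *
      ∑' c : ℕ+, 1 / (c : ℂ) ^ (2 * s) * cubicLSum (A i) c (2 * s) := by
  have hw : 2 < (2 * s).re := by simp; linarith
  set g : (Σ i, CubicParam (A i)) → ℂ := fun p => ω p.1 p.2.1 *
      ((|((B p.1).disc : ℝ)| * (p.2.1 : ℕ) ^ 2 * p.2.2.1.norm ^ 2 : ℝ) : ℂ) ^ (-s) with hg
  let e : (Σ p : ι × ℕ+, CubicFiber (A p.1) p.2) ≃ Σ i, CubicParam (A i) :=
    { toFun := fun x => ⟨x.1.1, x.1.2, x.2⟩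
      invFun := fun x => ⟨(x.1, x.2.1), x.2.2⟩
      left_inv := fun _ => rfl
      right_inv := fun _ => rfl }
  have hge : ∀ x, g (e x) = 1 / ((|(B x.1.1).disc| : ℤ) : ℂ) ^ s * (1 / (x.1.2 : ℂ) ^ (2 * s)) *
      (ω x.1.1 x.1.2 * (x.2.1.norm : ℂ) ^ (-(2 * s))) := by
    intro x
    change ω x.1.1 x.1.2 * ((|((B x.1.1).disc : ℝ)| * (x.1.2 : ℕ) ^ 2 * x.2.1.norm ^ 2 : ℝ) : ℂ) ^
      (-s) = _
    have hd : (0 : ℝ) < |((B x.1.1).disc : ℝ)| :=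
      abs_pos.2 (by exact_mod_cast (B x.1.1).disc_ne_zero)
    rw [cpow_neg_disc hd (by exact_mod_cast x.1.2.pos)
      (by exact_mod_cast (B x.1.1).norm_pos x.2.1)]
    have h1 : ((|((B x.1.1).disc : ℝ)| : ℝ) : ℂ) = ((|(B x.1.1).disc| : ℤ) : ℂ) := by
      rw [← Int.cast_abs, Complex.ofReal_intCast]
    rw [h1, Complex.ofReal_natCast, Complex.ofReal_natCast]
    ring
  have hsum' : Summable fun x => g (e x) := (e.summable_iff (f := g)).2 hsum
  have hfib : ∀ p : ι × ℕ+, HasSum (fun y => g (e ⟨p, y⟩))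
      (κ / ((|(B p.1).disc| : ℤ) : ℂ) ^ s *
        (1 / (p.2 : ℂ) ^ (2 * s) * cubicLSum (A p.1) p.2 (2 * s))) := by
    intro p
    have h0 : 1 / ((|(B p.1).disc| : ℤ) : ℂ) ^ s * (1 / (p.2 : ℂ) ^ (2 * s)) ≠ 0 := by
      have h1 : ((|(B p.1).disc| : ℤ) : ℂ) ≠ 0 := by
        exact_mod_cast abs_ne_zero.2 (B p.1).disc_ne_zero
      have h2 : (p.2 : ℂ) ≠ 0 := by exact_mod_cast p.2.ne_zero
      have h3 := Complex.cpow_ne_zero_iff_of_exponent_ne_zero (x := ((|(B p.1).disc| : ℤ) : ℂ))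
        (y := s) (by rintro rfl; simp at hs; linarith)
      have h4 := Complex.cpow_ne_zero_iff_of_exponent_ne_zero (x := (p.2 : ℂ))
        (y := 2 * s) (by rintro h; rw [h] at hw; simp at hw; linarith)
      exact mul_ne_zero (one_div_ne_zero (h3.2 h1)) (one_div_ne_zero (h4.2 h2))
    have h1 : Summable fun y => g (e ⟨p, y⟩) :=
      hsum'.comp_injective (i := Sigma.mk p) sigma_mk_injective
    simp only [hge] at h1 ⊢
    rw [summable_mul_left_iff h0] at h1
    have h2 := ((B p.1).hasSum_fiber p.2 hw hκ (hω p.1 p.2) h1).mul_left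
      (1 / ((|(B p.1).disc| : ℤ) : ℂ) ^ s * (1 / (p.2 : ℂ) ^ (2 * s)))
    have h3 : κ / ((|(B p.1).disc| : ℤ) : ℂ) ^ s *
        (1 / (p.2 : ℂ) ^ (2 * s) * cubicLSum (A p.1) p.2 (2 * s)) =
        1 / ((|(B p.1).disc| : ℤ) : ℂ) ^ s * (1 / (p.2 : ℂ) ^ (2 * s)) *
          (κ * cubicLSum (A p.1) p.2 (2 * s)) := by ring
    rw [h3]
    exact h2
  have hS := hsum'.hasSum.sigma hfib
  refine ⟨hS.summable, ?_⟩
  rw [← e.tsum_eq g, ← hS.tsum_eq, hS.summable.tsum_prod]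
  exact tsum_congr fun i => tsum_mul_left (a := κ / ((|(B i).disc| : ℤ) : ℂ) ^ s)
    (f := fun c : ℕ+ => 1 / (c : ℂ) ^ (2 * s) * cubicLSum (A i) c (2 * s))

/-- A parametrization of the dual forms whose discriminant lies in the class of `-3 disc A`
modulo squares. -/
noncomputable def form {A : Type*} [CommRing A] [Algebra ℚ A] (B : QuadraticCoords A) :
    CubicParam A → BinaryCubicForm := B.exists_parametrization.choose

section form

variable {A : Type*} [CommRing A] [Algebra ℚ A] (B : QuadraticCoords A)

lemma form_isDual (p : CubicParam A) : (B.form p).IsDual :=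
  (B.exists_parametrization.choose_spec.1 p).1

lemma form_disc (p : CubicParam A) :
    (B.form p).disc = -27 * (B.disc * p.1 ^ 2 * p.2.1.norm ^ 2) :=
  (B.exists_parametrization.choose_spec.1 p).2.1

lemma form_stabCard (p : CubicParam A) :
    (B.form p).stabCard = Nat.card {u : (conductorOrder A p.1)ˣ // u ^ 3 = 1} :=
  (B.exists_parametrization.choose_spec.1 p).2.2

lemma form_inj {p p' : CubicParam A} (γ : SL(2, ℤ)) (h : B.form p' = γ • B.form p) : p = p' :=
  B.exists_parametrization.choose_spec.2.1 p p' γ h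

lemma exists_form_eq {f : BinaryCubicForm} {r : ℚ} (hf : f.IsDual) (hr : r ≠ 0)
    (h : (f.disc : ℚ) = -27 * (B.disc * r ^ 2)) : ∃ p, ∃ γ : SL(2, ℤ), f = γ • B.form p :=
  B.exists_parametrization.choose_spec.2.2 f r hf hr h

lemma sqrt_index_ne_zero {A : Type*} [CommRing A] [Algebra ℚ A] (B : QuadraticCoords A)
    (p : CubicParam A) : ((p.1 : ℕ) * p.2.1.norm : ℚ) ≠ 0 :=
  mul_ne_zero (by exact_mod_cast p.1.ne_zero) (by exact_mod_cast (B.norm_pos p.2.1).ne')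

lemma form_disc_rat (p : CubicParam A) :
    ((B.form p).disc : ℚ) = -27 * (B.disc * ((p.1 : ℕ) * p.2.1.norm : ℚ) ^ 2) := by
  rw [form_disc]; push_cast; ring

lemma form_disc_pos (hB : B.disc < 0) (p : CubicParam A) : 0 < (B.form p).disc := by
  have h : (0 : ℚ) < (B.form p).disc := by
    rw [form_disc_rat]
    have : (B.disc : ℚ) < 0 := by exact_mod_cast hB
    have := mul_neg_of_neg_of_pos this (pow_two_pos_of_ne_zero (B.sqrt_index_ne_zero p))
    linarith
  exact_mod_cast h

lemma form_disc_neg (hB : 0 < B.disc) (p : CubicParam A) : (B.form p).disc < 0 := by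
  have h : ((B.form p).disc : ℚ) < 0 := by
    rw [form_disc_rat]
    have : (0 : ℚ) < B.disc := by exact_mod_cast hB
    have := mul_pos this (pow_two_pos_of_ne_zero (B.sqrt_index_ne_zero p))
    linarith
  exact_mod_cast h

lemma exists_disc_mul_sq_eq {A' : Type*} [CommRing A'] [Algebra ℚ A'] (B' : QuadraticCoords A')
    {p : CubicParam A} {p' : CubicParam A'} (h : (B.form p).disc = (B'.form p').disc) :
    ∃ r r' : ℚ, r ≠ 0 ∧ r' ≠ 0 ∧ (B.disc : ℚ) * r ^ 2 = B'.disc * r' ^ 2 := by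
  have h1 := B.form_disc_rat p
  rw [h, form_disc_rat] at h1
  exact ⟨_, _, B.sqrt_index_ne_zero p, B'.sqrt_index_ne_zero p', by linarith⟩

lemma form_discPow (p : CubicParam A) (s : ℂ) : (B.form p).discPow s =
    ((|(B.disc : ℝ)| * (p.1 : ℕ) ^ 2 * p.2.1.norm ^ 2 : ℝ) : ℂ) ^ (-s) := by
  have h : (((B.form p).disc : ℤ) : ℝ) / 27 = -(B.disc * (p.1 : ℕ) ^ 2 * p.2.1.norm ^ 2) := by
    rw [form_disc]; push_cast; ring
  rw [BinaryCubicForm.discPow, h, abs_neg, abs_mul, abs_mul, abs_pow, abs_pow, Nat.abs_cast,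
    Nat.abs_cast]

end form

end QuadraticCoords

/-! ### Orbits and parameters -/

/-- A set of forms that represents every orbit in `S` exactly once. -/
lemma bijective_orbit {J : Type*} (S : SubMulAction SL(2, ℤ) BinaryCubicForm)
    (F : J → BinaryCubicForm) (hF : ∀ j, F j ∈ S)
    (hinj : ∀ j j' (γ : SL(2, ℤ)), F j' = γ • F j → j = j')
    (hsurj : ∀ f ∈ S, ∃ j, ∃ γ : SL(2, ℤ), f = γ • F j) :
    Function.Bijective fun j =>
      (Quotient.mk'' ⟨F j, hF j⟩ : MulAction.orbitRel.Quotient SL(2, ℤ) S) := by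
  constructor
  · intro j j' h
    obtain ⟨γ, hγ⟩ := Quotient.exact h
    exact (hinj j' j γ (congrArg Subtype.val hγ).symm).symm
  · intro ω
    induction ω using Quotient.inductionOn' with
    | h x =>
      obtain ⟨j, γ, hγ⟩ := hsurj x.1 x.2
      exact ⟨j, Quotient.sound ⟨γ⁻¹, Subtype.ext (by
        change γ⁻¹ • x.1 = F j
        rw [hγ, inv_smul_smul])⟩⟩

lemma norm_discPow {x : BinaryCubicForm} (hx : x.disc ≠ 0) (s : ℂ) :
    ‖x.discPow s‖ = |(x.disc : ℝ) / 27| ^ (-s.re) := by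
  rw [BinaryCubicForm.discPow, Complex.norm_cpow_eq_rpow_re_of_pos, Complex.neg_re]
  exact abs_pos.2 (div_ne_zero (by exact_mod_cast hx) (by norm_num))

theorem summable_shintaniDualTerm₁ {s : ℂ} (hs : 1 < s.re) : Summable (shintaniDualTerm₁ s) := by
  have hS : ∀ x ∈ BinaryCubicForm.dualPos, x.disc ≠ 0 := fun x hx => ne_of_gt hx.2
  refine Summable.of_norm_bounded (BinaryCubicForm.summable_disc_rpow hs _ hS) fun ω => ?_
  have e : shintaniDualTerm₁ s ω =
      1 / ((Quotient.out ω).1.stabCard : ℂ) * (Quotient.out ω).1.discPow s := by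
    conv_lhs => rw [← Quotient.out_eq ω]
    rfl
  rw [e, norm_mul, norm_discPow (hS _ (Quotient.out ω).2)]
  refine mul_le_of_le_one_left (by positivity) ?_
  rw [norm_div, norm_one, Complex.norm_natCast, one_div]
  exact Nat.cast_inv_le_one _

theorem summable_shintaniDualTerm₂ {s : ℂ} (hs : 1 < s.re) : Summable (shintaniDualTerm₂ s) := by
  have hS : ∀ x ∈ BinaryCubicForm.dualNeg, x.disc ≠ 0 := fun x hx => ne_of_lt hx.2
  refine Summable.of_norm_bounded (BinaryCubicForm.summable_disc_rpow hs _ hS) fun ω => ?_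
  have e : shintaniDualTerm₂ s ω = (Quotient.out ω).1.discPow s := by
    conv_lhs => rw [← Quotient.out_eq ω]
    rfl
  rw [e, norm_discPow (hS _ (Quotient.out ω).2)]

/-- The class of `-3 disc` modulo squares determines a quadratic field, or is trivial. -/
lemma exists_discriminant_class {f : BinaryCubicForm} (hf : f.disc ≠ 0) :
    (∃ (k : QuadraticField) (r : ℚ), r ≠ 0 ∧ (f.disc : ℚ) = -27 * (k.coords.disc * r ^ 2)) ∨
      ∃ r : ℚ, r ≠ 0 ∧ (f.disc : ℚ) = -27 * r ^ 2 := by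
  have hf' : (f.disc : ℚ) ≠ 0 := by exact_mod_cast hf
  by_cases h : IsSquare (-3 * f.disc)
  · obtain ⟨m, hm⟩ := h
    have hm' : (-3 * f.disc : ℚ) = m * m := by exact_mod_cast hm
    have e : (f.disc : ℚ) = -27 * ((m : ℚ) / 9) ^ 2 := by linear_combination -hm' / 3
    refine Or.inr ⟨m / 9, fun h0 => hf' ?_, e⟩
    rw [e, h0]; ring
  · obtain ⟨k, r, hr⟩ := QuadraticField.exists_disc_eq _ h
    push_cast at hr
    have e : (f.disc : ℚ) = -27 * (k.coords.disc * (r / 9) ^ 2) := by linear_combination -hr / 3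
    refine Or.inl ⟨k, r / 9, fun h0 => hf' ?_, e⟩
    rw [e, h0]; ring

lemma QuadraticField.eq_of_form_eq {k k' : QuadraticField} {p : CubicParam k.1}
    {p' : CubicParam k'.1} {γ : SL(2, ℤ)} (h : k'.coords.form p' = γ • k.coords.form p) :
    k = k' := by
  obtain ⟨r, r', hr, hr', h1⟩ := k.coords.exists_disc_mul_sq_eq k'.coords (p := p) (p' := p')
    ((BinaryCubicForm.disc_smul γ _).symm.trans (congrArg BinaryCubicForm.disc h.symm))
  exact QuadraticField.eq_of_disc_eq hr hr' h1

lemma QuadraticField.form_disc_ne {k : QuadraticField} (p : CubicParam k.1)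
    (p' : CubicParam (ℚ × ℚ)) : (k.coords.form p).disc ≠ (prodCoords.form p').disc := by
  intro h
  obtain ⟨r, r', hr, hr', h1⟩ := k.coords.exists_disc_mul_sq_eq prodCoords h
  rw [disc_prodCoords, Int.cast_one, one_mul] at h1
  apply k.not_isSquare_disc
  rw [← Rat.isSquare_intCast_iff]
  exact ⟨r' / r, by field_simp; linarith⟩

lemma bijective_imaginary : Function.Bijective
    fun j : Σ k : ImaginaryQuadraticField, CubicParam k.1.1 =>
      (Quotient.mk'' ⟨j.1.1.coords.form j.2, j.1.1.coords.form_isDual j.2,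
        j.1.1.coords.form_disc_pos (j.1.1.isTotallyComplex_iff.1 j.1.2) j.2⟩ :
        MulAction.orbitRel.Quotient SL(2, ℤ) BinaryCubicForm.dualPos) := by
  refine bijective_orbit BinaryCubicForm.dualPos
    (fun j : Σ k : ImaginaryQuadraticField, CubicParam k.1.1 => j.1.1.coords.form j.2) _ ?_ ?_
  · rintro ⟨⟨k, hk⟩, p⟩ ⟨⟨k', hk'⟩, p'⟩ γ h
    obtain rfl : k = k' := QuadraticField.eq_of_form_eq h
    obtain rfl := k.coords.form_inj γ h
    rfl
  · rintro f ⟨hf, hpos⟩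
    have hpos' : (0 : ℚ) < f.disc := by exact_mod_cast hpos
    rcases exists_discriminant_class hpos.ne' with ⟨k, r, hr, h⟩ | ⟨r, hr, h⟩
    · have hk : k.coords.disc < 0 := by
        have : (k.coords.disc : ℚ) < 0 := by
          by_contra! h0
          have := mul_nonneg h0 (sq_nonneg r)
          linarith
        exact_mod_cast this
      obtain ⟨p, γ, h⟩ := k.coords.exists_form_eq hf hr h
      exact ⟨⟨⟨k, k.isTotallyComplex_iff.2 hk⟩, p⟩, γ, h⟩
    · have := sq_nonneg r
      linarith

/-- The forms attached to real quadratic fields and to `ℚ × ℚ`. -/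
noncomputable def indefiniteForm :
    (Σ k : RealQuadraticField, CubicParam k.1.1) ⊕ (Σ _ : Unit, CubicParam (ℚ × ℚ)) →
      BinaryCubicForm :=
  Sum.elim (fun j => j.1.1.coords.form j.2) fun j => prodCoords.form j.2

lemma indefiniteForm_mem (j) : indefiniteForm j ∈ BinaryCubicForm.dualNeg := by
  rcases j with j | j
  · exact ⟨j.1.1.coords.form_isDual j.2,
      j.1.1.coords.form_disc_neg (j.1.1.isTotallyReal_iff.1 j.1.2) j.2⟩
  · exact ⟨prodCoords.form_isDual j.2, prodCoords.form_disc_neg (by rw [disc_prodCoords]; decide) j.2⟩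

lemma bijective_indefinite : Function.Bijective fun j =>
    (Quotient.mk'' ⟨indefiniteForm j, indefiniteForm_mem j⟩ :
      MulAction.orbitRel.Quotient SL(2, ℤ) BinaryCubicForm.dualNeg) := by
  refine bijective_orbit BinaryCubicForm.dualNeg indefiniteForm _ ?_ ?_
  · rintro (⟨⟨k, hk⟩, p⟩ | ⟨_, p⟩) (⟨⟨k', hk'⟩, p'⟩ | ⟨_, p'⟩) γ h
    · change k'.coords.form p' = γ • k.coords.form p at h
      obtain rfl : k = k' := QuadraticField.eq_of_form_eq h
      obtain rfl := k.coords.form_inj γ h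
      rfl
    · change prodCoords.form p' = γ • k.coords.form p at h
      refine absurd ?_ (QuadraticField.form_disc_ne p p')
      rw [h, BinaryCubicForm.disc_smul]
    · change k'.coords.form p' = γ • prodCoords.form p at h
      refine absurd ?_ (QuadraticField.form_disc_ne p' p)
      rw [h, BinaryCubicForm.disc_smul]
    · obtain rfl := prodCoords.form_inj γ h
      rfl
  · rintro f ⟨hf, hneg⟩
    have hneg' : (f.disc : ℚ) < 0 := by exact_mod_cast hneg
    rcases exists_discriminant_class hneg.ne with ⟨k, r, hr, h⟩ | ⟨r, hr, h⟩
    · have hk : 0 < k.coords.disc := by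
        have : (0 : ℚ) < k.coords.disc := by
          by_contra! h0
          have := mul_nonneg (neg_nonneg.2 h0) (sq_nonneg r)
          linarith
        exact_mod_cast this
      obtain ⟨p, γ, h⟩ := k.coords.exists_form_eq hf hr h
      exact ⟨Sum.inl ⟨⟨k, k.isTotallyReal_iff.2 hk⟩, p⟩, γ, h⟩
    · obtain ⟨p, γ, h⟩ := prodCoords.exists_form_eq hf hr (by
        rw [disc_prodCoords, h]; push_cast; ring)
      exact ⟨Sum.inr ⟨(), p⟩, γ, h⟩

theorem theorem3p3 (s : ℂ) (hs : 1 < s.re) :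
    -- absolute convergence of all the series that occur
    (Summable (shintaniDualTerm₁ s) ∧
      Summable (shintaniDualTerm₂ s) ∧
      (∀ (k : QuadraticField) (c : ℕ+), CubicLSumConverges k.1 c (2 * s)) ∧
      (∀ c : ℕ+, CubicLSumConverges (ℚ × ℚ) c (2 * s)) ∧
      Summable (fun p : ImaginaryQuadraticField × ℕ+ =>
        1 / p.1.1.absDisc ^ s * (1 / (p.2 : ℂ) ^ (2 * s) * cubicLSum p.1.1.1 p.2 (2 * s))) ∧
      Summable (fun p : RealQuadraticField × ℕ+ =>
        3 / p.1.1.absDisc ^ s * (1 / (p.2 : ℂ) ^ (2 * s) * cubicLSum p.1.1.1 p.2 (2 * s))) ∧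
      Summable (fun c : ℕ+ =>
        1 / (c : ℂ) ^ (2 * s) * cubicLSum (ℚ × ℚ) c (2 * s))) ∧
    -- the two identities
    shintaniDual₁ s =
      ∑' k : ImaginaryQuadraticField, 1 / k.1.absDisc ^ s *
        ∑' c : ℕ+, 1 / (c : ℂ) ^ (2 * s) * cubicLSum k.1.1 c (2 * s) ∧
    shintaniDual₂ s =
      (∑' k : RealQuadraticField, 3 / k.1.absDisc ^ s *
        ∑' c : ℕ+, 1 / (c : ℂ) ^ (2 * s) * cubicLSum k.1.1 c (2 * s)) +
      ∑' c : ℕ+, 1 / (c : ℂ) ^ (2 * s) * cubicLSum (ℚ × ℚ) c (2 * s) := by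
  have hw : 2 < (2 * s).re := by simp; linarith
  have h₁ := summable_shintaniDualTerm₁ hs
  have h₂ := summable_shintaniDualTerm₂ hs
  have habs : ∀ k : QuadraticField, k.absDisc = ((|k.coords.disc| : ℤ) : ℂ) := fun k => by
    rw [QuadraticField.absDisc, k.disc_coords]
  let e₁ := Equiv.ofBijective _ bijective_imaginary
  let e₂ := Equiv.ofBijective _ bijective_indefinite
  have t₁ : ∀ j, shintaniDualTerm₁ s (e₁ j) =
      1 / (Nat.card {u : (conductorOrder j.1.1.1 j.2.1)ˣ // u ^ 3 = 1} : ℂ) *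
      ((|(j.1.1.coords.disc : ℝ)| * (j.2.1 : ℕ) ^ 2 * j.2.2.1.norm ^ 2 : ℝ) : ℂ) ^ (-s) := by
    intro j
    have h := j.1.1.coords.form_discPow j.2 s
    have h' := j.1.1.coords.form_stabCard j.2
    exact congrArg₂ (fun (n : ℕ) z => 1 / (n : ℂ) * z) h' h
  have t₂ : ∀ j, shintaniDualTerm₂ s (e₂ (Sum.inl j)) =
      1 * ((|(j.1.1.coords.disc : ℝ)| * (j.2.1 : ℕ) ^ 2 * j.2.2.1.norm ^ 2 : ℝ) : ℂ) ^ (-s) := by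
    intro j
    exact (j.1.1.coords.form_discPow j.2 s).trans (one_mul _).symm
  have t₃ : ∀ j, shintaniDualTerm₂ s (e₂ (Sum.inr j)) =
      1 * ((|(prodCoords.disc : ℝ)| * (j.2.1 : ℕ) ^ 2 * j.2.2.1.norm ^ 2 : ℝ) : ℂ) ^ (-s) := by
    intro j
    exact (prodCoords.form_discPow j.2 s).trans (one_mul _).symm
  have s₁ := (e₁.summable_iff).2 h₁
  have s₂ := (e₂.summable_iff).2 h₂
  have s₃ := s₂.comp_injective Sum.inr_injective
  have s₂ := s₂.comp_injective Sum.inl_injective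
  have r₁ := QuadraticCoords.tsum_family (ι := ImaginaryQuadraticField) (A := fun k => k.1.1)
    (fun k => k.1.coords) hs (κ := 1) one_ne_zero
    (fun k c => 1 / (Nat.card {u : (conductorOrder k.1.1 c)ˣ // u ^ 3 = 1} : ℂ))
    (fun k c => by
      have := k.1.coords.finite_units_of_disc_neg (k.1.isTotallyComplex_iff.1 k.2) c
      rw [card_quotient_cubes_of_finite]
      have : Nonempty {u : (conductorOrder k.1.1 c)ˣ // u ^ 3 = 1} := ⟨⟨1, one_pow 3⟩⟩
      exact one_div_mul_cancel (by exact_mod_cast Nat.card_pos.ne'))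
    (s₁.congr t₁)
  have r₂ := QuadraticCoords.tsum_family (ι := RealQuadraticField) (A := fun k => k.1.1)
    (fun k => k.1.coords) hs (κ := 3) three_ne_zero (fun _ _ => 1)
    (fun k c => by
      rw [k.1.coords.card_units_mod_cubes_of_real (k.1.isTotallyReal_iff.1 k.2)
        k.1.not_isSquare_disc c]
      norm_num)
    (s₂.congr t₂)
  have r₃ := QuadraticCoords.tsum_family (ι := Unit) (A := fun _ => ℚ × ℚ)
    (fun _ => prodCoords) hs (κ := 1) one_ne_zero (fun _ _ => 1)
    (fun _ c => by
      rw [card_quotient_cubes_of_sq_eq_one _ (prodCoords.unit_sq_eq_one t_prodCoords n_prodCoords)]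
      norm_num)
    (s₃.congr t₃)
  have one_disc : ((|prodCoords.disc| : ℤ) : ℂ) ^ s = 1 := by
    rw [disc_prodCoords]; simp
  simp only [one_disc, div_one, one_mul, tsum_fintype, Finset.univ_unique,
    Finset.sum_singleton] at r₃
  simp only [habs]
  refine ⟨⟨h₁, h₂, fun k c => k.coords.cubicLSumConverges c hw,
    fun c => prodCoords.cubicLSumConverges c hw, r₁.1, r₂.1, ?_⟩, ?_, ?_⟩
  · exact r₃.1.comp_injective (i := fun c : ℕ+ => ((), c)) (Prod.mk_right_injective ())
  · exact (e₁.tsum_eq (shintaniDualTerm₁ s)).symm.trans ((tsum_congr t₁).trans r₁.2)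
  · refine (e₂.tsum_eq (shintaniDualTerm₂ s)).symm.trans ((Summable.tsum_sum s₂ s₃).trans ?_)
    exact congrArg₂ (· + ·) ((tsum_congr t₂).trans r₂.2)
      ((tsum_congr fun j => (t₃ j).trans (one_mul _)).trans r₃.2)
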